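/- Let $\alpha>0$, $\Omega=(0,\alpha)$, $Y=(0,1)$. Let $a\in W^{1,\infty}(\mathbb R)$ and $\rho\in L^\infty(\mathbb R)$ be real-valued and $1$-periodic with $a^0\le a\le a^1$, $\rho^0\le\rho\le\rho^1$ for positive constants $a^0,a^1,\rho^0,\rho^1$. Let $k\in(-\tfrac12,\tfrac12)$ and $I^k=\{k,-k\}$ (so $I^0=\{0\}$). Let $\varepsilon$ run through a sequence tending to $0$ of numbers of the form $\alpha/N$, $N\in\mathbb N^*$. For each such $\varepsilon$ let $\lambda^\varepsilon\in\mathbb R$ and $w^\varepsilon\in H^1_0(\Omega)$ (complex-valued) satisfy $$-\partial_x\big(a(x/\varepsilon)\,\partial_x w^\varepsilon\big)=\lambda^\varepsilon\rho(x/\varepsilon)\,w^\varepsilon\ \text{ in }\Omega,\qquad \|w^\varepsilon\|_{L^2(\Omega)}=1,$$ and assume $\varepsilon^2\lambda^\varepsilon=\lambda^0+\varepsilon\lambda^1+o(\varepsilon)$ with $\lambda^0,\lambda^1\in\mathbb R$. For $\sigma\in\mathbb R$ put $$S^\varepsilon_\sigma u(x,y)=\sum_{l\in\mathbb Z,\ \varepsilon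 l+\varepsilon Y\subset\Omega}u(\varepsilon l+\varepsilon y)\,\chi_{\varepsilon l+\varepsilon Y}(x)\,e^{-2i\pi\sigma l}.$$ A (normalized) Bloch mode for $k$ with eigenvalue $\lambda\in\mathbb R$ is a function $\phi\in H^2_{loc}(\mathbb R)$ with $\phi(y+l)=\phi(y)e^{2i\pi kl}$ for $l\in\mathbb Z$, $-\partial_y(a\,\partial_y\phi)=\lambda\rho\phi$ and $\|\phi\|_{L^2(Y)}=1$; $\lambda$ is a Bloch eigenvalue for $k$ if such a $\phi$ exists. For functions $\phi,\psi$ put $$c(\phi,\psi)=\int_Y \big(a\,\partial_y\psi\,\overline{\phi}-\psi\,a\,\overline{\partial_y\phi}\big)\,dy,\qquad b(\phi,\psi)=\int_Y\rho\,\psi\,\overline{\phi}\,dy .$$ Then $\sum_{\sigma\in I^k}S^\varepsilon_\sigma w^\varepsilon$ is bounded in $L^2(\Omega;H^1(Y))$. Assume moreover that the fractional part of $\alpha k/\varepsilon$ converges to some $l^k$ along the sequence, and that $S^\varepsilon_kw^\varepsilon$ has, at least along a subsequence, a non-zero weak limit in $L^2(\Omega;H^1(Y))$. Then $\lambda^0$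 is a Bloch eigenvalue for $k$, and every weak limit $g_k$ in $L^2(\Omega;H^1(Y))$ of a subsequence of $\sum_{\sigma\in I^k}S^\varepsilon_\sigma w^\varepsilon$ satisfies the following. (i) Case $k\ne0$. Let $\phi^k$ be any normalized Bloch mode for $k$ with eigenvalue $\lambda^0$ and $\phi^{-k}=\overline{\phi^k}$. There are $u^k,u^{-k}\in H^1(\Omega)$ such that $g_k(x,y)=\sum_{\sigma\in I^k}u^\sigma(x)\phi^\sigma(y)$ a.e. in $\Omega\times Y$, $$c(\phi^\sigma,\phi^\sigma)\,\partial_xu^\sigma+\lambda^1\,b(\phi^\sigma,\phi^\sigma)\,u^\sigma=0\ \text{ in }\Omega\ \text{ for each }\sigma\in I^k,$$ $$u^k(x)\phi^k(0)e^{2i\pi l^kx/\alpha}+u^{-k}(x)\phi^{-k}(0)e^{-2i\pi l^kx/\alpha}=0\ \text{ for }x\in\{0,\alpha\}.$$ If the eigenfunctions $w^\varepsilon$ are real-valued, then $u^{-k}=\overline{u^k}$. (ii) Case $k=0$, when $\lambda^0$ is a double eigenvalue. Let $\phi_1,\phi_2$ be any two linearly independent normalized Bloch modes for $k=0$ with eigenvalue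 $\lambda^0$. There are $u_1,u_2\in H^1(\Omega)$ such that $g_0(x,y)=\sum_{q=1}^2u_q(x)\phi_q(y)$ a.e. in $\Omega\times Y$, $$\sum_{q=1}^2 \big(c(\phi_p,\phi_q)\,\partial_xu_q+\lambda^1\,b(\phi_p,\phi_q)\,u_q\big)=0\ \text{ in }\Omega\ \text{ for }p=1,2,$$ $$\sum_{q=1}^2u_q(x)\phi_q(0)=0\ \text{ for }x\in\{0,\alpha\}.$$ -/

import Mathlib

open MeasureTheory Set Filter Topology Asymptotics
open scoped ContDiff ComplexConjugate

noncomputable section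

namespace BlochHom

/-- `g` is the weak (distributional) derivative of `f` in the open set `U ⊆ ℝ`. -/
structure HasWeakDerivOn (U : Set ℝ) (f g : ℝ → ℂ) : Prop where
  locInt : LocallyIntegrableOn f U
  locInt_deriv : LocallyIntegrableOn g U
  integral_eq : ∀ θ : ℝ → ℝ, ContDiff ℝ ∞ θ → HasCompactSupport θ → tsupport θ ⊆ U →
    ∫ x in U, ((deriv θ x : ℝ) : ℂ) * f x = - ∫ x in U, (θ x : ℂ) * g x

/-- `u ∈ H¹(0,α)` with weak derivative `u'`. As usual in one dimension, `u` is the representative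
which is continuous on `[0,α]`, so that `u 0` and `u α` are its boundary values. -/
structure IsH1 (α : ℝ) (u u' : ℝ → ℂ) : Prop where
  cont : ContinuousOn u (Icc 0 α)
  memLp_deriv : MemLp u' 2 (volume.restrict (Ioo 0 α))
  weakDeriv : HasWeakDerivOn (Ioo 0 α) u u'

/-- `w ∈ H¹₀(0,α)`, `-∂ₓ(A ∂ₓ w) = lam R w` in `(0,α)` in the weak sense, and `‖w‖_{L²(0,α)} = 1`. -/
def IsDirichletEigenpair (α : ℝ) (A R : ℝ → ℝ) (lam : ℝ) (w : ℝ → ℂ) : Prop :=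
  (∃ w' : ℝ → ℂ, IsH1 α w w' ∧ w 0 = 0 ∧ w α = 0 ∧
    HasWeakDerivOn (Ioo 0 α) (fun x => (A x : ℂ) * w' x) (fun x => -((lam * R x : ℝ) : ℂ) * w x)) ∧
  ∫ x in Ioo 0 α, ‖w x‖ ^ 2 = 1

/-- The modulated two-scale transform `S_k^ε u (x, y)` over `Ω = (0,α)`: the sum runs over the cells
`ε l + ε Y`, `Y = (0,1)`, `l ∈ ℤ`, which are contained in `Ω`. -/
def twoScale (α ε k : ℝ) (u : ℝ → ℂ) (p : ℝ × ℝ) : ℂ :=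
  ∑ᶠ (l : ℤ) (_ : Ioo (ε * l) (ε * l + ε) ⊆ Ioo 0 α),
    (Ioo (ε * l) (ε * l + ε)).indicator
      (fun _ => u (ε * l + ε * p.2) * Complex.exp (-(2 * Real.pi * k * l : ℝ) * Complex.I)) p.1

/-- `∑_{σ ∈ I^k} S_σ^ε u`, where `I^k = {k, -k}` (which is `{0}` for `k = 0`). -/
def twoScaleSum (α ε k : ℝ) (u : ℝ → ℂ) (p : ℝ × ℝ) : ℂ :=
  ∑ σ ∈ ({k, -k} : Finset ℝ), twoScale α ε σ u p

/-- The rectangle `Ω × Y = (0,α) × (0,1)`. -/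
def cellDomain (α : ℝ) : Set (ℝ × ℝ) := Ioo 0 α ×ˢ Ioo 0 1

/-- `G ∈ L²(Ω; H¹(Y))` with `∂_y G = D`: both are in `L²(Ω × Y)` and `D` is the weak derivative of
`G` with respect to the second variable. -/
structure IsL2H1 (α : ℝ) (G D : ℝ × ℝ → ℂ) : Prop where
  memLp : MemLp G 2 (volume.restrict (cellDomain α))
  memLp_deriv : MemLp D 2 (volume.restrict (cellDomain α))
  integral_eq : ∀ θ : ℝ × ℝ → ℝ, ContDiff ℝ ∞ θ → HasCompactSupport θ →
    tsupport θ ⊆ cellDomain α →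
    ∫ p in cellDomain α, ((fderiv ℝ θ p (0, 1) : ℝ) : ℂ) * G p =
      - ∫ p in cellDomain α, (θ p : ℂ) * D p

/-- The sequence `G` is bounded in `L²(Ω; H¹(Y))`. -/
def BoundedL2H1 (α : ℝ) (G : ℕ → ℝ × ℝ → ℂ) : Prop :=
  ∃ C : ℝ, ∀ j, ∃ D : ℝ × ℝ → ℂ, IsL2H1 α (G j) D ∧
    (∫ p in cellDomain α, ‖G j p‖ ^ 2) + ∫ p in cellDomain α, ‖D p‖ ^ 2 ≤ C

/-- The sequence `G` converges to `g` weakly in the Hilbert space `L²(Ω; H¹(Y))`. -/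
def WeakTendstoL2H1 (α : ℝ) (G : ℕ → ℝ × ℝ → ℂ) (g : ℝ × ℝ → ℂ) : Prop :=
  ∃ (DG : ℕ → ℝ × ℝ → ℂ) (Dg : ℝ × ℝ → ℂ),
    (∀ j, IsL2H1 α (G j) (DG j)) ∧ IsL2H1 α g Dg ∧
    ∀ V DV : ℝ × ℝ → ℂ, IsL2H1 α V DV →
      Tendsto (fun j => ∫ p in cellDomain α, (G j p * conj (V p) + DG j p * conj (DV p))) atTop
        (𝓝 (∫ p in cellDomain α, (g p * conj (V p) + Dg p * conj (DV p))))

/-- `φ` is a Bloch mode for the quasi-momentum `k` and the eigenvalue `lam`: a `k`-quasi-periodic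
function in `H²_loc(ℝ)` (taken as its continuous representative) with `-∂(a ∂φ) = lam ρ φ` and
`‖φ‖_{L²(0,1)} = 1`. -/
structure IsBlochMode (a ρ : ℝ → ℝ) (k lam : ℝ) (φ : ℝ → ℂ) : Prop where
  cont : Continuous φ
  quasiPeriodic : ∀ (y : ℝ) (l : ℤ),
    φ (y + l) = φ y * Complex.exp ((2 * Real.pi * k * l : ℝ) * Complex.I)
  eqn : ∃ φ' φ'' : ℝ → ℂ,
    (∀ r : ℝ, MemLp φ' 2 (volume.restrict (Icc (-r) r))) ∧
    (∀ r : ℝ, MemLp φ'' 2 (volume.restrict (Icc (-r) r))) ∧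
    HasWeakDerivOn univ φ φ' ∧ HasWeakDerivOn univ φ' φ'' ∧
    HasWeakDerivOn univ (fun y => (a y : ℂ) * φ' y) (fun y => -((lam * ρ y : ℝ) : ℂ) * φ y)
  norm_eq : ∫ y in Ioo (0 : ℝ) 1, ‖φ y‖ ^ 2 = 1

/-- `lam` is an eigenvalue of the Bloch wave spectrum for the quasi-momentum `k`. -/
def IsBlochEigenvalue (a ρ : ℝ → ℝ) (k lam : ℝ) : Prop :=
  ∃ φ : ℝ → ℂ, IsBlochMode a ρ k lam φ

/-- The coefficient `c(n,m) = ∫_Y (a ∂φₘ conj φₙ - φₘ a conj (∂φₙ))`. Bloch modes are of class `C¹`,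
so `deriv` is their derivative. -/
def coeffC (a : ℝ → ℝ) (φn φm : ℝ → ℂ) : ℂ :=
  ∫ y in Ioo (0 : ℝ) 1,
    ((a y : ℂ) * deriv φm y * conj (φn y) - φm y * ((a y : ℂ) * conj (deriv φn y)))

/-- The coefficient `b(n,m) = ∫_Y ρ φₘ conj φₙ`. -/
def coeffB (ρ : ℝ → ℝ) (φn φm : ℝ → ℂ) : ℂ :=
  ∫ y in Ioo (0 : ℝ) 1, (ρ y : ℂ) * φm y * conj (φn y)

/-- The complex conjugate of a function; for `k ≠ 0` the Bloch mode `φ^{-k}` is `conj φ^k`. -/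
def conjFun (φ : ℝ → ℂ) (y : ℝ) : ℂ := conj (φ y)

end BlochHom

end

open MeasureTheory Set Filter Topology Asymptotics
open scoped ContDiff ComplexConjugate

noncomputable section

namespace BlochHom

/-- `F` is a primitive of the integrable function `f` on `[A, B]`. -/
structure IsPrim (A B : ℝ) (F f : ℝ → ℂ) : Prop where
  int : IntegrableOn f (Icc A B)
  eq : ∀ x ∈ Icc A B, F x = F A + ∫ t in A..x, f t

namespace IsPrim

variable {A B : ℝ} {F f G g : ℝ → ℂ}

theorem intervalIntegrable (h : IsPrim A B F f) {x y : ℝ} (hx : x ∈ Icc A B) (hy : y ∈ Icc A B) :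
    IntervalIntegrable f volume x y :=
  (intervalIntegrable_iff).2 (h.int.mono_set
    (uIoc_subset_uIcc.trans (uIcc_subset_Icc hx hy)))

theorem sub_eq (h : IsPrim A B F f) {x y : ℝ} (hx : x ∈ Icc A B) (hy : y ∈ Icc A B) :
    F y - F x = ∫ t in x..y, f t := by
  have hA : A ∈ Icc A B := ⟨le_rfl, hx.1.trans hx.2⟩
  rw [h.eq x hx, h.eq y hy, ← intervalIntegral.integral_add_adjacent_intervals
    (h.intervalIntegrable hA hx) (h.intervalIntegrable hx hy)]
  ring

theorem norm_sub_le (h : IsPrim A B F f) {x y : ℝ} (hx : x ∈ Icc A B) (hy : y ∈ Icc A B) :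
    ‖F y - F x‖ ≤ |∫ t in x..y, ‖f t‖| := by
  rw [h.sub_eq hx hy]
  exact intervalIntegral.norm_integral_le_abs_integral_norm

theorem absolutelyContinuous (h : IsPrim A B F f) (hAB : A ≤ B) :
    AbsolutelyContinuousOnInterval F A B := by
  have hA : A ∈ Icc A B := ⟨le_rfl, hAB⟩
  have hB : B ∈ Icc A B := ⟨hAB, le_rfl⟩
  have hn := (h.intervalIntegrable hA hB).norm.absolutelyContinuousOnInterval_intervalIntegral
    (c := A) left_mem_uIcc
  unfold AbsolutelyContinuousOnInterval at hn ⊢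
  refine squeeze_zero' ?_ ?_ hn
  · exact Eventually.of_forall fun _ => Finset.sum_nonneg fun _ _ => dist_nonneg
  rw [eventually_inf_principal]
  filter_upwards with E hE
  refine Finset.sum_le_sum fun i hi => ?_
  have h1 := (hE.1 i hi).1
  have h2 := (hE.1 i hi).2
  rw [uIcc_of_le hAB] at h1 h2
  rw [dist_eq_norm, Real.dist_eq, intervalIntegral.integral_interval_sub_left
    (h.intervalIntegrable hA h1).norm (h.intervalIntegrable hA h2).norm]
  exact h.norm_sub_le h2 h1

theorem continuousOn (h : IsPrim A B F f) : ContinuousOn F (Icc A B) := by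
  rcases le_or_gt A B with hAB | hAB
  · simpa [uIcc_of_le hAB] using (h.absolutelyContinuous hAB).continuousOn
  · simp [Icc_eq_empty_of_lt hAB]

theorem ae_hasDerivAt (h : IsPrim A B F f) :
    ∀ᵐ x, x ∈ Icc A B → HasDerivAt F (f x) x := by
  rcases le_or_gt A B with hAB | hAB
  · have hA : A ∈ Icc A B := ⟨le_rfl, hAB⟩
    have hB : B ∈ Icc A B := ⟨hAB, le_rfl⟩
    have h₁ : ∀ᵐ x : ℝ, x ≠ A := by simp [ae_iff, measure_singleton]
    have h₂ : ∀ᵐ x : ℝ, x ≠ B := by simp [ae_iff, measure_singleton]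
    filter_upwards [(h.intervalIntegrable hA hB).ae_hasDerivAt_integral, h₁, h₂] with x hx hxA hxB hxI
    have hd := (hx (by rwa [uIcc_of_le hAB]) A left_mem_uIcc).const_add (F A)
    refine hd.congr_of_eventuallyEq ?_
    filter_upwards [Icc_mem_nhds (lt_of_le_of_ne hxI.1 hxA.symm) (lt_of_le_of_ne hxI.2 hxB)] with y hy
    exact h.eq y hy
  · simp [Icc_eq_empty_of_lt hAB]

theorem of_absolutelyContinuous (hF : AbsolutelyContinuousOnInterval F A B) (hAB : A ≤ B)
    (hf : IntegrableOn f (Icc A B)) (hd : ∀ᵐ x, x ∈ Icc A B → HasDerivAt F (f x) x) :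
    IsPrim A B F f := by
  refine ⟨hf, ?_⟩
  have hP : IsPrim A B (fun x => ∫ t in A..x, f t) f := ⟨hf, fun x _ => by simp⟩
  have hac := hF.fun_sub (hP.absolutelyContinuous hAB)
  obtain ⟨C, hC⟩ := hac.const_of_ae_hasDerivAt_zero (by
    rw [uIcc_of_le hAB]
    filter_upwards [hd, hP.ae_hasDerivAt] with x h1 h2 hx
    simpa using (h1 hx).fun_sub (h2 hx))
  rw [uIcc_of_le hAB] at hC
  intro x hx
  have h1 := hC x hx
  have h2 := hC A ⟨le_rfl, hAB⟩
  simp only [intervalIntegral.integral_same, sub_zero] at h2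
  rw [h2, ← h1]; ring

theorem congr (h : IsPrim A B F f) (hF : ∀ x ∈ Icc A B, F x = G x)
    (hf : ∀ᵐ x, x ∈ Icc A B → f x = g x) : IsPrim A B G g := by
  refine ⟨h.int.congr ((ae_restrict_iff' measurableSet_Icc).2 hf), fun x hx => ?_⟩
  have hA : A ∈ Icc A B := ⟨le_rfl, hx.1.trans hx.2⟩
  rw [← hF x hx, ← hF A hA, h.eq x hx]
  congr 1
  refine intervalIntegral.integral_congr_ae ?_
  filter_upwards [hf] with t ht ht'
  rw [uIoc_of_le hx.1] at ht'
  exact ht ⟨ht'.1.le, ht'.2.trans hx.2⟩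

theorem mono (h : IsPrim A B F f) {A' B' : ℝ} (hA : A ≤ A') (hB : B' ≤ B) : IsPrim A' B' F f := by
  refine ⟨h.int.mono_set (Icc_subset_Icc hA hB), fun x hx => ?_⟩
  have h1 : A' ∈ Icc A B := ⟨hA, hx.1.trans (hx.2.trans hB)⟩
  have h2 : x ∈ Icc A B := ⟨hA.trans hx.1, hx.2.trans hB⟩
  rw [← h.sub_eq h1 h2]; ring

theorem trans (h : IsPrim A B F f) {C : ℝ} (h' : IsPrim B C F f) (hAB : A ≤ B) (hBC : B ≤ C) :
    IsPrim A C F f := by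
  have hi : IntegrableOn f (Icc A C) := by
    rw [← Icc_union_Icc_eq_Icc hAB hBC]; exact h.int.union h'.int
  refine ⟨hi, fun x hx => ?_⟩
  rcases le_total x B with hxB | hxB
  · exact h.eq x ⟨hx.1, hxB⟩
  · have hB : B ∈ Icc A B := ⟨hAB, le_rfl⟩
    have hx' : x ∈ Icc B C := ⟨hxB, hx.2⟩
    rw [← intervalIntegral.integral_add_adjacent_intervals
      (h.intervalIntegrable ⟨le_rfl, hAB⟩ hB) (h'.intervalIntegrable ⟨le_rfl, hBC⟩ hx'),
      ← add_assoc, ← h.eq B hB, ← h'.eq x hx']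

theorem add (hF : IsPrim A B F f) (hG : IsPrim A B G g) :
    IsPrim A B (fun x => F x + G x) (fun x => f x + g x) := by
  refine ⟨hF.int.add hG.int, fun x hx => ?_⟩
  have hA : A ∈ Icc A B := ⟨le_rfl, hx.1.trans hx.2⟩
  rw [intervalIntegral.integral_add (hF.intervalIntegrable hA hx) (hG.intervalIntegrable hA hx)]
  simp only [hF.eq x hx, hG.eq x hx]
  ring

theorem const_mul (hF : IsPrim A B F f) (c : ℂ) :
    IsPrim A B (fun x => c * F x) (fun x => c * f x) := by
  refine ⟨hF.int.const_mul c, fun x hx => ?_⟩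
  rw [intervalIntegral.integral_const_mul]
  simp only [hF.eq x hx]
  ring

theorem sub (hF : IsPrim A B F f) (hG : IsPrim A B G g) :
    IsPrim A B (fun x => F x - G x) (fun x => f x - g x) :=
  (hF.add (hG.const_mul (-1))).congr (fun x _ => by ring) (ae_of_all _ fun x _ => by ring)

theorem sum {ι : Type*} (s : Finset ι) {F f : ι → ℝ → ℂ} (h : ∀ i ∈ s, IsPrim A B (F i) (f i)) :
    IsPrim A B (fun x => ∑ i ∈ s, F i x) (fun x => ∑ i ∈ s, f i x) := by
  classical
  induction s using Finset.induction_on with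
  | empty => exact ⟨by simp, by simp⟩
  | insert i s hi ih =>
    simp only [Finset.sum_insert hi]
    exact (h i (Finset.mem_insert_self i s)).add
      (ih fun j hj => h j (Finset.mem_insert_of_mem hj))

theorem star (hF : IsPrim A B F f) :
    IsPrim A B (fun x => conj (F x)) (fun x => conj (f x)) := by
  refine ⟨?_, fun x hx => ?_⟩
  · exact (Complex.conjCLE.toContinuousLinearMap.integrable_comp hF.int :)
  · rw [hF.eq x hx, map_add, intervalIntegral.integral_of_le hx.1,
      intervalIntegral.integral_of_le hx.1, integral_conj]

theorem mul (hF : IsPrim A B F f) (hG : IsPrim A B G g) (hAB : A ≤ B) :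
    IsPrim A B (fun x => F x * G x) (fun x => f x * G x + F x * g x) := by
  refine of_absolutelyContinuous
    ((hF.absolutelyContinuous hAB).fun_smul (hG.absolutelyContinuous hAB)) hAB
    ((hF.int.mul_continuousOn hG.continuousOn isCompact_Icc).add
      (hG.int.continuousOn_mul hF.continuousOn isCompact_Icc)) ?_
  filter_upwards [hF.ae_hasDerivAt, hG.ae_hasDerivAt] with x h1 h2 hx
  exact (h1 hx).mul (h2 hx)

theorem of_hasDerivAt (hAB : A ≤ B) (hd : ∀ x ∈ Icc A B, HasDerivAt F (f x) x)
    (hf : ContinuousOn f (Icc A B)) : IsPrim A B F f := by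
  have hi : IntegrableOn f (Icc A B) := hf.integrableOn_Icc
  refine ⟨hi, fun x hx => ?_⟩
  have hsub : uIcc A x ⊆ Icc A B := uIcc_subset_Icc ⟨le_rfl, hAB⟩ hx
  rw [intervalIntegral.integral_eq_sub_of_hasDerivAt (fun t ht => hd t (hsub ht))
    ((hf.mono hsub).intervalIntegrable)]
  ring

theorem comp_mul_add (h : IsPrim A B F f) {c d A' B' : ℝ} (hc : 0 < c)
    (hA : c * A' + d = A) (hB : c * B' + d = B) :
    IsPrim A' B' (fun y => F (c * y + d)) (fun y => c * f (c * y + d)) := by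
  have hi : IntegrableOn (fun y => f (c * y + d)) (Icc A' B') := by
    rcases le_or_gt A' B' with hAB | hAB
    · rw [← intervalIntegrable_iff_integrableOn_Icc_of_le hAB]
      have hAB' : A ≤ B := by rw [← hA, ← hB]; gcongr
      have := (h.intervalIntegrable (x := A) (y := B) ⟨le_rfl, hAB'⟩ ⟨hAB', le_rfl⟩)
      have h2 := (this.comp_add_right d).comp_mul_left (c := c)
      convert h2 using 1 <;> field_simp <;> linarith
    · simp [Icc_eq_empty_of_lt hAB]
  refine ⟨hi.const_mul _, fun y hy => ?_⟩
  have hy' : c * y + d ∈ Icc A B := by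
    rw [← hA, ← hB]; constructor <;> gcongr; exacts [hy.1, hy.2]
  rw [hA, intervalIntegral.integral_const_mul, h.eq _ hy',
    intervalIntegral.integral_comp_mul_add _ hc.ne', hA]
  congr 1
  rw [Complex.real_smul, ← mul_assoc, ← Complex.ofReal_mul, mul_inv_cancel₀ hc.ne']
  simp

end IsPrim

theorem IsPrim.ofReal_contDiff {θ : ℝ → ℝ} (hθ : ContDiff ℝ ∞ θ) {A B : ℝ} (hAB : A ≤ B) :
    IsPrim A B (fun x => (θ x : ℂ)) (fun x => ((deriv θ x : ℝ) : ℂ)) := by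
  refine IsPrim.of_hasDerivAt hAB (fun x _ => ?_) ?_
  · exact ((hθ.differentiable (by simp)).differentiableAt.hasDerivAt (x := x)).ofReal_comp
  · exact (Complex.continuous_ofReal.comp (hθ.continuous_deriv (by simp))).continuousOn

theorem integral_eq_of_tsupport_subset {X : Type*} [TopologicalSpace X] [MeasurableSpace X]
    {μ : Measure X} {U : Set X} {θ : X → ℝ} (hθ : tsupport θ ⊆ U) (F : X → ℂ) :
    ∫ x in U, (θ x : ℂ) * F x ∂μ = ∫ x, (θ x : ℂ) * F x ∂μ :=
  setIntegral_eq_integral_of_forall_compl_eq_zero fun x hx => by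
    rw [image_eq_zero_of_notMem_tsupport fun h => hx (hθ h)]; simp

theorem tsupport_deriv_subset_of {θ : ℝ → ℝ} {U : Set ℝ} (hθ : tsupport θ ⊆ U) :
    tsupport (deriv θ) ⊆ U :=
  (closure_minimal (support_deriv_subset (f := θ)) (isClosed_tsupport θ)).trans hθ

theorem integrable_test_mul {X : Type*} [TopologicalSpace X] [MeasurableSpace X]
    [OpensMeasurableSpace X] [T2Space X] {μ : Measure X} {U : Set X} {F : X → ℂ}
    (hF : LocallyIntegrableOn F U μ) {θ : X → ℝ}
    (hc : Continuous θ) (hs : HasCompactSupport θ) (hθ : tsupport θ ⊆ U) :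
    Integrable (fun x => (θ x : ℂ) * F x) μ := by
  have h1 : IntegrableOn F (tsupport θ) μ := hF.integrableOn_compact_subset hθ hs
  have h2 : IntegrableOn (fun x => (θ x : ℂ) * F x) (tsupport θ) μ :=
    h1.continuousOn_mul (Complex.continuous_ofReal.comp hc).continuousOn hs
  refine h2.integrable_of_forall_notMem_eq_zero fun x hx => ?_
  rw [image_eq_zero_of_notMem_tsupport hx]; simp

theorem HasWeakDerivOn.mono {U V : Set ℝ} {F f : ℝ → ℂ} (h : HasWeakDerivOn V F f) (hUV : U ⊆ V) :
    HasWeakDerivOn U F f := by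
  refine ⟨h.locInt.mono_set hUV, h.locInt_deriv.mono_set hUV, fun θ h1 h2 h3 => ?_⟩
  rw [integral_eq_of_tsupport_subset (tsupport_deriv_subset_of h3),
    integral_eq_of_tsupport_subset h3,
    ← integral_eq_of_tsupport_subset (U := V) (tsupport_deriv_subset_of (h3.trans hUV)),
    ← integral_eq_of_tsupport_subset (U := V) (h3.trans hUV)]
  exact h.integral_eq θ h1 h2 (h3.trans hUV)

theorem HasWeakDerivOn.sub {U : Set ℝ} {F f G g : ℝ → ℂ} (hF : HasWeakDerivOn U F f)
    (hG : HasWeakDerivOn U G g) :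
    HasWeakDerivOn U (fun x => F x - G x) (fun x => f x - g x) := by
  refine ⟨hF.locInt.sub hG.locInt, hF.locInt_deriv.sub hG.locInt_deriv, fun θ h1 h2 h3 => ?_⟩
  have hc := h1.continuous
  have hc' := h1.continuous_deriv (by simp)
  have h3' := tsupport_deriv_subset_of h3
  simp only [mul_sub]
  rw [integral_sub (integrable_test_mul hF.locInt hc' h2.deriv h3').integrableOn
    (integrable_test_mul hG.locInt hc' h2.deriv h3').integrableOn,
    integral_sub (integrable_test_mul hF.locInt_deriv hc h2 h3).integrableOn
    (integrable_test_mul hG.locInt_deriv hc h2 h3).integrableOn,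
    hF.integral_eq θ h1 h2 h3, hG.integral_eq θ h1 h2 h3]
  ring

/-- Integration by parts against a test function. -/
theorem IsPrim.integral_test {A B : ℝ} {F f : ℝ → ℂ} (h : IsPrim A B F f)
    (hAB : A ≤ B) {θ : ℝ → ℝ} (hθ : ContDiff ℝ ∞ θ) (hs : tsupport θ ⊆ Ioo A B) :
    ∫ x in Ioo A B, ((deriv θ x : ℝ) : ℂ) * F x = - ∫ x in Ioo A B, (θ x : ℂ) * f x := by
  have hp := (IsPrim.ofReal_contDiff hθ hAB).mul h hAB
  have hA : A ∈ Icc A B := ⟨le_rfl, hAB⟩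
  have hB : B ∈ Icc A B := ⟨hAB, le_rfl⟩
  have key := hp.sub_eq hA hB
  have hθA : θ A = 0 := image_eq_zero_of_notMem_tsupport fun h' => lt_irrefl _ (hs h').1
  have hθB : θ B = 0 := image_eq_zero_of_notMem_tsupport fun h' => lt_irrefl _ (hs h').2
  have hi1 : IntegrableOn (fun x => ((deriv θ x : ℝ) : ℂ) * F x) (Ioo A B) :=
    (((IsPrim.ofReal_contDiff hθ hAB).int.mul_continuousOn h.continuousOn
      isCompact_Icc)).mono_set Ioo_subset_Icc_self
  have hi2 : IntegrableOn (fun x => (θ x : ℂ) * f x) (Ioo A B) :=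
    (h.int.continuousOn_mul (Complex.continuous_ofReal.comp hθ.continuous).continuousOn
      isCompact_Icc).mono_set Ioo_subset_Icc_self
  simp only [hθA, hθB, Complex.ofReal_zero, zero_mul, sub_zero] at key
  rw [intervalIntegral.integral_of_le hAB, integral_Ioc_eq_integral_Ioo,
    integral_add hi1 hi2] at key
  exact eq_neg_of_add_eq_zero_left key.symm

theorem IsPrim.hasWeakDerivOn {A B : ℝ} {F f : ℝ → ℂ} (h : IsPrim A B F f) (hAB : A ≤ B) :
    HasWeakDerivOn (Ioo A B) F f where
  locInt := (h.continuousOn.integrableOn_Icc.mono_set Ioo_subset_Icc_self).locallyIntegrableOn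
  locInt_deriv := (h.int.mono_set Ioo_subset_Icc_self).locallyIntegrableOn
  integral_eq _ h1 _ h3 := h.integral_test hAB h1 h3

theorem hasWeakDerivOn_univ_of_isPrim {F f : ℝ → ℂ} (h : ∀ r > 0, IsPrim (-r) r F f) :
    HasWeakDerivOn univ F f := by
  have hex : ∀ K : Set ℝ, IsCompact K → ∃ r > 0, K ⊆ Ioo (-r) r := fun K hK => by
    obtain ⟨r, hr⟩ := hK.isBounded.subset_ball 0
    refine ⟨max r 1, by positivity, fun x hx => ?_⟩
    have := hr hx
    rw [Metric.mem_ball, dist_zero_right, Real.norm_eq_abs, abs_lt] at this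
    exact ⟨by linarith [le_max_left r 1], this.2.trans_le (le_max_left _ _)⟩
  refine ⟨?_, ?_, fun θ h1 h2 h3 => ?_⟩
  · refine (locallyIntegrableOn_iff isClosed_univ.isLocallyClosed).2 fun K _ hK => ?_
    obtain ⟨r, hr, hKr⟩ := hex K hK
    exact (h r hr).continuousOn.integrableOn_Icc.mono_set (hKr.trans Ioo_subset_Icc_self)
  · refine (locallyIntegrableOn_iff isClosed_univ.isLocallyClosed).2 fun K _ hK => ?_
    obtain ⟨r, hr, hKr⟩ := hex K hK
    exact (h r hr).int.mono_set (hKr.trans Ioo_subset_Icc_self)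
  · obtain ⟨r, hr, hKr⟩ := hex _ h2
    rw [integral_eq_of_tsupport_subset (tsupport_deriv_subset_of h3),
      integral_eq_of_tsupport_subset h3,
      ← integral_eq_of_tsupport_subset (tsupport_deriv_subset_of hKr),
      ← integral_eq_of_tsupport_subset hKr]
    exact (h r hr).integral_test (by linarith) h1 hKr

/-- A smooth function with compact support in `(A, B)` and vanishing integral is the derivative
of such a function. -/
theorem exists_test_primitive {A B : ℝ} {η : ℝ → ℝ} (hη : ContDiff ℝ ∞ η)
    (hc : HasCompactSupport η) (hs : tsupport η ⊆ Ioo A B) (h0 : ∫ x, η x = 0) :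
    ∃ θ : ℝ → ℝ, ContDiff ℝ ∞ θ ∧ HasCompactSupport θ ∧ tsupport θ ⊆ Ioo A B ∧ deriv θ = η := by
  rcases (tsupport η).eq_empty_or_nonempty with he | hne
  · have : η = 0 := by simpa [tsupport_eq_empty_iff] using he
    refine ⟨0, contDiff_const, HasCompactSupport.zero, by simp, ?_⟩
    rw [this]; ext; simp
  have hK : IsCompact (tsupport η) := hc
  set A' := sInf (tsupport η)
  set B' := sSup (tsupport η)
  have hA' : A' ∈ Ioo A B := hs (hK.sInf_mem hne)
  have hB' : B' ∈ Ioo A B := hs (hK.sSup_mem hne)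
  have hsub : tsupport η ⊆ Icc A' B' := fun x hx =>
    ⟨csInf_le hK.bddBelow hx, le_csSup hK.bddAbove hx⟩
  have hz : ∀ x, x ∉ Icc A' B' → η x = 0 := fun x hx =>
    image_eq_zero_of_notMem_tsupport fun h => hx (hsub h)
  have hAB' : A' ≤ B' := (hsub (hK.sInf_mem hne)).2
  have hd : ∀ x, HasDerivAt (fun x => ∫ t in A'..x, η t) (η x) x := fun x =>
    intervalIntegral.integral_hasDerivAt_right (hη.continuous.intervalIntegrable _ _)
      (hη.continuous.stronglyMeasurableAtFilter _ _) hη.continuous.continuousAt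
  have hderiv : deriv (fun x => ∫ t in A'..x, η t) = η := funext fun x => (hd x).deriv
  have hsupp : tsupport (fun x => ∫ t in A'..x, η t) ⊆ Icc A' B' := by
    refine closure_minimal (fun x hx => ?_) isClosed_Icc
    by_contra hxn
    refine hx ?_
    rcases lt_or_ge x A' with hlt | hge
    · refine (intervalIntegral.integral_congr_ae (g := fun _ => 0) ?_).trans (by simp)
      have h₁ : ∀ᵐ y : ℝ, y ≠ A' := by simp [ae_iff, measure_singleton]
      filter_upwards [h₁] with y hy hyx
      rw [uIoc_of_ge hlt.le] at hyx
      exact hz y fun h => hy (le_antisymm hyx.2 h.1)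
    · have hxB : B' < x := by
        by_contra hh; exact hxn ⟨hge, not_lt.1 hh⟩
      have h1 : ∫ t, η t = ∫ t in Icc A' x, η t := by
        refine (setIntegral_eq_integral_of_forall_compl_eq_zero fun y hy => hz y fun h => hy ?_).symm
        exact ⟨h.1, h.2.trans hxB.le⟩
      show ∫ t in A'..x, η t = 0
      rw [intervalIntegral.integral_of_le hge, ← integral_Icc_eq_integral_Ioc, ← h1, h0]
  refine ⟨fun x => ∫ t in A'..x, η t, ?_, ?_, ?_, hderiv⟩
  · exact contDiff_infty_iff_deriv.2 ⟨fun x => (hd x).differentiableAt, by rwa [hderiv]⟩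
  · exact HasCompactSupport.of_support_subset_isCompact isCompact_Icc
      ((subset_tsupport _).trans hsupp)
  · exact hsupp.trans fun x hx => ⟨hA'.1.trans_le hx.1, hx.2.trans_lt hB'.2⟩

/-- A function with vanishing weak derivative on an interval is almost everywhere constant. -/
theorem HasWeakDerivOn.ae_const {A B : ℝ} (hAB : A < B) {H : ℝ → ℂ}
    (h : HasWeakDerivOn (Ioo A B) H (fun _ => 0)) :
    ∃ c : ℂ, ∀ᵐ x, x ∈ Ioo A B → H x = c := by
  let χb : ContDiffBump ((A + B) / 2) := ⟨(B - A) / 8, (B - A) / 4, by linarith, by linarith⟩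
  set χ := χb.normed volume with hχ
  have hχc : ContDiff ℝ ∞ χ := χb.contDiff_normed
  have hχs : HasCompactSupport χ := χb.hasCompactSupport_normed
  have hχt : tsupport χ ⊆ Ioo A B := by
    rw [hχ, χb.tsupport_normed_eq, Real.closedBall_eq_Icc]
    intro x hx
    have h1 : χb.rOut = (B - A) / 4 := rfl
    rw [h1] at hx
    exact ⟨by linarith [hx.1], by linarith [hx.2]⟩
  have hχ1 : ∫ x, χ x = 1 := χb.integral_normed
  set c : ℂ := ∫ x, (χ x : ℂ) * H x
  refine ⟨c, ?_⟩
  have hloc : LocallyIntegrableOn (fun x => H x - c) (Ioo A B) :=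
    h.locInt.sub ((locallyIntegrable_const c).locallyIntegrableOn _)
  have key := isOpen_Ioo.ae_eq_zero_of_integral_contDiff_smul_eq_zero hloc
    (fun η hη hηc hηs => ?_)
  · filter_upwards [key] with x hx hxI
    exact sub_eq_zero.1 (hx hxI)
  have hη' : Integrable η := hη.continuous.integrable_of_hasCompactSupport hηc
  have hχ' : Integrable χ := hχc.continuous.integrable_of_hasCompactSupport hχs
  set m := ∫ x, η x
  have hts : tsupport (fun x => η x - m * χ x) ⊆ Ioo A B := by
    refine (closure_minimal (t := tsupport η ∪ tsupport χ) (fun x hx => ?_)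
      ((isClosed_tsupport _).union (isClosed_tsupport _))).trans (union_subset hηs hχt)
    by_contra hn
    simp only [mem_union, not_or] at hn
    exact hx (by simp [image_eq_zero_of_notMem_tsupport hn.1,
      image_eq_zero_of_notMem_tsupport hn.2])
  obtain ⟨θ, hθ1, hθ2, hθ3, hθ4⟩ := exists_test_primitive (η := fun x => η x - m * χ x)
    (hη.sub (contDiff_const.mul hχc)) (HasCompactSupport.of_support_subset_isCompact
      (K := tsupport η ∪ tsupport χ) (IsCompact.union hηc hχs) (fun x hx => by
        by_contra hn
        simp only [mem_union, not_or] at hn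
        exact hx (by simp [image_eq_zero_of_notMem_tsupport hn.1,
          image_eq_zero_of_notMem_tsupport hn.2]))) hts
    (by rw [integral_sub hη' (hχ'.const_mul m), integral_const_mul, hχ1]; simp [m])
  have e := h.integral_eq θ hθ1 hθ2 hθ3
  rw [integral_eq_of_tsupport_subset (tsupport_deriv_subset_of hθ3), hθ4] at e
  have i1 := integrable_test_mul h.locInt hη.continuous hηc hηs
  have i2 := integrable_test_mul h.locInt hχc.continuous hχs hχt
  have e2 : ∫ x, ((η x - m * χ x : ℝ) : ℂ) * H x = (∫ x, (η x : ℂ) * H x) - m * c := by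
    rw [← integral_const_mul, ← integral_sub i1 (i2.const_mul _)]
    congr 1; ext x; push_cast; ring
  rw [e2] at e
  simp only [mul_zero, integral_zero, neg_zero] at e
  simp only [Complex.real_smul, mul_sub]
  have i3 : Integrable (fun x => (η x : ℂ) * c) := hη'.ofReal.mul_const c
  rw [integral_sub i1 i3, integral_mul_const, integral_complex_ofReal]
  exact e

/-- A function with integrable weak derivative agrees almost everywhere with a primitive. -/
theorem HasWeakDerivOn.exists_isPrim {A B : ℝ} (hAB : A < B) {F f : ℝ → ℂ}
    (h : HasWeakDerivOn (Ioo A B) F f) (hf : IntegrableOn f (Ioo A B)) :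
    ∃ P, IsPrim A B P f ∧ ∀ᵐ x, x ∈ Ioo A B → F x = P x := by
  have hf' : IntegrableOn f (Icc A B) := by
    rwa [integrableOn_Icc_iff_integrableOn_Ioo]
  have hP : IsPrim A B (fun x => ∫ t in A..x, f t) f := ⟨hf', fun x _ => by simp⟩
  have h0 := h.sub (hP.hasWeakDerivOn hAB.le)
  simp only [sub_self] at h0
  obtain ⟨c, hc⟩ := h0.ae_const hAB
  refine ⟨fun x => c + ∫ t in A..x, f t, ⟨hf', fun x _ => by simp⟩, ?_⟩
  filter_upwards [hc] with x hx hxI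
  rw [← hx hxI]; ring

theorem HasWeakDerivOn.isPrim {A B : ℝ} (hAB : A < B) {F f : ℝ → ℂ}
    (h : HasWeakDerivOn (Ioo A B) F f) (hf : IntegrableOn f (Ioo A B))
    (hF : ContinuousOn F (Icc A B)) : IsPrim A B F f := by
  obtain ⟨P, hP, hPF⟩ := h.exists_isPrim hAB hf
  have heq : EqOn P F (Icc A B) := by
    refine Measure.eqOn_Icc_of_ae_eq (μ := volume) hAB.ne ?_ hP.continuousOn hF
    refine (ae_restrict_iff' measurableSet_Icc).2 ?_
    have h₁ : ∀ᵐ x : ℝ, x ≠ A := by simp [ae_iff, measure_singleton]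
    have h₂ : ∀ᵐ x : ℝ, x ≠ B := by simp [ae_iff, measure_singleton]
    filter_upwards [hPF, h₁, h₂] with x hx hA hB hxI
    exact (hx ⟨lt_of_le_of_ne hxI.1 hA.symm, lt_of_le_of_ne hxI.2 hB⟩).symm
  exact hP.congr heq (ae_of_all _ fun _ _ => rfl)

/-- The coefficients of the periodic medium: `a` is Lipschitz, bounded and bounded from below by a
positive constant, `ρ` is measurable and bounded, and both are `1`-periodic. -/
structure PeriodicCoeff (a ρ : ℝ → ℝ) (a0 a1 ρ1 : ℝ) : Prop where
  a0_pos : 0 < a0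
  lip : ∃ K, LipschitzWith K a
  per : Function.Periodic a 1
  le_a : ∀ y, a0 ≤ a y
  a_le : ∀ y, a y ≤ a1
  meas : AEStronglyMeasurable ρ volume
  ρ_per : ∀ᵐ y, ρ (y + 1) = ρ y
  ρ_le : ∀ᵐ y, |ρ y| ≤ ρ1

namespace PeriodicCoeff

variable {a ρ : ℝ → ℝ} {a0 a1 ρ1 : ℝ}

theorem a_pos (h : PeriodicCoeff a ρ a0 a1 ρ1) (y : ℝ) : 0 < a y := h.a0_pos.trans_le (h.le_a y)

theorem a1_pos (h : PeriodicCoeff a ρ a0 a1 ρ1) : 0 < a1 := (h.a_pos 0).trans_le (h.a_le 0)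

theorem continuous_a (h : PeriodicCoeff a ρ a0 a1 ρ1) : Continuous a := h.lip.choose_spec.continuous

theorem ρ1_nonneg (h : PeriodicCoeff a ρ a0 a1 ρ1) : 0 ≤ ρ1 := by
  obtain ⟨y, hy⟩ := h.ρ_le.exists
  exact (abs_nonneg _).trans hy

theorem norm_div_le (h : PeriodicCoeff a ρ a0 a1 ρ1) (z : ℂ) (y : ℝ) : ‖z / a y‖ ≤ ‖z‖ / a0 := by
  rw [norm_div, Complex.norm_real, Real.norm_of_nonneg (h.a_pos y).le]
  exact div_le_div_of_nonneg_left (norm_nonneg z) h.a0_pos (h.le_a y)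

end PeriodicCoeff

/-- `(f, z)` solves the first order system `a ∂f = z`, `∂z = -μ ρ f` on `[A, B]`. -/
structure IsSol (a ρ : ℝ → ℝ) (μ A B : ℝ) (f z : ℝ → ℂ) : Prop where
  fst : IsPrim A B f (fun y => z y / a y)
  snd : IsPrim A B z (fun y => -((μ * ρ y : ℝ) : ℂ) * f y)

namespace IsSol

variable {a ρ : ℝ → ℝ} {μ ν A B : ℝ} {f z φ ζ : ℝ → ℂ}

theorem mono (h : IsSol a ρ μ A B f z) {A' B' : ℝ} (hA : A ≤ A') (hB : B' ≤ B) :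
    IsSol a ρ μ A' B' f z := ⟨h.fst.mono hA hB, h.snd.mono hA hB⟩

theorem star (h : IsSol a ρ μ A B f z) :
    IsSol a ρ μ A B (fun y => conj (f y)) (fun y => conj (z y)) :=
  ⟨h.fst.star.congr (fun _ _ => rfl) (ae_of_all _ fun x _ => by simp),
    h.snd.star.congr (fun _ _ => rfl) (ae_of_all _ fun x _ => by simp)⟩

theorem sum {ι : Type*} (s : Finset ι) (c : ι → ℂ) {f z : ι → ℝ → ℂ}
    (h : ∀ i, IsSol a ρ μ A B (f i) (z i)) :
    IsSol a ρ μ A B (fun y => ∑ i ∈ s, c i * f i y) (fun y => ∑ i ∈ s, c i * z i y) := by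
  constructor
  · refine (IsPrim.sum s fun i _ => (h i).fst.const_mul (c i)).congr (fun _ _ => rfl)
      (ae_of_all _ fun x _ => ?_)
    rw [Finset.sum_div]
    exact Finset.sum_congr rfl fun i _ => by ring
  · refine (IsPrim.sum s fun i _ => (h i).snd.const_mul (c i)).congr (fun _ _ => rfl)
      (ae_of_all _ fun x _ => ?_)
    rw [Finset.mul_sum]
    exact Finset.sum_congr rfl fun i _ => by ring

theorem const_mul (h : IsSol a ρ μ A B f z) (c : ℂ) :
    IsSol a ρ μ A B (fun y => c * f y) (fun y => c * z y) :=
  ⟨(h.fst.const_mul c).congr (fun _ _ => rfl) (ae_of_all _ fun x _ => by ring),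
    (h.snd.const_mul c).congr (fun _ _ => rfl) (ae_of_all _ fun x _ => by ring)⟩

/-- The Lagrange identity for two solutions with different spectral parameters. -/
theorem wronskian (h : IsSol a ρ μ A B f z) (h' : IsSol a ρ ν A B φ ζ) (hAB : A ≤ B) :
    IsPrim A B (fun y => z y * conj (φ y) - f y * conj (ζ y))
      (fun y => -(((μ - ν) * ρ y : ℝ) : ℂ) * (f y * conj (φ y))) := by
  refine ((h.snd.mul h'.fst.star hAB).sub (h.fst.mul h'.snd.star hAB)).congr
    (fun _ _ => rfl) (ae_of_all _ fun x _ => ?_)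
  simp only [map_div₀, map_mul, map_neg, Complex.conj_ofReal]
  push_cast
  ring

end IsSol

/-- The matrix of the sesquilinear Wronskians of a pair of solutions. -/
def wron (ψ z : Fin 2 → ℝ → ℂ) (y : ℝ) : Matrix (Fin 2) (Fin 2) ℂ :=
  Matrix.of fun p q => z q y * conj (ψ p y) - ψ q y * conj (z p y)

theorem wron_eq_of_isSol {a ρ : ℝ → ℝ} {lam A B : ℝ} {ψ z : Fin 2 → ℝ → ℂ}
    (h : ∀ q, IsSol a ρ lam A B (ψ q) (z q)) {x y : ℝ} (hx : x ∈ Icc A B) (hy : y ∈ Icc A B) :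
    wron ψ z x = wron ψ z y := by
  ext p q
  have := ((h q).wronskian (h p) (hx.1.trans hx.2)).sub_eq hx hy
  simp only [sub_self, zero_mul, Complex.ofReal_zero, neg_zero,
    intervalIntegral.integral_zero] at this
  exact (sub_eq_zero.1 this).symm

/-- The coordinates of `(W, Z)` in the basis given by a pair of solutions. -/
def coords (ψ z : Fin 2 → ℝ → ℂ) (W Z : ℝ → ℂ) (q : Fin 2) (y : ℝ) : ℂ :=
  ∑ p, (wron ψ z y)⁻¹ q p * (Z y * conj (ψ p y) - W y * conj (z p y))

/-- The fundamental matrix of a pair of solutions. -/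
def fundMat (ψ z : Fin 2 → ℝ → ℂ) (y : ℝ) : Matrix (Fin 2) (Fin 2) ℂ :=
  !![ψ 0 y, ψ 1 y; z 0 y, z 1 y]

theorem wron_eq_mul (ψ z : Fin 2 → ℝ → ℂ) (y : ℝ) :
    wron ψ z y = !![-conj (z 0 y), conj (ψ 0 y); -conj (z 1 y), conj (ψ 1 y)] * fundMat ψ z y := by
  ext p q
  fin_cases p <;> fin_cases q <;> simp [wron, fundMat, Matrix.mul_apply] <;> ring

theorem det_wron (ψ z : Fin 2 → ℝ → ℂ) (y : ℝ) :
    (wron ψ z y).det = conj (fundMat ψ z y).det * (fundMat ψ z y).det := by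
  rw [wron_eq_mul, Matrix.det_mul]
  simp only [fundMat, Matrix.det_fin_two_of, map_sub, map_mul]
  ring

theorem coords_spec {ψ z : Fin 2 → ℝ → ℂ} {y : ℝ} (hdet : (wron ψ z y).det ≠ 0) (W Z : ℝ → ℂ) :
    W y = ∑ q, coords ψ z W Z q y * ψ q y ∧ Z y = ∑ q, coords ψ z W Z q y * z q y := by
  set C := wron ψ z y with hC
  have hu : IsUnit C.det := isUnit_iff_ne_zero.2 hdet
  have h1 := Matrix.nonsing_inv_mul C hu
  nth_rewrite 2 [hC] at h1
  rw [wron_eq_mul, ← Matrix.mul_assoc] at h1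
  have h2 := mul_eq_one_comm.1 h1
  have e : ∀ i j, _ = _ := fun i j => congrFun (congrFun h2 i) j
  have e00 := e 0 0
  have e01 := e 0 1
  have e10 := e 1 0
  have e11 := e 1 1
  simp [fundMat, Matrix.mul_apply, Fin.sum_univ_two] at e00 e01 e10 e11
  simp only [coords, Fin.sum_univ_two, ← hC]
  constructor
  · linear_combination (-W y) * e00 - Z y * e01
  · linear_combination (-W y) * e10 - Z y * e11

theorem coords_unique {ψ z : Fin 2 → ℝ → ℂ} {y : ℝ} (hdet : (wron ψ z y).det ≠ 0) {W Z : ℝ → ℂ}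
    {c : Fin 2 → ℂ} (hW : W y = ∑ q, c q * ψ q y) (hZ : Z y = ∑ q, c q * z q y) (q : Fin 2) :
    coords ψ z W Z q y = c q := by
  have h1 := Matrix.nonsing_inv_mul (wron ψ z y) (isUnit_iff_ne_zero.2 hdet)
  have e : ∀ i j, _ = _ := fun i j => congrFun (congrFun h1 i) j
  have hq0 := e q 0
  have hq1 := e q 1
  simp only [coords, hW, hZ, Fin.sum_univ_two]
  simp only [Matrix.mul_apply, Fin.sum_univ_two] at hq0 hq1
  have w : ∀ p r, wron ψ z y p r = z r y * conj (ψ p y) - ψ r y * conj (z p y) := fun _ _ => rfl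
  rw [w, w] at hq0 hq1
  have : c q = c 0 * (1 : Matrix (Fin 2) (Fin 2) ℂ) q 0 + c 1 * (1 : Matrix (Fin 2) (Fin 2) ℂ) q 1 := by
    revert q
    exact fun q _ _ => by
      rcases Fin.exists_fin_two.1 ⟨q, rfl⟩ with rfl | rfl <;> simp
  rw [this]
  linear_combination c 0 * hq0 + c 1 * hq1

/-- Variation of constants: the coordinates of a solution for `μ` in a basis of solutions for
`lam` vary slowly. -/
theorem isPrim_coords {a ρ : ℝ → ℝ} {lam μ A B : ℝ} {ψ z : Fin 2 → ℝ → ℂ} {W Z : ℝ → ℂ}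
    (h : ∀ q, IsSol a ρ lam A B (ψ q) (z q)) (hW : IsSol a ρ μ A B W Z) (hAB : A ≤ B) (q : Fin 2) :
    IsPrim A B (coords ψ z W Z q) (fun y => ∑ p, (wron ψ z A)⁻¹ q p *
      (-(((μ - lam) * ρ y : ℝ) : ℂ) * (W y * conj (ψ p y)))) := by
  refine (IsPrim.sum Finset.univ fun p _ =>
    (hW.wronskian (h p) hAB).const_mul ((wron ψ z A)⁻¹ q p)).congr (fun y hy => ?_)
    (ae_of_all _ fun _ _ => rfl)
  rw [coords, wron_eq_of_isSol h hy ⟨le_rfl, hAB⟩]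

theorem le_exp_of_le_add_integral {A B δ K : ℝ} {h : ℝ → ℝ} (hc : ContinuousOn h (Icc A B))
    (hK : 0 ≤ K)
    (hle : ∀ y ∈ Icc A B, h y ≤ δ + K * ∫ t in A..y, h t) :
    ∀ y ∈ Icc A B, h y ≤ δ * Real.exp (K * (y - A)) := by
  intro y hy
  have hAB : A ≤ B := hy.1.trans hy.2
  have hg0 : ∀ x ∈ Ico A B, HasDerivWithinAt (fun y => δ + K * ∫ t in A..y, h t)
      (K * h x) (Ici x) x := by
    intro x hx
    have hi : IntervalIntegrable h volume A x := (hc.mono (by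
      rw [uIcc_of_le hx.1]; exact Icc_subset_Icc le_rfl hx.2.le)).intervalIntegrable
    have hcx : ContinuousWithinAt h (Ioi x) x :=
      ((hc x ⟨hx.1, hx.2.le⟩).mono_of_mem_nhdsWithin (by
        refine mem_of_superset (Ioo_mem_nhdsGT hx.2) fun t ht => ⟨hx.1.trans ht.1.le, ht.2.le⟩))
    have hm : StronglyMeasurableAtFilter h (𝓝[>] x) volume := by
      refine ⟨Ioo x B, Ioo_mem_nhdsGT hx.2, ?_⟩
      exact (hc.mono fun t ht => ⟨hx.1.trans ht.1.le, ht.2.le⟩).aestronglyMeasurable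
        measurableSet_Ioo
    have := intervalIntegral.integral_hasDerivWithinAt_right hi (s := Ici x) (t := Ioi x) hm hcx
    exact (this.const_mul K).const_add δ
  have hgc : ContinuousOn (fun y => δ + K * ∫ t in A..y, h t) (Icc A B) := by
    have : ContinuousOn (fun y => ∫ t in A..y, h t) (Icc A B) := by
      have := intervalIntegral.continuousOn_primitive_interval (a := A) (b := B) (f := h)
        (μ := volume) (by rw [uIcc_of_le hAB]; exact hc.integrableOn_Icc)
      rwa [uIcc_of_le hAB] at this
    fun_prop
  have key := le_gronwallBound_of_liminf_deriv_right_le (f := fun y => δ + K * ∫ t in A..y, h t)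
    (f' := fun x => K * h x) (δ := δ) (K := K) (ε := 0) (a := A) (b := B) hgc
    (fun x hx r hr => (hg0 x hx).liminf_right_slope_le hr) (by simp)
    (fun x hx => by
      have := hle x ⟨hx.1, hx.2.le⟩
      nlinarith) y hy
  rw [gronwallBound_ε0] at key
  exact (hle y hy).trans key

theorem IsSol.eq_zero {a ρ : ℝ → ℝ} {a0 a1 ρ1 : ℝ} (hco : PeriodicCoeff a ρ a0 a1 ρ1)
    {μ A B : ℝ} {f z : ℝ → ℂ} (h : IsSol a ρ μ A B f z) (hf : f A = 0) (hz : z A = 0) :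
    ∀ y ∈ Icc A B, f y = 0 ∧ z y = 0 := by
  intro y hy
  have hAB : A ≤ B := hy.1.trans hy.2
  have hA : A ∈ Icc A B := ⟨le_rfl, hAB⟩
  set K := 1 / a0 + |μ| * ρ1
  have hρ := hco.ρ1_nonneg
  have ha0 := hco.a0_pos
  have hK : 0 ≤ K := by positivity
  have hfc := h.fst.continuousOn
  have hzc := h.snd.continuousOn
  have key := le_exp_of_le_add_integral (h := fun y => ‖f y‖ + ‖z y‖) (δ := 0)
    (hfc.norm.add hzc.norm) hK (fun x hx => ?_) y hy
  · rw [zero_mul] at key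
    have h1 := norm_nonneg (f y)
    have h2 := norm_nonneg (z y)
    exact ⟨norm_eq_zero.1 (by linarith), norm_eq_zero.1 (by linarith)⟩
  · have e1 := h.fst.norm_sub_le hA hx
    have e2 := h.snd.norm_sub_le hA hx
    have i1 := (h.fst.intervalIntegrable hA hx).norm
    have i2 := (h.snd.intervalIntegrable hA hx).norm
    rw [hf, sub_zero, abs_of_nonneg (intervalIntegral.integral_nonneg hx.1 fun _ _ =>
      norm_nonneg _)] at e1
    rw [hz, sub_zero, abs_of_nonneg (intervalIntegral.integral_nonneg hx.1 fun _ _ =>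
      norm_nonneg _)] at e2
    have i3 : IntervalIntegrable (fun y => ‖f y‖ + ‖z y‖) volume A x :=
      ((hfc.norm.add hzc.norm).mono (by
        rw [uIcc_of_le hx.1]; exact Icc_subset_Icc le_rfl hx.2)).intervalIntegrable
    rw [zero_add, ← intervalIntegral.integral_const_mul]
    refine (add_le_add e1 e2).trans ?_
    rw [← intervalIntegral.integral_add i1 i2]
    refine intervalIntegral.integral_mono_ae hx.1 (i1.add i2) (i3.const_mul K) ?_
    filter_upwards [hco.ρ_le] with t ht
    have t1 := hco.norm_div_le (z t) t
    have t2 : ‖-((μ * ρ t : ℝ) : ℂ) * f t‖ ≤ |μ| * ρ1 * ‖f t‖ := by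
      rw [norm_mul, norm_neg, Complex.norm_real, Real.norm_eq_abs, abs_mul]
      gcongr
    refine (add_le_add t1 t2).trans ?_
    have n1 := norm_nonneg (f t)
    have n2 := norm_nonneg (z t)
    have n3 : 0 ≤ 1 / a0 * ‖f t‖ := by positivity
    have n4 : 0 ≤ |μ| * ρ1 * ‖z t‖ := by positivity
    simp only [K]
    calc _ = 1 / a0 * ‖z t‖ + |μ| * ρ1 * ‖f t‖ := by ring
      _ ≤ _ := by nlinarith

/-- The integrand of the weighted Volterra operator. -/
def volterraIntegrand (Λ : ℝ) (b : ℝ → ℂ) (g : C(Icc (0 : ℝ) 1, ℂ)) (s : ℝ) : ℂ :=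
  Real.exp (Λ * s) * (b s * IccExtend zero_le_one g s)

theorem intervalIntegrable_volterraIntegrand {L : ℝ} {b : ℝ → ℂ} (Λ : ℝ)
    (hb : AEStronglyMeasurable b volume) (hL : ∀ᵐ s, ‖b s‖ ≤ L) (g : C(Icc (0 : ℝ) 1, ℂ)) (x y : ℝ) :
    IntervalIntegrable (volterraIntegrand Λ b g) volume x y := by
  have hg : Continuous (IccExtend (zero_le_one (α := ℝ)) g) := g.continuous.Icc_extend'
  have h1 : IntervalIntegrable b volume x y := by
    rw [intervalIntegrable_iff]
    exact Measure.integrableOn_of_bounded (by simp) hb (ae_restrict_of_ae hL)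
  exact (h1.mul_continuousOn hg.continuousOn).continuousOn_mul (by fun_prop)

/-- The Volterra operator `g ↦ exp (-Λ y) ∫₀^y exp (Λ s) b(s) g(s) ds` on `C([0,1])`. -/
def volterra (Λ : ℝ) {L : ℝ} {b : ℝ → ℂ} (hb : AEStronglyMeasurable b volume)
    (hL : ∀ᵐ s, ‖b s‖ ≤ L) (g : C(Icc (0 : ℝ) 1, ℂ)) : C(Icc (0 : ℝ) 1, ℂ) where
  toFun y := Real.exp (-(Λ * y)) * ∫ s in (0 : ℝ)..y, volterraIntegrand Λ b g s
  continuous_toFun := by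
    have := intervalIntegral.continuous_primitive
      (fun x y => intervalIntegrable_volterraIntegrand Λ hb hL g x y) 0
    exact (by fun_prop : Continuous fun y : Icc (0 : ℝ) 1 => ((Real.exp (-(Λ * y)) : ℝ) : ℂ)).mul
      (this.comp continuous_subtype_val)

theorem dist_volterra_le {Λ : ℝ} (hΛ : 0 < Λ) {L : ℝ} {b : ℝ → ℂ}
    (hb : AEStronglyMeasurable b volume) (hL : ∀ᵐ s, ‖b s‖ ≤ L) (g h : C(Icc (0 : ℝ) 1, ℂ)) :
    dist (volterra Λ hb hL g) (volterra Λ hb hL h) ≤ L / Λ * dist g h := by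
  have hL0 : 0 ≤ L := by
    obtain ⟨s, hs⟩ := hL.exists
    exact (norm_nonneg _).trans hs
  rw [ContinuousMap.dist_le (by positivity)]
  intro y
  have hy0 : (0 : ℝ) ≤ y := y.2.1
  rw [dist_eq_norm]
  simp only [volterra, ContinuousMap.coe_mk]
  rw [← mul_sub, ← intervalIntegral.integral_sub
    (intervalIntegrable_volterraIntegrand Λ hb hL g _ _)
    (intervalIntegrable_volterraIntegrand Λ hb hL h _ _), norm_mul, Complex.norm_real,
    Real.norm_of_nonneg (Real.exp_pos _).le]
  have hbd : ‖∫ s in (0 : ℝ)..y, (volterraIntegrand Λ b g s - volterraIntegrand Λ b h s)‖ ≤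
      ∫ s in (0 : ℝ)..y, L * dist g h * Real.exp (Λ * s) := by
    refine intervalIntegral.norm_integral_le_of_norm_le hy0 ?_
      ((by fun_prop : Continuous fun s => L * dist g h * Real.exp (Λ * s)).intervalIntegrable _ _)
    filter_upwards [hL] with s hs _
    rw [volterraIntegrand, volterraIntegrand, ← mul_sub, ← mul_sub, norm_mul, norm_mul,
      Complex.norm_real, Real.norm_of_nonneg (Real.exp_pos _).le, mul_comm]
    gcongr
    rw [← dist_eq_norm]
    exact ContinuousMap.dist_apply_le_dist _
  have hexp : ∫ s in (0 : ℝ)..y, L * dist g h * Real.exp (Λ * s) =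
      L * dist g h * (Λ⁻¹ * (Real.exp (Λ * y) - 1)) := by
    rw [intervalIntegral.integral_const_mul, intervalIntegral.integral_comp_mul_left _ hΛ.ne']
    simp
  rw [hexp] at hbd
  calc _ ≤ Real.exp (-(Λ * y)) * (L * dist g h * (Λ⁻¹ * (Real.exp (Λ * y) - 1))) := by gcongr
    _ = L / Λ * dist g h * (Real.exp (-(Λ * y)) * Real.exp (Λ * y) - Real.exp (-(Λ * y))) := by
        field_simp
    _ ≤ L / Λ * dist g h * 1 := by
        gcongr
        rw [← Real.exp_add]
        simp [Real.exp_nonneg]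
    _ = _ := by ring

theorem exp_mul_volterra {Λ : ℝ} {L : ℝ} {b : ℝ → ℂ} (hb : AEStronglyMeasurable b volume)
    (hL : ∀ᵐ s, ‖b s‖ ≤ L) (g : C(Icc (0 : ℝ) 1, ℂ)) (y : Icc (0 : ℝ) 1) :
    Real.exp (Λ * y) * volterra Λ hb hL g y = ∫ s in (0 : ℝ)..y, volterraIntegrand Λ b g s := by
  simp only [volterra, ContinuousMap.coe_mk]
  rw [← mul_assoc, ← Complex.ofReal_mul, ← Real.exp_add]
  simp

/-- Solutions of the first order system on `[0,1]` with prescribed initial values. -/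
theorem exists_isSol {a ρ : ℝ → ℝ} {a0 a1 ρ1 : ℝ} (hco : PeriodicCoeff a ρ a0 a1 ρ1) (μ : ℝ)
    (v₁ v₂ : ℂ) : ∃ f z : ℝ → ℂ, IsSol a ρ μ 0 1 f z ∧ f 0 = v₁ ∧ z 0 = v₂ := by
  set L := 1 / a0 + |μ| * ρ1
  have hρ := hco.ρ1_nonneg
  have ha0 := hco.a0_pos
  have hL : 0 < L := by positivity
  set Λ := 2 * L
  have hΛ : 0 < Λ := by positivity
  have hb1 : AEStronglyMeasurable (fun y => 1 / (a y : ℂ)) volume :=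
    (Continuous.div continuous_const (Complex.continuous_ofReal.comp hco.continuous_a)
      fun y => Complex.ofReal_ne_zero.2 (hco.a_pos y).ne').aestronglyMeasurable
  have hL1 : ∀ᵐ y, ‖1 / (a y : ℂ)‖ ≤ L := ae_of_all _ fun y => by
    refine (hco.norm_div_le 1 y).trans ?_
    simp only [norm_one, L]
    linarith [show 0 ≤ |μ| * ρ1 by positivity]
  have hb2 : AEStronglyMeasurable (fun y => -((μ * ρ y : ℝ) : ℂ)) volume :=
    (Complex.continuous_ofReal.comp_aestronglyMeasurable (hco.meas.const_mul μ)).neg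
  have hL2 : ∀ᵐ y, ‖-((μ * ρ y : ℝ) : ℂ)‖ ≤ L := by
    filter_upwards [hco.ρ_le] with y hy
    rw [norm_neg, Complex.norm_real, Real.norm_eq_abs, abs_mul]
    have : |μ| * |ρ y| ≤ |μ| * ρ1 := by gcongr
    simp only [L]
    linarith [show 0 ≤ 1 / a0 by positivity]
  let e : ℂ → C(Icc (0 : ℝ) 1, ℂ) := fun v =>
    ⟨fun y => Real.exp (-(Λ * y)) * v, by fun_prop⟩
  let T : C(Icc (0 : ℝ) 1, ℂ) × C(Icc (0 : ℝ) 1, ℂ) → C(Icc (0 : ℝ) 1, ℂ) × C(Icc (0 : ℝ) 1, ℂ) :=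
    fun p => (e v₁ + volterra Λ hb1 hL1 p.2, e v₂ + volterra Λ hb2 hL2 p.1)
  have hT : ContractingWith (1 / 2) T := by
    refine ⟨by norm_num, LipschitzWith.of_dist_le_mul fun p q => ?_⟩
    have hhalf : L / Λ = 1 / 2 := by simp only [Λ]; field_simp
    have h1 := dist_volterra_le hΛ hb1 hL1 p.2 q.2
    have h2 := dist_volterra_le hΛ hb2 hL2 p.1 q.1
    rw [hhalf] at h1 h2
    have d1 : dist p.1 q.1 ≤ dist p q := le_max_left _ _
    have d2 : dist p.2 q.2 ≤ dist p q := le_max_right _ _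
    rw [Prod.dist_eq]
    simp only [T, dist_add_left, NNReal.coe_div, NNReal.coe_one, NNReal.coe_ofNat]
    exact max_le (by linarith) (by linarith)
  obtain ⟨p, hp⟩ : ∃ p, T p = p := ⟨_, hT.fixedPoint_isFixedPt⟩
  have hp1 : ∀ y : Icc (0 : ℝ) 1, p.1 y = e v₁ y + volterra Λ hb1 hL1 p.2 y := fun y => by
    conv_lhs => rw [← hp]
    rfl
  have hp2 : ∀ y : Icc (0 : ℝ) 1, p.2 y = e v₂ y + volterra Λ hb2 hL2 p.1 y := fun y => by
    conv_lhs => rw [← hp]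
    rfl
  let f : ℝ → ℂ := fun y => Real.exp (Λ * y) * IccExtend zero_le_one p.1 y
  let z : ℝ → ℂ := fun y => Real.exp (Λ * y) * IccExtend zero_le_one p.2 y
  have hexp : ∀ y : ℝ, ∀ v : ℂ, (Real.exp (Λ * y) : ℂ) * (Real.exp (-(Λ * y)) * v) = v :=
    fun y v => by rw [← mul_assoc, ← Complex.ofReal_mul, ← Real.exp_add]; simp
  have hf : ∀ y ∈ Icc (0 : ℝ) 1, f y = v₁ + ∫ s in (0 : ℝ)..y, z s / a s := by
    intro y hy
    simp only [f]
    rw [IccExtend_of_mem _ _ hy, hp1, mul_add]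
    refine (congrArg _ (exp_mul_volterra hb1 hL1 p.2 ⟨y, hy⟩)).trans ?_
    congr 1
    · exact hexp y v₁
    · congr 1; ext s; simp only [volterraIntegrand, z]; ring
  have hz : ∀ y ∈ Icc (0 : ℝ) 1, z y = v₂ + ∫ s in (0 : ℝ)..y, -((μ * ρ s : ℝ) : ℂ) * f s := by
    intro y hy
    simp only [z]
    rw [IccExtend_of_mem _ _ hy, hp2, mul_add]
    refine (congrArg _ (exp_mul_volterra hb2 hL2 p.1 ⟨y, hy⟩)).trans ?_
    congr 1
    · exact hexp y v₂
    · congr 1; ext s; simp only [volterraIntegrand, f]; ring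
  have h0 : (0 : ℝ) ∈ Icc (0 : ℝ) 1 := by simp
  have hf0 : f 0 = v₁ := by rw [hf 0 h0]; simp
  have hz0 : z 0 = v₂ := by rw [hz 0 h0]; simp
  refine ⟨f, z, ⟨⟨?_, fun y hy => by rw [hf0, hf y hy]⟩, ⟨?_, fun y hy => by rw [hz0, hz y hy]⟩⟩,
    hf0, hz0⟩
  · rw [← intervalIntegrable_iff_integrableOn_Icc_of_le zero_le_one]
    convert intervalIntegrable_volterraIntegrand Λ hb1 hL1 p.2 0 1 using 1
    ext s; simp only [volterraIntegrand, z]; ring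
  · rw [← intervalIntegrable_iff_integrableOn_Icc_of_le zero_le_one]
    convert intervalIntegrable_volterraIntegrand Λ hb2 hL2 p.1 0 1 using 1
    ext s; simp only [volterraIntegrand, f]; ring

theorem IsPrim.hasDerivAt {A B : ℝ} {F f : ℝ → ℂ} (h : IsPrim A B F f)
    (hf : ContinuousOn f (Icc A B)) {x : ℝ} (hx : x ∈ Ioo A B) : HasDerivAt F (f x) x := by
  have hx' : x ∈ Icc A B := Ioo_subset_Icc_self hx
  have hA : A ∈ Icc A B := ⟨le_rfl, hx.1.le.trans hx.2.le⟩
  have hn : Icc A B ∈ 𝓝 x := Icc_mem_nhds hx.1 hx.2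
  have hm : StronglyMeasurableAtFilter f (𝓝 x) volume :=
    ⟨Icc A B, hn, hf.aestronglyMeasurable measurableSet_Icc⟩
  have hd := (intervalIntegral.integral_hasDerivAt_right (h.intervalIntegrable hA hx') hm
    (hf.continuousAt hn)).const_add (F A)
  refine hd.congr_of_eventuallyEq ?_
  filter_upwards [hn] with y hy
  exact h.eq y hy

/-- The quasi-periodicity factor `exp (2 i π k l)`. -/
def phase (k : ℝ) (l : ℤ) : ℂ := Complex.exp ((2 * Real.pi * k * l : ℝ) * Complex.I)

theorem norm_phase (k : ℝ) (l : ℤ) : ‖phase k l‖ = 1 := Complex.norm_exp_ofReal_mul_I _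

theorem phase_ne_zero (k : ℝ) (l : ℤ) : phase k l ≠ 0 := Complex.exp_ne_zero _

theorem phase_add (k : ℝ) (l m : ℤ) : phase k (l + m) = phase k l * phase k m := by
  rw [phase, phase, phase, ← Complex.exp_add]
  congr 1; push_cast; ring

theorem phase_mul (k k' : ℝ) (l : ℤ) : phase k l * phase k' l = phase (k + k') l := by
  rw [phase, phase, phase, ← Complex.exp_add]
  congr 1; push_cast; ring

theorem phase_zero (k : ℝ) : phase k 0 = 1 := by simp [phase]

theorem phase_zero_left (l : ℤ) : phase 0 l = 1 := by simp [phase]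

theorem phase_neg (k : ℝ) (l : ℤ) : phase (-k) l = conj (phase k l) := by
  rw [phase, phase, ← Complex.exp_conj]
  congr 1
  rw [map_mul, Complex.conj_ofReal, Complex.conj_I]
  push_cast; ring

theorem phase_eq_pow (k : ℝ) (l : ℕ) : phase k l = phase k 1 ^ l := by
  rw [phase, phase, ← Complex.exp_nat_mul]
  congr 1; push_cast; ring

theorem phase_one_ne_one {k : ℝ} (hk : |k| < 1) (hk0 : k ≠ 0) : phase k 1 ≠ 1 := by
  intro h
  rw [phase, Complex.exp_eq_one_iff] at h
  obtain ⟨n, hn⟩ := h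
  have h2 : (2 * Real.pi * Complex.I : ℂ) ≠ 0 := Complex.two_pi_I_ne_zero
  have h3 : ((k : ℝ) : ℂ) = ((n : ℝ) : ℂ) := by
    apply mul_right_cancel₀ h2
    push_cast at hn ⊢
    rw [← hn]; ring
  have h4 : k = n := by exact_mod_cast h3
  rw [h4] at hk hk0
  have : |n| < 1 := by exact_mod_cast hk
  exact hk0 (by exact_mod_cast Int.abs_lt_one_iff.1 this)

/-- `(φ, z)` is a quasi-periodic solution of the first order system on the whole line. -/
structure IsBlochSol (a ρ : ℝ → ℝ) (k lam : ℝ) (φ z : ℝ → ℂ) : Prop where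
  sol : ∀ A B, IsSol a ρ lam A B φ z
  qp : ∀ (y : ℝ) (l : ℤ), φ (y + l) = φ y * phase k l
  qpz : ∀ (y : ℝ) (l : ℤ), z (y + l) = z y * phase k l

theorem continuous_of_isPrim {F f : ℝ → ℂ} (h : ∀ A B, IsPrim A B F f) : Continuous F :=
  continuous_iff_continuousAt.2 fun x =>
    (h (x - 1) (x + 1)).continuousOn.continuousAt (Icc_mem_nhds (by linarith) (by linarith))

theorem exists_bound_of_quasiPeriodic {F : ℝ → ℂ} {k : ℝ} (hc : Continuous F)
    (hq : ∀ (y : ℝ) (l : ℤ), F (y + l) = F y * phase k l) : ∃ K, ∀ y, ‖F y‖ ≤ K := by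
  obtain ⟨K, hK⟩ := (isCompact_Icc (a := (0 : ℝ)) (b := 1)).exists_bound_of_continuousOn
    hc.continuousOn
  refine ⟨K, fun y => ?_⟩
  have h1 : F y = F (Int.fract y) * phase k ⌊y⌋ := by
    rw [← hq, Int.fract_add_floor]
  rw [h1, norm_mul, norm_phase, mul_one]
  exact hK _ ⟨Int.fract_nonneg y, (Int.fract_lt_one y).le⟩

namespace IsBlochSol

variable {a ρ : ℝ → ℝ} {a0 a1 ρ1 k lam : ℝ} {φ z : ℝ → ℂ}

theorem continuous (h : IsBlochSol a ρ k lam φ z) : Continuous φ :=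
  continuous_of_isPrim fun A B => (h.sol A B).fst

theorem continuous_snd (h : IsBlochSol a ρ k lam φ z) : Continuous z :=
  continuous_of_isPrim fun A B => (h.sol A B).snd

theorem continuous_div (h : IsBlochSol a ρ k lam φ z) (hco : PeriodicCoeff a ρ a0 a1 ρ1) :
    Continuous fun y => z y / a y :=
  h.continuous_snd.div (Complex.continuous_ofReal.comp hco.continuous_a)
    fun y => Complex.ofReal_ne_zero.2 (hco.a_pos y).ne'

theorem hasDerivAt (h : IsBlochSol a ρ k lam φ z) (hco : PeriodicCoeff a ρ a0 a1 ρ1) (y : ℝ) :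
    HasDerivAt φ (z y / a y) y :=
  (h.sol (y - 1) (y + 1)).fst.hasDerivAt (h.continuous_div hco).continuousOn
    ⟨by linarith, by linarith⟩

theorem exists_bound (h : IsBlochSol a ρ k lam φ z) : ∃ K, ∀ y, ‖φ y‖ ≤ K ∧ ‖z y‖ ≤ K := by
  obtain ⟨K, hK⟩ := exists_bound_of_quasiPeriodic h.continuous h.qp
  obtain ⟨K', hK'⟩ := exists_bound_of_quasiPeriodic h.continuous_snd h.qpz
  exact ⟨max K K', fun y => ⟨(hK y).trans (le_max_left _ _), (hK' y).trans (le_max_right _ _)⟩⟩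

theorem star (h : IsBlochSol a ρ k lam φ z) :
    IsBlochSol a ρ (-k) lam (conjFun φ) (conjFun z) where
  sol A B := (h.sol A B).star
  qp y l := by rw [conjFun, conjFun, h.qp, map_mul, phase_neg]
  qpz y l := by rw [conjFun, conjFun, h.qpz, map_mul, phase_neg]

theorem const_mul (h : IsBlochSol a ρ k lam φ z) (c : ℂ) :
    IsBlochSol a ρ k lam (fun y => c * φ y) (fun y => c * z y) where
  sol A B := (h.sol A B).const_mul c
  qp y l := by simp only [h.qp]; ring
  qpz y l := by simp only [h.qpz]; ring

end IsBlochSol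

theorem lipschitzWith_inv {a : ℝ → ℝ} {a0 : ℝ} (ha0 : 0 < a0) (h : ∀ y, a0 ≤ a y)
    (hl : ∃ K, LipschitzWith K a) : ∃ K, LipschitzWith K fun y => (a y)⁻¹ := by
  obtain ⟨K, hK⟩ := hl
  refine ⟨K * Real.toNNReal ((a0 ^ 2)⁻¹), LipschitzWith.of_dist_le_mul fun x y => ?_⟩
  have hx : 0 < a x := ha0.trans_le (h x)
  have hy : 0 < a y := ha0.trans_le (h y)
  have h1 := hK.dist_le_mul x y
  have h2 : a0 ^ 2 ≤ a x * a y := by nlinarith [h x, h y]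
  rw [Real.dist_eq] at h1 ⊢
  rw [NNReal.coe_mul, Real.coe_toNNReal _ (by positivity)]
  have h3 : (a x)⁻¹ - (a y)⁻¹ = -(a x - a y) * (a x * a y)⁻¹ := by field_simp; ring
  rw [h3, abs_mul, abs_neg, abs_of_pos (by positivity : 0 < (a x * a y)⁻¹)]
  calc |a x - a y| * (a x * a y)⁻¹ ≤ (K * dist x y) * (a0 ^ 2)⁻¹ := by gcongr
    _ = _ := by ring

theorem LipschitzWith.isPrim {g : ℝ → ℝ} {K : NNReal} (hg : LipschitzWith K g) (A B : ℝ) :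
    IsPrim A B (fun y => (g y : ℂ)) (fun y => ((deriv g y : ℝ) : ℂ)) := by
  have hac : ∀ x y, AbsolutelyContinuousOnInterval g x y := fun x y =>
    (hg.lipschitzOnWith (s := uIcc x y)).absolutelyContinuousOnInterval
  refine ⟨?_, fun x hx => ?_⟩
  · rcases le_or_gt A B with hAB | hAB
    · rw [← intervalIntegrable_iff_integrableOn_Icc_of_le hAB]
      have := (hac A B).intervalIntegrable_deriv
      rw [intervalIntegrable_iff] at this ⊢
      exact this.ofReal
    · simp [Icc_eq_empty_of_lt hAB]
  · rw [intervalIntegral.integral_ofReal, (hac A x).integral_deriv_eq_sub]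
    push_cast; ring

/-- A normalized quasi-periodic solution is a Bloch mode. -/
theorem IsBlochSol.isBlochMode {a ρ : ℝ → ℝ} {a0 a1 ρ1 k lam : ℝ} {φ z : ℝ → ℂ}
    (h : IsBlochSol a ρ k lam φ z) (hco : PeriodicCoeff a ρ a0 a1 ρ1)
    (hn : ∫ y in Ioo (0 : ℝ) 1, ‖φ y‖ ^ 2 = 1) : IsBlochMode a ρ k lam φ := by
  obtain ⟨K, hK⟩ := lipschitzWith_inv hco.a0_pos hco.le_a hco.lip
  have hdiv : ∀ A B, A ≤ B → IsPrim A B (fun y => z y / a y)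
      (fun y => -((lam * ρ y : ℝ) : ℂ) * φ y * ((a y)⁻¹ : ℝ) +
        z y * ((deriv (fun y => (a y)⁻¹) y : ℝ) : ℂ)) := fun A B hAB => by
    refine ((h.sol A B).snd.mul (LipschitzWith.isPrim hK A B) hAB).congr (fun y _ => ?_)
      (ae_of_all _ fun _ _ => rfl)
    rw [Complex.ofReal_inv, div_eq_mul_inv]
  obtain ⟨M, hM⟩ := h.exists_bound
  refine ⟨h.continuous, h.qp, ⟨_, _, fun r => ?_, fun r => ?_,
    hasWeakDerivOn_univ_of_isPrim fun r _ => (h.sol (-r) r).fst,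
    hasWeakDerivOn_univ_of_isPrim fun r hr => hdiv (-r) r (by linarith), ?_⟩, hn⟩
  · have ha := hco.a0_pos
    exact MemLp.of_bound (h.continuous_div hco).aestronglyMeasurable (M / a0)
      (ae_of_all _ fun y => (hco.norm_div_le _ y).trans (by gcongr; exact (hM y).2))
  · have hM0 : 0 ≤ M := (norm_nonneg _).trans (hM 0).1
    refine MemLp.of_bound (C := |lam| * ρ1 * M * (1 / a0) + M * K) ?_ ?_
    · refine AEStronglyMeasurable.restrict ?_
      refine AEStronglyMeasurable.add (AEStronglyMeasurable.mul (AEStronglyMeasurable.mul ?_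
        h.continuous.aestronglyMeasurable) ?_) (h.continuous_snd.aestronglyMeasurable.mul ?_)
      · exact (Complex.continuous_ofReal.comp_aestronglyMeasurable (hco.meas.const_mul lam)).neg
      · exact (Complex.continuous_ofReal.comp hK.continuous).aestronglyMeasurable
      · exact (Complex.measurable_ofReal.comp (measurable_deriv _)).aestronglyMeasurable
    · refine ae_restrict_of_ae ?_
      filter_upwards [hco.ρ_le] with y hy
      refine (norm_add_le _ _).trans (add_le_add ?_ ?_)
      · rw [norm_mul, norm_mul, norm_neg, Complex.norm_real, Complex.norm_real, Real.norm_eq_abs,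
          Real.norm_eq_abs, abs_mul, abs_of_pos (inv_pos.2 (hco.a_pos y)), ← one_div]
        have := hco.ρ1_nonneg
        have ha := hco.a0_pos
        have ha' := hco.a_pos y
        gcongr
        · exact (hM y).1
        · exact hco.le_a y
      · rw [norm_mul, Complex.norm_real]
        gcongr
        · exact (hM y).2
        · exact norm_deriv_le_of_lipschitz hK
  · have e : (fun y => (a y : ℂ) * (z y / a y)) = z := by
      ext y
      rw [mul_div_cancel₀]
      exact Complex.ofReal_ne_zero.2 (hco.a_pos y).ne'
    rw [e]
    exact hasWeakDerivOn_univ_of_isPrim fun r _ => (h.sol (-r) r).snd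

theorem integrableOn_of_memLp_two {φ : ℝ → ℂ} {s : Set ℝ} (hs : volume s ≠ ⊤)
    (h : MemLp φ 2 (volume.restrict s)) : IntegrableOn φ s := by
  have : IsFiniteMeasure (volume.restrict s) := isFiniteMeasure_restrict.2 hs
  exact h.integrable (by norm_num)

/-- A Bloch mode solves the first order system. -/
theorem IsBlochMode.exists_isBlochSol {a ρ : ℝ → ℝ} {a0 a1 ρ1 k lam : ℝ} {φ : ℝ → ℂ}
    (h : IsBlochMode a ρ k lam φ) (hco : PeriodicCoeff a ρ a0 a1 ρ1) :
    ∃ z, IsBlochSol a ρ k lam φ z := by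
  obtain ⟨φ', φ'', h1, -, h3, -, h5⟩ := h.eqn
  have key : ∀ r > 0, IsSol a ρ lam (-r) r φ (fun y => a y * deriv φ y) := by
    intro r hr
    set R := r + 1
    have hR : -R < R := by simp only [R]; linarith
    have hi : IntegrableOn φ' (Ioo (-R) R) :=
      (integrableOn_of_memLp_two (by simp) (h1 R)).mono_set Ioo_subset_Icc_self
    have p1 : IsPrim (-R) R φ φ' :=
      (h3.mono (subset_univ _)).isPrim hR hi h.cont.continuousOn
    have hi2 : IntegrableOn (fun y => -((lam * ρ y : ℝ) : ℂ) * φ y) (Ioo (-R) R) := by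
      refine (((locallyIntegrableOn_iff isClosed_univ.isLocallyClosed).1 h5.locInt_deriv
        (Icc (-R) R) (subset_univ _) isCompact_Icc)).mono_set Ioo_subset_Icc_self
    obtain ⟨P, hP, hPe⟩ := (h5.mono (subset_univ (Ioo (-R) R))).exists_isPrim hR hi2
    have hPc : ContinuousOn (fun y => P y / a y) (Icc (-R) R) :=
      hP.continuousOn.div (Complex.continuous_ofReal.comp hco.continuous_a).continuousOn
        fun y _ => Complex.ofReal_ne_zero.2 (hco.a_pos y).ne'
    have h₁ : ∀ᵐ x : ℝ, x ≠ -R := by simp [ae_iff, measure_singleton]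
    have h₂ : ∀ᵐ x : ℝ, x ≠ R := by simp [ae_iff, measure_singleton]
    have p2 : IsPrim (-R) R φ (fun y => P y / a y) := p1.congr (fun _ _ => rfl) (by
      filter_upwards [hPe, h₁, h₂] with y hy hy1 hy2 hyI
      rw [← hy ⟨lt_of_le_of_ne hyI.1 hy1.symm, lt_of_le_of_ne hyI.2 hy2⟩, mul_div_cancel_left₀]
      exact Complex.ofReal_ne_zero.2 (hco.a_pos y).ne')
    have hd : ∀ y ∈ Icc (-r) r, a y * deriv φ y = P y := fun y hy => by
      have hy' : y ∈ Ioo (-R) R :=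
        ⟨by simp only [R]; linarith [hy.1], by simp only [R]; linarith [hy.2]⟩
      rw [(p2.hasDerivAt hPc hy').deriv, mul_div_cancel₀]
      exact Complex.ofReal_ne_zero.2 (hco.a_pos y).ne'
    have hr1 : -R ≤ -r := by simp only [R]; linarith
    have hr2 : r ≤ R := by simp only [R]; linarith
    exact ⟨(p2.mono hr1 hr2).congr (fun _ _ => rfl) (ae_of_all _ fun y hy => by rw [hd y hy]),
      (hP.mono hr1 hr2).congr (fun y hy => (hd y hy).symm) (ae_of_all _ fun _ _ => rfl)⟩
  refine ⟨fun y => a y * deriv φ y, fun A B => ?_, h.quasiPeriodic, fun y l => ?_⟩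
  · have hpos : 0 < |A| + |B| + 1 := by positivity
    exact (key _ hpos).mono (by linarith [neg_abs_le A, abs_nonneg B])
      (by linarith [le_abs_self B, abs_nonneg A])
  · have e : (fun t => φ (t + l)) = fun t => φ t * phase k l :=
      funext fun t => h.quasiPeriodic t l
    have e2 := congrArg (fun F => deriv F y) e
    simp only [deriv_comp_add_const, deriv_mul_const_field] at e2
    have e3 : a (y + l) = a y := by
      simpa using hco.per.int_mul l y
    simp only [e2, e3]
    ring

/-- The `k`-quasi-periodic extension of a function on `[0,1)`. -/
def quasiExt (k : ℝ) (f : ℝ → ℂ) (y : ℝ) : ℂ := f (Int.fract y) * phase k ⌊y⌋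

theorem quasiExt_add_int (k : ℝ) (f : ℝ → ℂ) (y : ℝ) (l : ℤ) :
    quasiExt k f (y + l) = quasiExt k f y * phase k l := by
  rw [quasiExt, quasiExt, Int.fract_add_intCast, Int.floor_add_intCast, phase_add]
  ring

theorem quasiExt_of_mem (k : ℝ) (f : ℝ → ℂ) {n : ℤ} {y : ℝ} (hy : y ∈ Ico (n : ℝ) (n + 1)) :
    quasiExt k f y = f (y - n) * phase k n := by
  have : ⌊y⌋ = n := Int.floor_eq_iff.2 hy
  rw [quasiExt, Int.fract, this]

theorem isPrim_quasiExt {k : ℝ} {f g : ℝ → ℂ} (h : IsPrim 0 1 f g) (h1 : f 1 = f 0 * phase k 1)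
    (A B : ℝ) : IsPrim A B (quasiExt k f) (quasiExt k g) := by
  have cell : ∀ n : ℤ, IsPrim n (n + 1) (quasiExt k f) (quasiExt k g) := by
    intro n
    have := (h.comp_mul_add (c := 1) (d := -n) (A' := n) (B' := n + 1) one_pos (by ring)
      (by ring)).const_mul (phase k n)
    refine this.congr (fun y hy => ?_) ?_
    · rcases hy.2.lt_or_eq with hlt | heq
      · rw [quasiExt_of_mem k f ⟨hy.1, hlt⟩, one_mul, sub_eq_add_neg, mul_comm]
      · have hy' : y ∈ Ico (((n + 1 : ℤ)) : ℝ) (((n + 1 : ℤ) : ℝ) + 1) := by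
          rw [heq]; push_cast; constructor <;> linarith
        rw [quasiExt_of_mem k f hy', heq, phase_add]
        push_cast
        rw [show (1 : ℝ) * (n + 1) + -n = 1 by ring, h1,
          show (n + 1 : ℝ) - (n + 1) = 0 by ring]
        ring
    · have h₂ : ∀ᵐ x : ℝ, x ≠ n + 1 := by simp [ae_iff, measure_singleton]
      filter_upwards [h₂] with y hne hy
      rw [quasiExt_of_mem k g ⟨hy.1, lt_of_le_of_ne hy.2 hne⟩, one_mul, sub_eq_add_neg, mul_comm]
      simp
  have big : ∀ n : ℕ, IsPrim (-n) n (quasiExt k f) (quasiExt k g) := by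
    intro n
    induction n with
    | zero => exact ⟨by simp, fun x hx => by
        have : x = 0 := by simpa using hx
        simp [this]⟩
    | succ n ih =>
      have l := cell (-(n + 1 : ℤ))
      have r := cell n
      push_cast at l r ⊢
      have l' : IsPrim (-(n + 1 : ℝ)) (-n) (quasiExt k f) (quasiExt k g) := by
        convert l using 1; ring
      have hn : (0 : ℝ) ≤ n := Nat.cast_nonneg n
      exact (l'.trans ih (by linarith) (by linarith)).trans r (by linarith) (by linarith)
  obtain ⟨n, hn⟩ := exists_nat_ge (max |A| |B|)
  refine (big n).mono ?_ ?_
  · linarith [neg_abs_le A, le_max_left |A| |B|]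
  · linarith [le_abs_self B, le_max_right |A| |B|]

theorem PeriodicCoeff.ρ_add_int {a ρ : ℝ → ℝ} {a0 a1 ρ1 : ℝ} (h : PeriodicCoeff a ρ a0 a1 ρ1) :
    ∀ᵐ y, ∀ n : ℤ, ρ (y + n) = ρ y := by
  have h1 : ∀ᵐ y, ∀ n : ℤ, ρ (y + n + 1) = ρ (y + n) := by
    rw [ae_all_iff]
    intro n
    exact (measurePreserving_add_right volume (n : ℝ)).quasiMeasurePreserving.ae h.ρ_per
  filter_upwards [h1] with y hy n
  induction n using Int.induction_on with
  | zero => simp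
  | succ n ih =>
    have := hy n
    push_cast at this ih ⊢
    rw [← add_assoc, this, ih]
  | pred n ih =>
    have := hy (-n - 1)
    push_cast at this ih ⊢
    rw [← this, ← ih]
    congr 1; ring

theorem IsSol.isBlochSol_quasiExt {a ρ : ℝ → ℝ} {a0 a1 ρ1 k lam : ℝ} {f z : ℝ → ℂ}
    (h : IsSol a ρ lam 0 1 f z) (hco : PeriodicCoeff a ρ a0 a1 ρ1)
    (hf : f 1 = f 0 * phase k 1) (hz : z 1 = z 0 * phase k 1) :
    IsBlochSol a ρ k lam (quasiExt k f) (quasiExt k z) where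
  sol A B := by
    constructor
    · refine (isPrim_quasiExt h.fst hf A B).congr (fun _ _ => rfl) (ae_of_all _ fun y _ => ?_)
      have : a (Int.fract y) = a y := by
        have := hco.per.sub_int_mul_eq (x := y) ⌊y⌋
        simpa using this
      simp only [quasiExt, this]
      ring
    · refine (isPrim_quasiExt h.snd hz A B).congr (fun _ _ => rfl) ?_
      filter_upwards [hco.ρ_add_int] with y hy _
      have : ρ (Int.fract y) = ρ y := by
        have := hy (-⌊y⌋)
        rw [Int.cast_neg, ← sub_eq_add_neg] at this
        exact this
      simp only [quasiExt, this]
      ring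
  qp := quasiExt_add_int k f
  qpz := quasiExt_add_int k z

theorem det_wron_ne_zero {a ρ : ℝ → ℝ} {a0 a1 ρ1 lam : ℝ} (hco : PeriodicCoeff a ρ a0 a1 ρ1)
    {ψ z : Fin 2 → ℝ → ℂ} (h : ∀ q A B, IsSol a ρ lam A B (ψ q) (z q))
    (hli : ∀ c : Fin 2 → ℂ, (∀ y ≥ 0, ∑ q, c q * ψ q y = 0) → c = 0) :
    (wron ψ z 0).det ≠ 0 := by
  intro h0
  rw [det_wron] at h0
  have hdet : (fundMat ψ z 0).det = 0 := by
    rcases mul_eq_zero.1 h0 with h1 | h1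
    · simpa using h1
    · exact h1
  obtain ⟨c, hc, hc0⟩ := Matrix.exists_mulVec_eq_zero_iff.2 hdet
  refine hc (hli c fun y hy => ?_)
  have hs := IsSol.sum Finset.univ c (fun q => h q 0 y)
  have e0 := congrFun hc0 0
  have e1 := congrFun hc0 1
  simp only [fundMat, Matrix.mulVec, dotProduct, Fin.sum_univ_two] at e0 e1
  refine (hs.eq_zero hco ?_ ?_ y ⟨hy, le_rfl⟩).1
  · simp only [Fin.sum_univ_two]
    simp at e0
    linear_combination e0
  · simp only [Fin.sum_univ_two]
    simp at e1
    linear_combination e1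

theorem coeffC_eq_wron {a ρ : ℝ → ℝ} {a0 a1 ρ1 lam : ℝ} (hco : PeriodicCoeff a ρ a0 a1 ρ1)
    {κ : Fin 2 → ℝ} {ψ z : Fin 2 → ℝ → ℂ} (h : ∀ q, IsBlochSol a ρ (κ q) lam (ψ q) (z q))
    (p q : Fin 2) : coeffC a (ψ p) (ψ q) = wron ψ z 0 p q := by
  have : ∀ y ∈ Ioo (0 : ℝ) 1, (a y : ℂ) * deriv (ψ q) y * conj (ψ p y) -
      ψ q y * ((a y : ℂ) * conj (deriv (ψ p) y)) = wron ψ z 0 p q := fun y hy => by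
    rw [wron_eq_of_isSol (fun q => (h q).sol 0 1) (x := 0) (y := y) (by simp)
      (Ioo_subset_Icc_self hy), ((h q).hasDerivAt hco y).deriv, ((h p).hasDerivAt hco y).deriv]
    have ha : (a y : ℂ) ≠ 0 := Complex.ofReal_ne_zero.2 (hco.a_pos y).ne'
    simp only [wron, Matrix.of_apply, map_div₀, Complex.conj_ofReal]
    field_simp
  rw [coeffC, setIntegral_congr_fun measurableSet_Ioo this]
  simp

/-- A solution of the rescaled Dirichlet problem on `(0, N)`, normalized in `L²` with weight
`α / N`. -/
structure IsCellSol (a ρ : ℝ → ℝ) (α : ℝ) (N : ℕ) (μ : ℝ) (W Z : ℝ → ℂ) : Prop where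
  N_pos : 0 < N
  sol : IsSol a ρ μ 0 N W Z
  zero_left : W 0 = 0
  zero_right : W N = 0
  norm_eq : α / N * ∫ y in (0 : ℝ)..N, ‖W y‖ ^ 2 = 1

theorem IsDirichletEigenpair.exists_isCellSol {a ρ : ℝ → ℝ} {a0 a1 ρ1 α : ℝ} (hα : 0 < α)
    (hco : PeriodicCoeff a ρ a0 a1 ρ1) {N : ℕ} (hN : 0 < N) {ε lam : ℝ} (hε : ε = α / N)
    {w : ℝ → ℂ}
    (h : IsDirichletEigenpair α (fun x => a (x / ε)) (fun x => ρ (x / ε)) lam w) :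
    ∃ Z, IsCellSol a ρ α N (ε ^ 2 * lam) (fun y => w (ε * y)) Z := by
  obtain ⟨⟨w', hw, hw0, hwα, heq⟩, hn⟩ := h
  have hN' : (0 : ℝ) < N := by exact_mod_cast hN
  have hε0 : 0 < ε := by rw [hε]; positivity
  have hεN : ε * N = α := by rw [hε]; field_simp
  have hw'i : IntegrableOn w' (Ioo 0 α) := integrableOn_of_memLp_two (by simp) hw.memLp_deriv
  have p1 : IsPrim 0 α w w' := hw.weakDeriv.isPrim hα hw'i hw.cont
  have hρi : IntervalIntegrable (fun x => ρ (x / ε)) volume 0 α := by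
    have h1 : IntervalIntegrable ρ volume 0 (α / ε) := by
      rw [intervalIntegrable_iff]
      exact Measure.integrableOn_of_bounded (M := ρ1) (by simp) hco.meas
        (ae_restrict_of_ae (by simpa using hco.ρ_le))
    have h2 := h1.comp_mul_right (c := ε⁻¹)
    simp only [← div_eq_mul_inv, zero_div] at h2
    convert h2 using 1
    field_simp
  have hi2 : IntegrableOn (fun x => -((lam * ρ (x / ε) : ℝ) : ℂ) * w x) (Icc 0 α) := by
    rw [intervalIntegrable_iff_integrableOn_Icc_of_le hα.le] at hρi
    have h3 : IntegrableOn (fun x => -((lam * ρ (x / ε) : ℝ) : ℂ)) (Icc 0 α) :=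
      (hρi.const_mul lam).ofReal.neg
    exact h3.mul_continuousOn hw.cont isCompact_Icc
  obtain ⟨P, hP, hPe⟩ := heq.exists_isPrim hα (hi2.mono_set Ioo_subset_Icc_self)
  have h₁ : ∀ᵐ x : ℝ, x ≠ 0 := by simp [ae_iff, measure_singleton]
  have h₂ : ∀ᵐ x : ℝ, x ≠ α := by simp [ae_iff, measure_singleton]
  have p2 : IsPrim 0 α w (fun x => P x / a (x / ε)) := p1.congr (fun _ _ => rfl) (by
    filter_upwards [hPe, h₁, h₂] with y hy hy1 hy2 hyI
    rw [← hy ⟨lt_of_le_of_ne hyI.1 hy1.symm, lt_of_le_of_ne hyI.2 hy2⟩, mul_div_cancel_left₀]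
    exact Complex.ofReal_ne_zero.2 (hco.a_pos _).ne')
  have hdiv : ∀ y, ε * y / ε = y := fun y => by field_simp
  refine ⟨fun y => ε * P (ε * y), hN, ⟨?_, ?_⟩, by simpa using hw0, by rw [hεN]; exact hwα, ?_⟩
  · refine (p2.comp_mul_add (c := ε) (d := 0) (A' := 0) (B' := N) hε0 (by simp)
      (by simp [hεN])).congr (fun y _ => by simp) (ae_of_all _ fun y _ => ?_)
    simp only [add_zero, hdiv]
    ring
  · refine ((hP.comp_mul_add (c := ε) (d := 0) (A' := 0) (B' := N) hε0 (by simp)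
      (by simp [hεN])).const_mul ε).congr (fun y _ => by simp) (ae_of_all _ fun y _ => ?_)
    simp only [add_zero, hdiv]
    push_cast
    ring
  · rw [← hε, ← smul_eq_mul, intervalIntegral.smul_integral_comp_mul_left (fun x => ‖w x‖ ^ 2),
      mul_zero, hεN, intervalIntegral.integral_of_le hα.le, integral_Ioc_eq_integral_Ioo, hn]

theorem IsCellSol.energy {a ρ : ℝ → ℝ} {a0 a1 ρ1 α μ : ℝ} {N : ℕ} {W Z : ℝ → ℂ}
    (h : IsCellSol a ρ α N μ W Z) (hα : 0 < α) (hco : PeriodicCoeff a ρ a0 a1 ρ1) :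
    α / N * ∫ y in (0 : ℝ)..N, ‖Z y‖ ^ 2 ≤ a1 * |μ| * ρ1 := by
  have hN : (0 : ℝ) ≤ N := Nat.cast_nonneg N
  have hZc := h.sol.snd.continuousOn
  have hWc := h.sol.fst.continuousOn
  have hp := h.sol.snd.mul h.sol.fst.star hN
  have key := hp.sub_eq (x := 0) (y := N) ⟨le_rfl, hN⟩ ⟨hN, le_rfl⟩
  simp only [h.zero_left, h.zero_right, map_zero, mul_zero, sub_zero] at key
  have iW : IntervalIntegrable (fun y => ‖W y‖ ^ 2) volume 0 N :=
    ((hWc.norm.pow 2).mono (by rw [uIcc_of_le hN])).intervalIntegrable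
  have iZ : IntervalIntegrable (fun y => ‖Z y‖ ^ 2) volume 0 N :=
    ((hZc.norm.pow 2).mono (by rw [uIcc_of_le hN])).intervalIntegrable
  have iZa : IntervalIntegrable (fun y => ‖Z y‖ ^ 2 / a y) volume 0 N := by
    refine (ContinuousOn.div (hZc.norm.pow 2) hco.continuous_a.continuousOn
      (fun y _ => (hco.a_pos y).ne')).intervalIntegrable_of_Icc hN
  have iρW : IntervalIntegrable (fun y => μ * ρ y * ‖W y‖ ^ 2) volume 0 N := by
    have h1 : IntervalIntegrable ρ volume 0 N := by
      rw [intervalIntegrable_iff]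
      exact Measure.integrableOn_of_bounded (M := ρ1) (by simp) hco.meas
        (ae_restrict_of_ae (by simpa using hco.ρ_le))
    exact (h1.const_mul μ).mul_continuousOn (by rw [uIcc_of_le hN]; exact hWc.norm.pow 2)
  have e : ∫ y in (0 : ℝ)..N, ‖Z y‖ ^ 2 / a y = ∫ y in (0 : ℝ)..N, μ * ρ y * ‖W y‖ ^ 2 := by
    have e1 : ∀ y, -((μ * ρ y : ℝ) : ℂ) * W y * conj (W y) + Z y * conj (Z y / a y) =
        ((‖Z y‖ ^ 2 / a y - μ * ρ y * ‖W y‖ ^ 2 : ℝ) : ℂ) := fun y => by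
      have e2 := Complex.mul_conj' (W y)
      have e3 := Complex.mul_conj' (Z y)
      rw [map_div₀, Complex.conj_ofReal]
      push_cast
      rw [← e2, ← e3]
      ring
    simp only [e1, intervalIntegral.integral_ofReal] at key
    have key' : ∫ y in (0 : ℝ)..N, (‖Z y‖ ^ 2 / a y - μ * ρ y * ‖W y‖ ^ 2) = 0 := by
      exact_mod_cast key.symm
    rw [intervalIntegral.integral_sub iZa iρW] at key'
    linarith
  have b1 : ∫ y in (0 : ℝ)..N, ‖Z y‖ ^ 2 ≤ a1 * ∫ y in (0 : ℝ)..N, ‖Z y‖ ^ 2 / a y := by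
    rw [← intervalIntegral.integral_const_mul]
    refine intervalIntegral.integral_mono hN iZ (iZa.const_mul a1) fun y => ?_
    have ha := hco.a_pos y
    have := hco.a_le y
    rw [mul_div_assoc', le_div_iff₀ ha, mul_comm]
    gcongr
  have b2 : ∫ y in (0 : ℝ)..N, μ * ρ y * ‖W y‖ ^ 2 ≤
      |μ| * ρ1 * ∫ y in (0 : ℝ)..N, ‖W y‖ ^ 2 := by
    rw [← intervalIntegral.integral_const_mul]
    refine intervalIntegral.integral_mono_ae hN iρW (iW.const_mul _) ?_
    filter_upwards [hco.ρ_le] with y hy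
    have : μ * ρ y ≤ |μ| * ρ1 := (le_abs_self _).trans (by rw [abs_mul]; gcongr)
    gcongr
  have hαN : 0 ≤ α / N := by positivity
  calc α / N * ∫ y in (0 : ℝ)..N, ‖Z y‖ ^ 2
      ≤ α / N * (a1 * (|μ| * ρ1 * ∫ y in (0 : ℝ)..N, ‖W y‖ ^ 2)) := by
        rw [e] at b1
        have := hco.a1_pos
        gcongr
        exact b1.trans (by gcongr)
    _ = a1 * |μ| * ρ1 * (α / N * ∫ y in (0 : ℝ)..N, ‖W y‖ ^ 2) := by ring
    _ = _ := by rw [h.norm_eq, mul_one]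

theorem restrict_cellDomain (α : ℝ) :
    (volume.restrict (cellDomain α) : Measure (ℝ × ℝ)) =
      (volume.restrict (Ioo 0 α)).prod (volume.restrict (Ioo (0 : ℝ) 1)) := by
  rw [cellDomain, Measure.volume_eq_prod, Measure.prod_restrict]

theorem measurableSet_cellDomain (α : ℝ) : MeasurableSet (cellDomain α) :=
  measurableSet_Ioo.prod measurableSet_Ioo

theorem isOpen_cellDomain (α : ℝ) : IsOpen (cellDomain α) := isOpen_Ioo.prod isOpen_Ioo

instance isFiniteMeasure_restrict_cellDomain (α : ℝ) :
    IsFiniteMeasure (volume.restrict (cellDomain α) : Measure (ℝ × ℝ)) := by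
  rw [restrict_cellDomain]; infer_instance

theorem hasDerivAt_slice {θ : ℝ × ℝ → ℝ} (hθ : ContDiff ℝ ∞ θ) (x y : ℝ) :
    HasDerivAt (fun t => θ (x, t)) (fderiv ℝ θ (x, y) (0, 1)) y := by
  have h1 := ((hθ.differentiable (by simp)) (x, y)).hasFDerivAt
  have h2 : HasDerivAt (fun t : ℝ => (x, t)) ((0 : ℝ), (1 : ℝ)) y :=
    (hasDerivAt_const y x).prodMk (hasDerivAt_id y)
  exact h1.comp_hasDerivAt y h2

theorem tsupport_slice_subset {θ : ℝ × ℝ → ℝ} {α : ℝ} (hs : tsupport θ ⊆ cellDomain α) (x : ℝ) :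
    tsupport (fun t => θ (x, t)) ⊆ Ioo 0 1 := by
  have hc : IsClosed {t : ℝ | (x, t) ∈ tsupport θ} :=
    (isClosed_tsupport θ).preimage (by fun_prop)
  refine (closure_minimal (fun t ht => ?_) hc).trans fun t ht => (hs ht).2
  exact subset_tsupport θ ht

theorem continuous_fderiv_snd {θ : ℝ × ℝ → ℝ} (hθ : ContDiff ℝ ∞ θ) :
    Continuous fun p => fderiv ℝ θ p (0, 1) :=
  (hθ.continuous_fderiv (by simp)).clm_apply continuous_const

theorem tsupport_fderiv_snd_subset {θ : ℝ × ℝ → ℝ} :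
    tsupport (fun p => fderiv ℝ θ p (0, 1)) ⊆ tsupport θ := by
  refine closure_minimal (fun p hp => ?_) (isClosed_tsupport θ)
  refine support_fderiv_subset ℝ fun h => hp ?_
  simp [h]

theorem integrable_bounded_mul {X : Type*} [MeasurableSpace X] {μ : Measure X} {F : X → ℂ}
    (hF : Integrable F μ) {θ : X → ℝ} {K : ℝ} (hm : AEStronglyMeasurable θ μ)
    (hK : ∀ x, ‖θ x‖ ≤ K) : Integrable (fun x => (θ x : ℂ) * F x) μ :=
  hF.bdd_mul (c := K) (Complex.continuous_ofReal.comp_aestronglyMeasurable hm)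
    (ae_of_all _ fun x => by simpa using hK x)

namespace IsL2H1

variable {α : ℝ} {G D G' D' : ℝ × ℝ → ℂ}

theorem integrable_test (hG : MemLp G 2 (volume.restrict (cellDomain α))) {θ : ℝ × ℝ → ℝ}
    (hθ : Continuous θ) (hc : HasCompactSupport θ) :
    Integrable (fun p => (θ p : ℂ) * G p) (volume.restrict (cellDomain α)) := by
  obtain ⟨K, hK⟩ := hc.exists_bound_of_continuous hθ
  exact integrable_bounded_mul (hG.integrable (by norm_num)) hθ.aestronglyMeasurable hK

theorem hasCompactSupport_fderiv_snd {θ : ℝ × ℝ → ℝ} (hc : HasCompactSupport θ) :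
    HasCompactSupport fun p => fderiv ℝ θ p (0, 1) :=
  HasCompactSupport.of_support_subset_isCompact hc
    ((subset_tsupport _).trans tsupport_fderiv_snd_subset)

theorem congr (h : IsL2H1 α G D) (hG : G =ᵐ[volume.restrict (cellDomain α)] G')
    (hD : D =ᵐ[volume.restrict (cellDomain α)] D') : IsL2H1 α G' D' := by
  refine ⟨h.memLp.ae_eq hG, h.memLp_deriv.ae_eq hD, fun θ h1 h2 h3 => ?_⟩
  have e1 : ∫ p in cellDomain α, ((fderiv ℝ θ p (0, 1) : ℝ) : ℂ) * G p =
      ∫ p in cellDomain α, ((fderiv ℝ θ p (0, 1) : ℝ) : ℂ) * G' p :=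
    integral_congr_ae (hG.mono fun p hp => by simp only [hp])
  have e2 : ∫ p in cellDomain α, (θ p : ℂ) * D p = ∫ p in cellDomain α, (θ p : ℂ) * D' p :=
    integral_congr_ae (hD.mono fun p hp => by simp only [hp])
  rw [← e1, ← e2]
  exact h.integral_eq θ h1 h2 h3

theorem add (h : IsL2H1 α G D) (h' : IsL2H1 α G' D') :
    IsL2H1 α (fun p => G p + G' p) (fun p => D p + D' p) := by
  refine ⟨h.memLp.add h'.memLp, h.memLp_deriv.add h'.memLp_deriv, fun θ h1 h2 h3 => ?_⟩
  have c1 := continuous_fderiv_snd h1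
  have c2 := hasCompactSupport_fderiv_snd h2
  simp only [mul_add]
  rw [integral_add (integrable_test h.memLp c1 c2) (integrable_test h'.memLp c1 c2),
    integral_add (integrable_test h.memLp_deriv h1.continuous h2)
      (integrable_test h'.memLp_deriv h1.continuous h2),
    h.integral_eq θ h1 h2 h3, h'.integral_eq θ h1 h2 h3]
  ring

theorem const_mul (h : IsL2H1 α G D) (c : ℂ) :
    IsL2H1 α (fun p => c * G p) (fun p => c * D p) := by
  refine ⟨h.memLp.const_mul c, h.memLp_deriv.const_mul c, fun θ h1 h2 h3 => ?_⟩
  simp only [mul_left_comm _ c, integral_const_mul, h.integral_eq θ h1 h2 h3, mul_neg]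

theorem sub (h : IsL2H1 α G D) (h' : IsL2H1 α G' D') :
    IsL2H1 α (fun p => G p - G' p) (fun p => D p - D' p) :=
  (h.add (h'.const_mul (-1))).congr (ae_of_all _ fun p => by ring) (ae_of_all _ fun p => by ring)

theorem sum {ι : Type*} (s : Finset ι) {G D : ι → ℝ × ℝ → ℂ} (h : ∀ i ∈ s, IsL2H1 α (G i) (D i)) :
    IsL2H1 α (fun p => ∑ i ∈ s, G i p) (fun p => ∑ i ∈ s, D i p) := by
  classical
  induction s using Finset.induction_on with
  | empty =>
    simp only [Finset.sum_empty]
    exact ⟨MemLp.zero, MemLp.zero, fun θ _ _ _ => by simp⟩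
  | insert i s hi ih =>
    simp only [Finset.sum_insert hi]
    exact (h i (Finset.mem_insert_self i s)).add
      (ih fun j hj => h j (Finset.mem_insert_of_mem hj))

theorem deriv_unique (h : IsL2H1 α G D) (h' : IsL2H1 α G D') :
    D =ᵐ[volume.restrict (cellDomain α)] D' := by
  have hi : IntegrableOn D (cellDomain α) := h.memLp_deriv.integrable (by norm_num)
  have hi' : IntegrableOn D' (cellDomain α) := h'.memLp_deriv.integrable (by norm_num)
  have hl : LocallyIntegrableOn (fun p => D p - D' p) (cellDomain α) :=
    (hi.sub hi').locallyIntegrableOn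
  have key := (isOpen_cellDomain α).ae_eq_zero_of_integral_contDiff_smul_eq_zero hl
    (fun θ h1 h2 h3 => ?_)
  · refine (ae_restrict_iff' (measurableSet_cellDomain α)).2 ?_
    filter_upwards [key] with p hp hpc
    exact sub_eq_zero.1 (hp hpc)
  · have e := (h.integral_eq θ h1 h2 h3).symm.trans (h'.integral_eq θ h1 h2 h3)
    simp only [Complex.real_smul]
    rw [← integral_eq_of_tsupport_subset h3]
    simp only [mul_sub]
    rw [integral_sub (integrable_test h.memLp_deriv h1.continuous h2)
      (integrable_test h'.memLp_deriv h1.continuous h2)]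
    rw [neg_inj.1 e, sub_self]

theorem memLp_two_mul_prod {f h : ℝ → ℂ} {μ ν : Measure ℝ} [SFinite μ] [SFinite ν]
    (hf : MemLp f 2 μ) (hh : MemLp h 2 ν) :
    MemLp (fun p : ℝ × ℝ => f p.1 * h p.2) 2 (μ.prod ν) := by
  have hm : AEStronglyMeasurable (fun p : ℝ × ℝ => f p.1 * h p.2) (μ.prod ν) :=
    hf.1.comp_fst.mul hh.1.comp_snd
  rw [memLp_two_iff_integrable_sq_norm hm]
  have := ((memLp_two_iff_integrable_sq_norm hf.1).1 hf).mul_prod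
    ((memLp_two_iff_integrable_sq_norm hh.1).1 hh)
  refine this.congr (ae_of_all _ fun p => ?_)
  simp only [norm_mul]
  ring

theorem tensor {f h h' : ℝ → ℂ} (hf : MemLp f 2 (volume.restrict (Ioo 0 α)))
    (hh : IsPrim 0 1 h h') (hh' : MemLp h' 2 (volume.restrict (Ioo (0 : ℝ) 1))) :
    IsL2H1 α (fun p => f p.1 * h p.2) (fun p => f p.1 * h' p.2) := by
  have hhm : MemLp h 2 (volume.restrict (Ioo (0 : ℝ) 1)) := by
    obtain ⟨K, hK⟩ := isCompact_Icc.exists_bound_of_continuousOn hh.continuousOn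
    refine MemLp.of_bound ((hh.continuousOn.mono
      Ioo_subset_Icc_self).aestronglyMeasurable measurableSet_Ioo) K ?_
    exact (ae_restrict_iff' measurableSet_Ioo).2
      (ae_of_all _ fun y hy => hK y (Ioo_subset_Icc_self hy))
  have m1 : MemLp (fun p : ℝ × ℝ => f p.1 * h p.2) 2 (volume.restrict (cellDomain α)) := by
    rw [restrict_cellDomain]; exact memLp_two_mul_prod hf hhm
  have m2 : MemLp (fun p : ℝ × ℝ => f p.1 * h' p.2) 2 (volume.restrict (cellDomain α)) := by
    rw [restrict_cellDomain]; exact memLp_two_mul_prod hf hh'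
  refine ⟨m1, m2, fun θ h1 h2 h3 => ?_⟩
  have i1 := integrable_test m1 (continuous_fderiv_snd h1) (hasCompactSupport_fderiv_snd h2)
  have i2 := integrable_test m2 h1.continuous h2
  rw [restrict_cellDomain] at i1 i2 ⊢
  rw [integral_prod _ i1, integral_prod _ i2, ← integral_neg]
  congr 1
  ext x
  have hsl : ContDiff ℝ ∞ fun t => θ (x, t) := h1.comp (by fun_prop)
  have key := hh.integral_test zero_le_one hsl (tsupport_slice_subset h3 x)
  have hd : ∀ y, deriv (fun t => θ (x, t)) y = fderiv ℝ θ (x, y) (0, 1) :=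
    fun y => (hasDerivAt_slice h1 x y).deriv
  simp only [hd] at key
  simp only [mul_left_comm _ (f x), integral_const_mul]
  rw [key, mul_neg]

end IsL2H1

/-- The function equal to `H l y` on the product of the cell `[ε l, ε l + ε)` with `Y`. -/
def stepFun (ε : ℝ) (H : ℕ → ℝ → ℂ) (p : ℝ × ℝ) : ℂ := H ⌊p.1 / ε⌋₊ p.2

theorem floor_lt_of_mem {α ε x : ℝ} {N : ℕ} (hε : 0 < ε) (hεN : ε * N = α) (hx : x ∈ Ioo 0 α) :
    ⌊x / ε⌋₊ < N := by
  rw [Nat.floor_lt (div_nonneg hx.1.le hε.le), div_lt_iff₀ hε, mul_comm, hεN]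
  exact hx.2

theorem floor_eq_iff_mem_Ico {ε x : ℝ} (hε : 0 < ε) (hx : 0 ≤ x) (l : ℕ) :
    ⌊x / ε⌋₊ = l ↔ x ∈ Ico (ε * l) (ε * (l + 1)) := by
  rw [Nat.floor_eq_iff (div_nonneg hx hε.le), le_div_iff₀ hε, div_lt_iff₀ hε, mul_comm ε,
    mul_comm ε, mem_Ico]

theorem step_eq_sum {E : Type*} [AddCommMonoid E] {α ε x : ℝ} {N : ℕ} (hε : 0 < ε)
    (hεN : ε * N = α) (hx : x ∈ Ioo 0 α) (Φ : ℕ → E) :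
    Φ ⌊x / ε⌋₊ = ∑ l ∈ Finset.range N, (Ico (ε * l) (ε * (l + 1))).indicator (fun _ => Φ l) x := by
  classical
  rw [Finset.sum_eq_single ⌊x / ε⌋₊]
  · rw [indicator_of_mem]
    exact (floor_eq_iff_mem_Ico hε hx.1.le _).1 rfl
  · intro l _ hl
    rw [indicator_of_notMem]
    exact fun h => hl ((floor_eq_iff_mem_Ico hε hx.1.le _).2 h).symm
  · intro h
    exact absurd (Finset.mem_range.2 (floor_lt_of_mem hε hεN hx)) h

theorem Ico_cell_subset {α ε : ℝ} {N : ℕ} (hε : 0 < ε) (hεN : ε * N = α) {l : ℕ} (hl : l < N) :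
    Ico (ε * l) (ε * (l + 1)) ⊆ Ico 0 α := by
  have h1 : (l + 1 : ℝ) ≤ N := by exact_mod_cast hl
  exact Ico_subset_Ico (by positivity) (by rw [← hεN]; gcongr)

theorem integral_step {α ε : ℝ} {N : ℕ} (hε : 0 < ε) (hεN : ε * N = α) (Φ : ℕ → ℝ) :
    ∫ x in Ioo 0 α, Φ ⌊x / ε⌋₊ = ε * ∑ l ∈ Finset.range N, Φ l := by
  rw [setIntegral_congr_fun measurableSet_Ioo fun x hx => step_eq_sum hε hεN hx Φ,
    integral_finsetSum, Finset.mul_sum]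
  · refine Finset.sum_congr rfl fun l hl => ?_
    rw [← integral_Ico_eq_integral_Ioo, setIntegral_indicator measurableSet_Ico,
      inter_eq_self_of_subset_right (Ico_cell_subset hε hεN (Finset.mem_range.1 hl))]
    simp only [integral_const, measureReal_restrict_apply_univ, smul_eq_mul]
    rw [Real.volume_real_Ico_of_le (by nlinarith)]
    ring
  · intro l _
    exact (integrable_const (Φ l)).indicator measurableSet_Ico

theorem stepFun_ae_eq {α ε : ℝ} {N : ℕ} (hε : 0 < ε) (hεN : ε * N = α) (H : ℕ → ℝ → ℂ) :
    (fun p => ∑ l ∈ Finset.range N, (Ico (ε * l) (ε * (l + 1))).indicator (fun _ => (1 : ℂ)) p.1 *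
      H l p.2) =ᵐ[volume.restrict (cellDomain α)] stepFun ε H := by
  refine (ae_restrict_iff' (measurableSet_cellDomain α)).2 (ae_of_all _ fun p hp => ?_)
  have := step_eq_sum hε hεN hp.1 (fun l => H l p.2)
  simp only [stepFun]
  rw [this]
  refine Finset.sum_congr rfl fun l _ => ?_
  by_cases h : p.1 ∈ Ico (ε * l) (ε * (l + 1)) <;> simp [h]

theorem isL2H1_stepFun {α ε : ℝ} {N : ℕ} (hε : 0 < ε) (hεN : ε * N = α) {H H' : ℕ → ℝ → ℂ}
    (h : ∀ l < N, IsPrim 0 1 (H l) (H' l))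
    (h' : ∀ l < N, MemLp (H' l) 2 (volume.restrict (Ioo (0 : ℝ) 1))) :
    IsL2H1 α (stepFun ε H) (stepFun ε H') := by
  refine (IsL2H1.sum (Finset.range N) fun l hl => IsL2H1.tensor
    (f := (Ico (ε * l) (ε * (l + 1))).indicator (fun _ => (1 : ℂ)))
    ?_ (h l (Finset.mem_range.1 hl)) (h' l (Finset.mem_range.1 hl))).congr
    (stepFun_ae_eq hε hεN H) (stepFun_ae_eq hε hεN H')
  exact (memLp_const (1 : ℂ)).indicator measurableSet_Ico

theorem integral_norm_sq_stepFun {α ε : ℝ} {N : ℕ} (hε : 0 < ε) (hεN : ε * N = α)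
    {H : ℕ → ℝ → ℂ} (hm : MemLp (stepFun ε H) 2 (volume.restrict (cellDomain α))) :
    ∫ p in cellDomain α, ‖stepFun ε H p‖ ^ 2 =
      ε * ∑ l ∈ Finset.range N, ∫ y in (0 : ℝ)..1, ‖H l y‖ ^ 2 := by
  have hi := (memLp_two_iff_integrable_sq_norm hm.1).1 hm
  rw [restrict_cellDomain] at hi ⊢
  rw [integral_prod _ hi]
  simp only [stepFun]
  rw [integral_step hε hεN fun l => ∫ y in Ioo (0 : ℝ) 1, ‖H l y‖ ^ 2]
  simp only [intervalIntegral.integral_of_le zero_le_one, integral_Ioc_eq_integral_Ioo]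

theorem ae_fst_notMem (α : ℝ) {S : Set ℝ} (hS : S.Countable) :
    ∀ᵐ p ∂(volume.restrict (cellDomain α)), p.1 ∉ S := by
  have h : ∀ᵐ x ∂(volume.restrict (Ioo 0 α)), x ∉ S := ae_restrict_of_ae (hS.ae_notMem _)
  rw [restrict_cellDomain]
  exact Measure.quasiMeasurePreserving_fst.ae h

theorem twoScale_ae_eq {α ε : ℝ} {N : ℕ} (hε : 0 < ε) (hεN : ε * N = α) (σ : ℝ) (u : ℝ → ℂ) :
    twoScale α ε σ u =ᵐ[volume.restrict (cellDomain α)]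
      stepFun ε (fun l y => phase (-σ) l * u (ε * (l + y))) := by
  have hS : (range fun l : ℕ => ε * l).Countable := countable_range _
  filter_upwards [ae_fst_notMem α hS, ae_restrict_mem (measurableSet_cellDomain α)] with p hp hpc
  set n := ⌊p.1 / ε⌋₊ with hn
  have hnN : n < N := floor_lt_of_mem hε hεN hpc.1
  have hmem := (floor_eq_iff_mem_Ico hε hpc.1.1.le n).1 rfl
  have hlt : ε * n < p.1 := lt_of_le_of_ne hmem.1 fun h => hp ⟨n, h⟩
  have hx : p.1 ∈ Ioo (ε * (n : ℤ)) (ε * (n : ℤ) + ε) := by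
    push_cast
    exact ⟨hlt, by linarith [hmem.2]⟩
  have hsub : Ioo (ε * (n : ℤ)) (ε * (n : ℤ) + ε) ⊆ Ioo 0 α := by
    push_cast
    have h1 : (n + 1 : ℝ) ≤ N := by exact_mod_cast hnN
    refine Ioo_subset_Ioo (by positivity) ?_
    calc ε * n + ε = ε * (n + 1) := by ring
      _ ≤ ε * N := by gcongr
      _ = α := hεN
  simp only [twoScale]
  rw [finsum_eq_single _ (n : ℤ)]
  · simp only [hsub, finsum_true]
    rw [indicator_of_mem hx, stepFun, ← hn, phase]
    have e : -(2 * Real.pi * σ * ((n : ℤ) : ℝ) : ℝ) = 2 * Real.pi * -σ * ((n : ℤ) : ℝ) := by ring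
    rw [← Complex.ofReal_neg, e, mul_comm]
    push_cast
    congr 2
    ring
  · intro l hl
    rw [indicator_of_notMem, finsum_zero]
    intro hxl
    apply hl
    have h1 : ε * (l : ℝ) < ε * ((n : ℤ) + 1 : ℝ) := by linarith [hxl.1, hx.2]
    have h2 : ε * ((n : ℤ) : ℝ) < ε * ((l : ℝ) + 1) := by linarith [hxl.2, hx.1]
    have h3 : (l : ℝ) < (n : ℤ) + 1 := lt_of_mul_lt_mul_left h1 hε.le
    have h4 : ((n : ℤ) : ℝ) < l + 1 := lt_of_mul_lt_mul_left h2 hε.le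
    have h5 : l < (n : ℤ) + 1 := by exact_mod_cast h3
    have h6 : (n : ℤ) < l + 1 := by exact_mod_cast h4
    omega

/-- The phase factor of `twoScaleSum` on the `l`-th cell. -/
def phaseSum (k : ℝ) (l : ℕ) : ℂ := ∑ σ ∈ ({k, -k} : Finset ℝ), phase (-σ) l

theorem norm_phaseSum_le (k : ℝ) (l : ℕ) : ‖phaseSum k l‖ ≤ 2 := by
  refine (norm_sum_le _ _).trans ?_
  simp only [norm_phase, Finset.sum_const, nsmul_eq_mul, mul_one]
  exact_mod_cast Finset.card_le_two

theorem twoScaleSum_ae_eq {α ε : ℝ} {N : ℕ} (hε : 0 < ε) (hεN : ε * N = α) (k : ℝ) (u : ℝ → ℂ) :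
    twoScaleSum α ε k u =ᵐ[volume.restrict (cellDomain α)]
      stepFun ε (fun l y => phaseSum k l * u (ε * (l + y))) := by
  have h : ∀ᵐ p ∂(volume.restrict (cellDomain α)), ∀ σ ∈ ({k, -k} : Finset ℝ),
      twoScale α ε σ u p = stepFun ε (fun l y => phase (-σ) l * u (ε * (l + y))) p := by
    rw [Filter.eventually_all_finset]
    exact fun σ _ => twoScale_ae_eq hε hεN σ u
  filter_upwards [h] with p hp
  rw [twoScaleSum, Finset.sum_congr rfl hp]
  simp only [stepFun, phaseSum, Finset.sum_mul]

section cell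

variable {a ρ : ℝ → ℝ} {a0 a1 ρ1 α μ : ℝ} {N : ℕ} {W Z : ℝ → ℂ}

theorem IsSol.comp_add {A B : ℝ} (h : IsSol a ρ μ A B W Z) (d : ℝ) :
    IsSol (fun y => a (d + y)) (fun y => ρ (d + y)) μ (A - d) (B - d)
      (fun y => W (d + y)) (fun y => Z (d + y)) := by
  constructor
  · refine (h.fst.comp_mul_add (c := 1) (d := d) (A' := A - d) (B' := B - d) one_pos (by ring)
      (by ring)).congr (fun y _ => by rw [one_mul, add_comm]) (ae_of_all _ fun y _ => ?_)
    simp [add_comm]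
  · refine (h.snd.comp_mul_add (c := 1) (d := d) (A' := A - d) (B' := B - d) one_pos (by ring)
      (by ring)).congr (fun y _ => by rw [one_mul, add_comm]) (ae_of_all _ fun y _ => ?_)
    simp [add_comm]

theorem IsSol.cell (h : IsSol a ρ μ 0 N W Z) (hco : PeriodicCoeff a ρ a0 a1 ρ1) {l : ℕ}
    (hl : l < N) : IsSol a ρ μ 0 1 (fun y => W (l + y)) (fun y => Z (l + y)) := by
  have hl' : (l + 1 : ℝ) ≤ N := by exact_mod_cast hl
  have h1 := (h.comp_add (l : ℝ)).mono (A' := 0) (B' := 1) (by simp) (by linarith)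
  have ha : ∀ y, a (l + y) = a y := fun y => by
    have := hco.per.nat_mul l y
    rw [mul_one] at this
    rw [add_comm, this]
  constructor
  · exact h1.fst.congr (fun _ _ => rfl) (ae_of_all _ fun y _ => by rw [ha])
  · refine h1.snd.congr (fun _ _ => rfl) ?_
    filter_upwards [hco.ρ_add_int] with y hy _
    have := hy l
    push_cast at this
    rw [add_comm (l : ℝ) y, this]

theorem sum_integral_cells {f : ℝ → ℝ} (hf : ContinuousOn f (Icc 0 (N : ℝ))) :
    ∑ l ∈ Finset.range N, ∫ y in (0 : ℝ)..1, f (l + y) = ∫ y in (0 : ℝ)..N, f y := by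
  have := intervalIntegral.sum_integral_adjacent_intervals (f := f) (μ := volume)
    (a := fun n : ℕ => (n : ℝ)) (n := N) (fun l hl => by
      refine (hf.mono ?_).intervalIntegrable
      rw [uIcc_of_le (by push_cast; linarith)]
      exact Icc_subset_Icc (by positivity) (by exact_mod_cast hl))
  simp only [Nat.cast_zero] at this
  rw [← this]
  refine Finset.sum_congr rfl fun l _ => ?_
  rw [intervalIntegral.integral_comp_add_left f]
  push_cast
  simp

/-- Modulated unfolding of a solution on `(0, N)`. -/
theorem IsCellSol.isL2H1 (h : IsCellSol a ρ α N μ W Z) (hα : 0 < α)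
    (hco : PeriodicCoeff a ρ a0 a1 ρ1) (c : ℕ → ℂ) :
    IsL2H1 α (stepFun (α / N) fun l y => c l * W (l + y))
      (stepFun (α / N) fun l y => c l * (Z (l + y) / a y)) := by
  have hN : (0 : ℝ) < N := by exact_mod_cast h.N_pos
  refine isL2H1_stepFun (N := N) (by positivity) (by field_simp)
    (fun l hl => ((h.sol.cell hco hl).fst.const_mul (c l))) fun l hl => ?_
  have hc : ContinuousOn (fun y => c l * (Z (l + y) / a y)) (Icc 0 1) :=
    continuousOn_const.mul ((h.sol.cell hco hl).snd.continuousOn.div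
      (Complex.continuous_ofReal.comp hco.continuous_a).continuousOn
      fun y _ => Complex.ofReal_ne_zero.2 (hco.a_pos y).ne')
  obtain ⟨K, hK⟩ := isCompact_Icc.exists_bound_of_continuousOn hc
  exact MemLp.of_bound ((hc.mono Ioo_subset_Icc_self).aestronglyMeasurable measurableSet_Ioo) K
    ((ae_restrict_iff' measurableSet_Ioo).2
      (ae_of_all _ fun y hy => hK y (Ioo_subset_Icc_self hy)))

theorem IsCellSol.norm_sq_le (h : IsCellSol a ρ α N μ W Z) (hα : 0 < α)
    (hco : PeriodicCoeff a ρ a0 a1 ρ1) {c : ℕ → ℂ} {K : ℝ} (hc : ∀ l, ‖c l‖ ≤ K) :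
    (∫ p in cellDomain α, ‖stepFun (α / N) (fun l y => c l * W (l + y)) p‖ ^ 2) ≤ K ^ 2 ∧
    (∫ p in cellDomain α, ‖stepFun (α / N) (fun l y => c l * (Z (l + y) / a y)) p‖ ^ 2) ≤
      K ^ 2 * (a1 * |μ| * ρ1 / a0 ^ 2) := by
  have hN : (0 : ℝ) < N := by exact_mod_cast h.N_pos
  have hK : 0 ≤ K := (norm_nonneg _).trans (hc 0)
  have hL := h.isL2H1 hα hco c
  have hαN : 0 < α / N := by positivity
  have hαN' : α / N * N = α := by field_simp
  have ha0 := hco.a0_pos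
  have hWc := h.sol.fst.continuousOn
  have hZc := h.sol.snd.continuousOn
  have cellc : ∀ {f : ℝ → ℂ}, ContinuousOn f (Icc 0 (N : ℝ)) → ∀ l < N,
      ContinuousOn (fun y => f (l + y)) (Icc (0 : ℝ) 1) := fun {f} hf l hl => by
    have hl' : (l + 1 : ℝ) ≤ N := by exact_mod_cast hl
    exact hf.comp (by fun_prop) fun y hy => ⟨by have := hy.1; positivity, by linarith [hy.2]⟩
  rw [integral_norm_sq_stepFun hαN hαN' hL.memLp, integral_norm_sq_stepFun hαN hαN' hL.memLp_deriv]
  constructor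
  · calc α / N * ∑ l ∈ Finset.range N, ∫ y in (0 : ℝ)..1, ‖c l * W (l + y)‖ ^ 2
        ≤ α / N * ∑ l ∈ Finset.range N, ∫ y in (0 : ℝ)..1, K ^ 2 * ‖W (l + y)‖ ^ 2 := by
          gcongr with l hl
          have hw := cellc hWc l (Finset.mem_range.1 hl)
          refine intervalIntegral.integral_mono_on zero_le_one
            (((continuousOn_const.mul hw).norm.pow 2).intervalIntegrable_of_Icc zero_le_one)
            ((continuousOn_const.mul (hw.norm.pow 2)).intervalIntegrable_of_Icc zero_le_one)
            fun y _ => ?_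
          rw [norm_mul, mul_pow]
          gcongr
          exact hc l
      _ = K ^ 2 * (α / N * ∫ y in (0 : ℝ)..N, ‖W y‖ ^ 2) := by
          simp only [intervalIntegral.integral_const_mul]
          rw [← Finset.mul_sum, sum_integral_cells (f := fun y => ‖W y‖ ^ 2) (hWc.norm.pow 2)]
          ring
      _ = K ^ 2 := by rw [h.norm_eq, mul_one]
  · calc α / N * ∑ l ∈ Finset.range N, ∫ y in (0 : ℝ)..1, ‖c l * (Z (l + y) / a y)‖ ^ 2
        ≤ α / N * ∑ l ∈ Finset.range N, ∫ y in (0 : ℝ)..1, K ^ 2 / a0 ^ 2 * ‖Z (l + y)‖ ^ 2 := by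
          gcongr with l hl
          have hz := cellc hZc l (Finset.mem_range.1 hl)
          refine intervalIntegral.integral_mono_on zero_le_one
            (((continuousOn_const.mul (hz.div (Complex.continuous_ofReal.comp
              hco.continuous_a).continuousOn fun y _ =>
                Complex.ofReal_ne_zero.2 (hco.a_pos y).ne')).norm.pow
                  2).intervalIntegrable_of_Icc zero_le_one)
            ((continuousOn_const.mul (hz.norm.pow 2)).intervalIntegrable_of_Icc zero_le_one)
            fun y _ => ?_
          rw [norm_mul, mul_pow]
          calc _ ≤ K ^ 2 * (‖Z (l + y)‖ / a0) ^ 2 := by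
                gcongr
                · exact hc l
                · exact hco.norm_div_le _ y
            _ = _ := by ring
      _ = K ^ 2 / a0 ^ 2 * (α / N * ∫ y in (0 : ℝ)..N, ‖Z y‖ ^ 2) := by
          simp only [intervalIntegral.integral_const_mul]
          rw [← Finset.mul_sum, sum_integral_cells (f := fun y => ‖Z y‖ ^ 2) (hZc.norm.pow 2)]
          ring
      _ ≤ K ^ 2 / a0 ^ 2 * (a1 * |μ| * ρ1) := by
          exact mul_le_mul_of_nonneg_left (h.energy hα hco) (by positivity)
      _ = _ := by ring

end cell

theorem norm_integral_mul_le_sqrt {X : Type*} [MeasurableSpace X] {μ : Measure X} {f g : X → ℂ}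
    (hf : MemLp f 2 μ) (hg : MemLp g 2 μ) :
    ‖∫ x, f x * g x ∂μ‖ ≤ √(∫ x, ‖f x‖ ^ 2 ∂μ) * √(∫ x, ‖g x‖ ^ 2 ∂μ) := by
  have h2 : ENNReal.ofReal 2 = 2 := by simp
  have h := integral_mul_le_Lp_mul_Lq_of_nonneg (μ := μ) Real.HolderConjugate.two_two
    (f := fun x => ‖f x‖) (g := fun x => ‖g x‖) (ae_of_all _ fun x => norm_nonneg _)
    (ae_of_all _ fun x => norm_nonneg _) (by rw [h2]; exact hf.norm) (by rw [h2]; exact hg.norm)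
  refine (norm_integral_le_integral_norm _).trans ?_
  simp only [norm_mul]
  refine h.trans (le_of_eq ?_)
  rw [Real.sqrt_eq_rpow, Real.sqrt_eq_rpow]
  norm_cast

theorem norm_toLp_two_sq {X : Type*} [MeasurableSpace X] {μ : Measure X} {f : X → ℂ}
    (hf : MemLp f 2 μ) : ‖hf.toLp f‖ ^ 2 = ∫ x, ‖f x‖ ^ 2 ∂μ := by
  have hn : 0 ≤ ∫ x, ‖f x‖ ^ 2 ∂μ := integral_nonneg fun x => by positivity
  rw [Lp.norm_toLp, hf.eLpNorm_eq_integral_rpow_norm (by norm_num) (by norm_num)]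
  simp only [ENNReal.toReal_ofNat, Real.rpow_ofNat]
  rw [ENNReal.toReal_ofReal (by positivity), ← Real.rpow_natCast, ← Real.rpow_mul hn]
  norm_num

/-- Translations are continuous in `L²(ℝ)`. -/
theorem tendsto_integral_norm_sq_shift {F : ℝ → ℂ} (hF : MemLp F 2 volume) {h : ℕ → ℝ}
    (hh : Tendsto h atTop (𝓝 0)) :
    Tendsto (fun j => ∫ x, ‖F (h j + x) - F x‖ ^ 2) atTop (𝓝 0) := by
  have : Fact ((2 : ENNReal) ≠ ⊤) := ⟨by norm_num⟩
  have hm : ∀ c : ℝ, MemLp (fun x => F (c + x)) 2 volume := fun c =>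
    hF.comp_measurePreserving (measurePreserving_add_left volume c)
  have h1 : Continuous fun c : ℝ => (DomAddAct.mk c +ᵥ hF.toLp F : Lp ℂ 2 (volume : Measure ℝ)) :=
    (DomAddAct.mkHomeomorph.continuous).vadd continuous_const
  have h2 := ((h1.tendsto 0).comp hh)
  have e0 : (DomAddAct.mk (0 : ℝ) +ᵥ hF.toLp F : Lp ℂ 2 (volume : Measure ℝ)) = hF.toLp F := by
    rw [DomAddAct.mk_vadd_toLp]
    simp
  rw [e0] at h2
  have h3 := (tendsto_iff_norm_sub_tendsto_zero.1 h2).pow 2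
  simp only [ne_eq, OfNat.ofNat_ne_zero, not_false_eq_true, zero_pow] at h3
  refine h3.congr fun j => ?_
  have e1 : (DomAddAct.mk (h j) +ᵥ hF.toLp F : Lp ℂ 2 (volume : Measure ℝ)) =
      (hm (h j)).toLp _ := DomAddAct.mk_vadd_toLp _ _
  rw [Function.comp_apply, e1, ← MemLp.toLp_sub, norm_toLp_two_sq]
  rfl

theorem tendsto_integral_mul_shift_sub {F : ℝ → ℂ} (hF : MemLp F 2 volume) {h : ℕ → ℝ}
    (hh : Tendsto h atTop (𝓝 0)) {X : ℕ → ℝ → ℂ} (hX : ∀ j, MemLp (X j) 2 volume) {K : ℝ}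
    (hK : ∀ j, ∫ x, ‖X j x‖ ^ 2 ≤ K) :
    Tendsto (fun j => ∫ x, X j x * (F (h j + x) - F x)) atTop (𝓝 0) := by
  have hm : ∀ c : ℝ, MemLp (fun x => F (c + x)) 2 volume := fun c =>
    hF.comp_measurePreserving (measurePreserving_add_left volume c)
  have h1 := ((tendsto_integral_norm_sq_shift hF hh).sqrt).const_mul √K
  rw [Real.sqrt_zero, mul_zero] at h1
  refine squeeze_zero_norm (fun j => ?_) h1
  refine (norm_integral_mul_le_sqrt (hX j) ((hm (h j)).sub hF)).trans ?_
  simp only [Pi.sub_apply]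
  gcongr
  exact hK j

theorem measurable_step {E : Type*} [MeasurableSpace E] (ε : ℝ) (Φ : ℕ → E) :
    Measurable fun t : ℝ => Φ ⌊t / ε⌋₊ :=
  measurable_from_top.comp (Nat.measurable_floor.comp (measurable_id.div_const ε))

theorem memLp_step {α ε : ℝ} {N : ℕ} (hε : 0 < ε) (hεN : ε * N = α) (Φ : ℕ → ℂ) :
    MemLp (fun t : ℝ => Φ ⌊t / ε⌋₊) 2 (volume.restrict (Ioo 0 α)) := by
  refine MemLp.of_bound (measurable_step ε Φ).aestronglyMeasurable
    (∑ l ∈ Finset.range N, ‖Φ l‖) ?_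
  refine (ae_restrict_iff' measurableSet_Ioo).2 (ae_of_all _ fun t ht => ?_)
  exact Finset.single_le_sum (f := fun l => ‖Φ l‖) (fun _ _ => norm_nonneg _)
    (Finset.mem_range.2 (floor_lt_of_mem hε hεN ht))

/-- The increments of bounded step functions converge weakly to zero. -/
theorem tendsto_integral_step_increment {α : ℝ} (hα : 0 < α) {N : ℕ → ℕ} (hN : ∀ j, 0 < N j)
    (hε : Tendsto (fun j => α / N j) atTop (𝓝 0)) {x : ℕ → ℕ → ℂ} {K : ℝ}
    (hK : ∀ j, α / N j * ∑ l ∈ Finset.range (N j + 1), ‖x j l‖ ^ 2 ≤ K)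
    {F : ℝ → ℂ} (hF : MemLp F 2 (volume.restrict (Ioo 0 α))) :
    Tendsto (fun j => ∫ t in Ioo 0 α,
      (x j (⌊t / (α / N j)⌋₊ + 1) - x j ⌊t / (α / N j)⌋₊) * F t) atTop (𝓝 0) := by
  have hN' : ∀ j, (0 : ℝ) < N j := fun j => by exact_mod_cast hN j
  have hε0 : ∀ j, 0 < α / N j := fun j => div_pos hα (hN' j)
  have hεN : ∀ j, α / N j * N j = α := fun j => div_mul_cancel₀ _ (hN' j).ne'
  set F' := (Ioo 0 α).indicator F with hF'
  have hF'm : MemLp F' 2 volume := (memLp_indicator_iff_restrict measurableSet_Ioo).2 hF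
  set X : ℕ → ℝ → ℂ := fun j =>
    (Ioo 0 (α + α / N j)).indicator fun t => x j ⌊t / (α / N j)⌋₊ with hX
  have hεN' : ∀ j, α / N j * (N j + 1 : ℕ) = α + α / N j := fun j => by
    push_cast; rw [mul_add, hεN, mul_one]
  have hXm : ∀ j, MemLp (X j) 2 volume := fun j =>
    (memLp_indicator_iff_restrict measurableSet_Ioo).2 (memLp_step (hε0 j) (hεN' j) (x j))
  have hXK : ∀ j, ∫ t, ‖X j t‖ ^ 2 ≤ K := fun j => by
    refine le_trans (le_of_eq ?_) (hK j)
    rw [← integral_step (hε0 j) (hεN' j) fun l => ‖x j l‖ ^ 2,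
      ← integral_indicator measurableSet_Ioo]
    congr 1
    ext t
    by_cases ht : t ∈ Ioo 0 (α + α / N j) <;> simp [hX, ht]
  have key := tendsto_integral_mul_shift_sub hF'm (h := fun j => -(α / N j))
    (by simpa using hε.neg) hXm hXK
  refine key.congr fun j => ?_
  have hm : MemLp (fun t => F' (-(α / N j) + t)) 2 volume :=
    hF'm.comp_measurePreserving (measurePreserving_add_left volume _)
  have hmX : MemLp (fun t => X j (α / N j + t)) 2 volume :=
    (hXm j).comp_measurePreserving (measurePreserving_add_left volume _)
  have i1 : Integrable fun t => X j t * F' (-(α / N j) + t) := (hXm j).integrable_mul hm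
  have i2 : Integrable fun t => X j t * F' t := (hXm j).integrable_mul hF'm
  have i3 : Integrable fun t => X j (α / N j + t) * F' t := hmX.integrable_mul hF'm
  simp only [mul_sub]
  rw [integral_sub i1 i2, ← integral_add_left_eq_self _ (α / N j)]
  simp only [neg_add_cancel_left]
  rw [← integral_sub i3 i2, ← integral_indicator measurableSet_Ioo]
  congr 1
  ext t
  by_cases ht : t ∈ Ioo 0 α
  · have h1 : t ∈ Ioo 0 (α + α / N j) := ⟨ht.1, by linarith [ht.2, hε0 j]⟩
    have h2 : α / N j + t ∈ Ioo 0 (α + α / N j) :=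
      ⟨by linarith [ht.1, hε0 j], by linarith [ht.2]⟩
    have h3 : ⌊(α / N j + t) / (α / N j)⌋₊ = ⌊t / (α / N j)⌋₊ + 1 := by
      rw [add_div, div_self (hε0 j).ne', add_comm,
        Nat.floor_add_one (div_nonneg ht.1.le (hε0 j).le)]
    simp only [hX, hF', indicator_of_mem ht, indicator_of_mem h1, indicator_of_mem h2, h3]
    ring
  · simp [hF', ht]

/-- Weak convergence to zero of oscillating phase factors. -/
theorem tendsto_integral_pow_step {α : ℝ} (hα : 0 < α) {N : ℕ → ℕ} (hN : ∀ j, 0 < N j)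
    (hε : Tendsto (fun j => α / N j) atTop (𝓝 0)) {c : ℂ} (hc : ‖c‖ = 1) (hc1 : c ≠ 1)
    {F : ℝ → ℂ} (hF : MemLp F 2 (volume.restrict (Ioo 0 α))) :
    Tendsto (fun j => ∫ t in Ioo 0 α, c ^ ⌊t / (α / N j)⌋₊ * F t) atTop (𝓝 0) := by
  have hK : ∀ j, α / N j * ∑ l ∈ Finset.range (N j + 1), ‖c ^ l‖ ^ 2 ≤ 2 * α := fun j => by
    have h1 : (1 : ℝ) ≤ N j := by exact_mod_cast hN j
    simp only [norm_pow, hc, one_pow, Finset.sum_const, Finset.card_range, nsmul_eq_mul, mul_one]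
    push_cast
    rw [div_mul_eq_mul_div, div_le_iff₀ (by linarith)]
    nlinarith
  have key := (tendsto_integral_step_increment hα hN hε (x := fun _ l => c ^ l) hK hF).const_mul
    (c - 1)⁻¹
  rw [mul_zero] at key
  refine key.congr fun j => ?_
  rw [← integral_const_mul]
  congr 1
  ext t
  have : c - 1 ≠ 0 := sub_ne_zero.2 hc1
  field_simp
  ring

/-- The constant in the estimate of the variation of the coordinates. -/
def varConst (M : Matrix (Fin 2) (Fin 2) ℂ) (ρ1 S : ℝ) : ℝ := (∑ q, ∑ p, ‖M⁻¹ q p‖) * (ρ1 * S)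

theorem varConst_nonneg (M : Matrix (Fin 2) (Fin 2) ℂ) {ρ1 S : ℝ} (h1 : 0 ≤ ρ1) (hS : 0 ≤ S) :
    0 ≤ varConst M ρ1 S := by
  unfold varConst; positivity

theorem coords_density_le {a ρ : ℝ → ℝ} {a0 a1 ρ1 : ℝ} (hco : PeriodicCoeff a ρ a0 a1 ρ1)
    {lam μ S : ℝ} {ψ : Fin 2 → ℝ → ℂ} {W : ℝ → ℂ} {I : Set ℝ} (hS : ∀ q, ∀ y ∈ I, ‖ψ q y‖ ≤ S)
    (M : Matrix (Fin 2) (Fin 2) ℂ) (q : Fin 2) :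
    ∀ᵐ y, y ∈ I → ‖∑ p, M⁻¹ q p * (-(((μ - lam) * ρ y : ℝ) : ℂ) * (W y * conj (ψ p y)))‖ ≤
      varConst M ρ1 S * |μ - lam| * ‖W y‖ := by
  filter_upwards [hco.ρ_le] with y hy hyI
  have hS0 : 0 ≤ S := (norm_nonneg _).trans (hS 0 y hyI)
  have hρ := hco.ρ1_nonneg
  calc _ ≤ ∑ p, ‖M⁻¹ q p‖ * (|μ - lam| * ρ1 * (‖W y‖ * S)) := by
        refine (norm_sum_le _ _).trans (Finset.sum_le_sum fun p _ => ?_)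
        rw [norm_mul, norm_mul, norm_neg, Complex.norm_real, Real.norm_eq_abs, abs_mul, norm_mul,
          RCLike.norm_conj]
        gcongr
        exact hS p y hyI
    _ = (∑ p, ‖M⁻¹ q p‖) * (ρ1 * S) * |μ - lam| * ‖W y‖ := by
        rw [← Finset.sum_mul]; ring
    _ ≤ _ := by
        unfold varConst
        have hq : ∑ p, ‖M⁻¹ q p‖ ≤ ∑ q, ∑ p, ‖M⁻¹ q p‖ := Finset.single_le_sum (f := fun q => ∑ p, ‖M⁻¹ q p‖)
          (fun q _ => Finset.sum_nonneg fun p _ => norm_nonneg _) (Finset.mem_univ q)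
        exact mul_le_mul_of_nonneg_right (mul_le_mul_of_nonneg_right
          (mul_le_mul_of_nonneg_right hq (by positivity)) (abs_nonneg _)) (norm_nonneg _)

theorem norm_coords_sub_le {a ρ : ℝ → ℝ} {a0 a1 ρ1 : ℝ} (hco : PeriodicCoeff a ρ a0 a1 ρ1)
    {lam μ A B S : ℝ} {ψ z : Fin 2 → ℝ → ℂ} {W Z : ℝ → ℂ}
    (h : ∀ q, IsSol a ρ lam A B (ψ q) (z q)) (hW : IsSol a ρ μ A B W Z)
    (hS : ∀ q, ∀ y ∈ Icc A B, ‖ψ q y‖ ≤ S) (q : Fin 2) {x y : ℝ} (hx : x ∈ Icc A B)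
    (hy : y ∈ Icc A B) (hxy : x ≤ y) :
    ‖coords ψ z W Z q y - coords ψ z W Z q x‖ ≤
      varConst (wron ψ z A) ρ1 S * |μ - lam| * ∫ t in x..y, ‖W t‖ := by
  have hp := isPrim_coords h hW (hx.1.trans hx.2) q
  rw [hp.sub_eq hx hy, ← intervalIntegral.integral_const_mul]
  refine intervalIntegral.norm_integral_le_of_norm_le hxy ?_ ?_
  · filter_upwards [coords_density_le hco (lam := lam) (μ := μ) (W := W) hS (wron ψ z A) q]
      with t ht htI
    exact ht ⟨hx.1.trans htI.1.le, htI.2.trans hy.2⟩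
  · refine ((hW.fst.continuousOn.norm.mono ?_).intervalIntegrable).const_mul _
    rw [uIcc_of_le hxy]
    exact Icc_subset_Icc hx.1 hy.2

theorem sq_integral_le {g : ℝ → ℝ} (hg : ContinuousOn g (Icc 0 1)) :
    (∫ t in (0 : ℝ)..1, g t) ^ 2 ≤ ∫ t in (0 : ℝ)..1, g t ^ 2 := by
  set m := ∫ t in (0 : ℝ)..1, g t with hm
  have i1 : IntervalIntegrable g volume 0 1 := hg.intervalIntegrable_of_Icc zero_le_one
  have i2 : IntervalIntegrable (fun t => g t ^ 2) volume 0 1 :=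
    (hg.pow 2).intervalIntegrable_of_Icc zero_le_one
  have h0 : 0 ≤ ∫ t in (0 : ℝ)..1, (g t - m) ^ 2 :=
    intervalIntegral.integral_nonneg zero_le_one fun t _ => sq_nonneg _
  have e : ∀ t, (g t - m) ^ 2 = g t ^ 2 - 2 * m * g t + m ^ 2 := fun t => by ring
  simp only [e] at h0
  rw [intervalIntegral.integral_add (i2.sub (i1.const_mul _)) (by simp),
    intervalIntegral.integral_sub i2 (i1.const_mul _), intervalIntegral.integral_const_mul, ← hm]
    at h0
  simp at h0
  nlinarith

theorem IsPrim.norm_sq_le {F f : ℝ → ℂ} (h : IsPrim 0 1 F f) {g : ℝ → ℝ}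
    (hg : ContinuousOn g (Icc 0 1)) (hfg : ∀ᵐ t, t ∈ Icc (0 : ℝ) 1 → ‖f t‖ ≤ g t) {y : ℝ}
    (hy : y ∈ Icc (0 : ℝ) 1) :
    ‖F y‖ ^ 2 ≤ 2 * (∫ t in (0 : ℝ)..1, ‖F t‖ ^ 2) + 2 * ∫ t in (0 : ℝ)..1, g t ^ 2 := by
  have i1 : IntervalIntegrable g volume 0 1 := hg.intervalIntegrable_of_Icc zero_le_one
  have hfi : IntervalIntegrable (fun t => ‖f t‖) volume 0 1 :=
    (h.intervalIntegrable (by simp) (by simp)).norm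
  have hfg' : ∫ t in (0 : ℝ)..1, ‖f t‖ ≤ ∫ t in (0 : ℝ)..1, g t := by
    refine intervalIntegral.integral_mono_ae_restrict zero_le_one hfi i1 ?_
    exact (ae_restrict_iff' measurableSet_Icc).2 hfg
  have h1 : ∀ t ∈ Icc (0 : ℝ) 1, ‖F y‖ ≤ ‖F t‖ + ∫ t in (0 : ℝ)..1, g t := fun t ht => by
    have e1 := h.norm_sub_le ht hy
    have e2 : |∫ s in t..y, ‖f s‖| ≤ ∫ s in (0 : ℝ)..1, ‖f s‖ := by
      rw [intervalIntegral.abs_intervalIntegral_eq, abs_of_nonneg (integral_nonneg fun _ =>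
        norm_nonneg _), intervalIntegral.integral_of_le zero_le_one]
      refine setIntegral_mono_set ?_ (ae_of_all _ fun _ => norm_nonneg _) ?_
      · exact (intervalIntegrable_iff_integrableOn_Ioc_of_le zero_le_one).1 hfi
      · refine LE.le.eventuallyLE ?_
        intro s hs
        rw [mem_uIoc] at hs
        rcases hs with hs | hs
        · exact ⟨ht.1.trans_lt hs.1, hs.2.trans hy.2⟩
        · exact ⟨hy.1.trans_lt hs.1, hs.2.trans ht.2⟩
    have e3 := norm_le_norm_add_norm_sub' (F y) (F t)
    linarith
  have h2 : ∀ t ∈ Icc (0 : ℝ) 1,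
      ‖F y‖ ^ 2 - 2 * (∫ t in (0 : ℝ)..1, g t ^ 2) ≤ 2 * ‖F t‖ ^ 2 := fun t ht => by
    have e1 := h1 t ht
    have e2 := sq_integral_le hg
    have e3 : ‖F y‖ ^ 2 ≤ (‖F t‖ + ∫ t in (0 : ℝ)..1, g t) ^ 2 := by gcongr
    nlinarith [sq_nonneg (‖F t‖ - ∫ t in (0 : ℝ)..1, g t)]
  have i3 : IntervalIntegrable (fun t => 2 * ‖F t‖ ^ 2) volume 0 1 :=
    (continuousOn_const.mul (h.continuousOn.norm.pow 2)).intervalIntegrable_of_Icc zero_le_one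
  have h3 := intervalIntegral.integral_mono_on zero_le_one intervalIntegrable_const i3 h2
  rw [intervalIntegral.integral_const, sub_zero, one_smul,
    intervalIntegral.integral_const_mul] at h3
  linarith

theorem IsSol.norm_sq_le {a ρ : ℝ → ℝ} {a0 a1 ρ1 : ℝ} (hco : PeriodicCoeff a ρ a0 a1 ρ1)
    {μ K : ℝ} (hμ : |μ| ≤ K) {f z : ℝ → ℂ} (h : IsSol a ρ μ 0 1 f z) {y : ℝ}
    (hy : y ∈ Icc (0 : ℝ) 1) :
    ‖f y‖ ^ 2 + ‖z y‖ ^ 2 ≤ (2 + 2 / a0 ^ 2 + 2 * (K * ρ1) ^ 2) *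
      ((∫ t in (0 : ℝ)..1, ‖f t‖ ^ 2) + ∫ t in (0 : ℝ)..1, ‖z t‖ ^ 2) := by
  have hfc := h.fst.continuousOn
  have hzc := h.snd.continuousOn
  have hρ := hco.ρ1_nonneg
  have ha := hco.a0_pos
  have h1 := h.fst.norm_sq_le (g := fun t => ‖z t‖ / a0) (hzc.norm.div_const _)
    (ae_of_all _ fun t _ => hco.norm_div_le _ t) hy
  have h2 := h.snd.norm_sq_le (g := fun t => K * ρ1 * ‖f t‖) (continuousOn_const.mul hfc.norm)
    (by
      filter_upwards [hco.ρ_le] with t ht _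
      rw [norm_mul, norm_neg, Complex.norm_real, Real.norm_eq_abs, abs_mul]
      have := (abs_nonneg μ).trans hμ
      gcongr) hy
  simp only [div_pow, mul_pow, intervalIntegral.integral_const_mul,
    intervalIntegral.integral_div] at h1 h2
  have n1 : 0 ≤ ∫ t in (0 : ℝ)..1, ‖f t‖ ^ 2 :=
    intervalIntegral.integral_nonneg zero_le_one fun t _ => by positivity
  have n2 : 0 ≤ ∫ t in (0 : ℝ)..1, ‖z t‖ ^ 2 :=
    intervalIntegral.integral_nonneg zero_le_one fun t _ => by positivity
  set I := ∫ t in (0 : ℝ)..1, ‖f t‖ ^ 2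
  set J := ∫ t in (0 : ℝ)..1, ‖z t‖ ^ 2
  have e : 2 * (J / a0 ^ 2) = 2 / a0 ^ 2 * J := by ring
  rw [e] at h1
  have n3 : 0 ≤ 2 / a0 ^ 2 * I := by positivity
  have n4 : 0 ≤ 2 * (K * ρ1) ^ 2 * J := by positivity
  nlinarith

theorem sum_norm_sq_nodes_le {a ρ : ℝ → ℝ} {a0 a1 ρ1 α μ K : ℝ} {N : ℕ} {W Z : ℝ → ℂ}
    (h : IsCellSol a ρ α N μ W Z) (hα : 0 < α) (hco : PeriodicCoeff a ρ a0 a1 ρ1)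
    (hμ : |μ| ≤ K) :
    α / N * ∑ l ∈ Finset.range (N + 1), (‖W l‖ ^ 2 + ‖Z l‖ ^ 2) ≤
      2 * ((2 + 2 / a0 ^ 2 + 2 * (K * ρ1) ^ 2) * (1 + a1 * K * ρ1)) := by
  have hN : (0 : ℝ) < N := by exact_mod_cast h.N_pos
  have ha := hco.a0_pos
  have ha1 := hco.a1_pos
  have hρ := hco.ρ1_nonneg
  have hK := (abs_nonneg μ).trans hμ
  set C := 2 + 2 / a0 ^ 2 + 2 * (K * ρ1) ^ 2 with hC
  have hC0 : 0 ≤ C := by positivity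
  set I : ℕ → ℝ := fun l => C * ((∫ t in (0 : ℝ)..1, ‖W (l + t)‖ ^ 2) +
    ∫ t in (0 : ℝ)..1, ‖Z (l + t)‖ ^ 2) with hI
  have hI0 : ∀ l, 0 ≤ I l := fun l => mul_nonneg hC0 (add_nonneg
    (intervalIntegral.integral_nonneg zero_le_one fun t _ => by positivity)
    (intervalIntegral.integral_nonneg zero_le_one fun t _ => by positivity))
  have b1 : ∀ l < N, ‖W l‖ ^ 2 + ‖Z l‖ ^ 2 ≤ I l := fun l hl => by
    simpa using (h.sol.cell hco hl).norm_sq_le hco hμ (y := 0) (by simp)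
  have hsum : ∑ l ∈ Finset.range N, I l = C * ((∫ t in (0 : ℝ)..N, ‖W t‖ ^ 2) +
      ∫ t in (0 : ℝ)..N, ‖Z t‖ ^ 2) := by
    rw [hI, ← Finset.mul_sum, Finset.sum_add_distrib,
      sum_integral_cells (f := fun t => ‖W t‖ ^ 2) (h.sol.fst.continuousOn.norm.pow 2),
      sum_integral_cells (f := fun t => ‖Z t‖ ^ 2) (h.sol.snd.continuousOn.norm.pow 2)]
  have b2 : ‖W N‖ ^ 2 + ‖Z N‖ ^ 2 ≤ ∑ l ∈ Finset.range N, I l := by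
    have hl : N - 1 < N := Nat.sub_lt h.N_pos one_pos
    have e : ((N - 1 : ℕ) : ℝ) + 1 = N := by
      exact_mod_cast Nat.sub_add_cancel h.N_pos
    have := (h.sol.cell hco hl).norm_sq_le hco hμ (y := 1) (by simp)
    rw [e] at this
    exact this.trans (Finset.single_le_sum (f := I) (fun l _ => hI0 l) (Finset.mem_range.2 hl))
  have henergy := h.energy hα hco
  have hn := h.norm_eq
  calc α / N * ∑ l ∈ Finset.range (N + 1), (‖W l‖ ^ 2 + ‖Z l‖ ^ 2)
      ≤ α / N * (∑ l ∈ Finset.range N, I l + ∑ l ∈ Finset.range N, I l) := by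
        rw [Finset.sum_range_succ]
        gcongr with l hl
        exact b1 l (Finset.mem_range.1 hl)
    _ = 2 * (C * (α / N * (∫ t in (0 : ℝ)..N, ‖W t‖ ^ 2) +
          α / N * ∫ t in (0 : ℝ)..N, ‖Z t‖ ^ 2)) := by rw [hsum]; ring
    _ ≤ 2 * (C * (1 + a1 * |μ| * ρ1)) := by rw [hn]; gcongr
    _ ≤ _ := by gcongr

theorem memLp_integral_slice {α : ℝ} {H : ℝ × ℝ → ℂ}
    (hH : MemLp H 2 (volume.restrict (cellDomain α))) :
    MemLp (fun x => ∫ y in Ioo (0 : ℝ) 1, H (x, y)) 2 (volume.restrict (Ioo 0 α)) := by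
  rw [restrict_cellDomain] at hH
  have hm := hH.1.integral_prod_right'
  rw [memLp_two_iff_integrable_sq_norm hm]
  have hi := (memLp_two_iff_integrable_sq_norm hH.1).1 hH
  refine hi.integral_prod_left.mono' (hm.norm.pow 2) ?_
  filter_upwards [hH.1.prodMk_left, hi.prod_right_ae] with x h1 h2
  have hx : MemLp (fun y => H (x, y)) 2 (volume.restrict (Ioo (0 : ℝ) 1)) :=
    (memLp_two_iff_integrable_sq_norm h1).2 h2
  have h3 := norm_integral_mul_le_sqrt hx (memLp_const (1 : ℂ))
  simp only [mul_one, norm_one, one_pow, integral_const, measureReal_restrict_apply_univ,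
    Real.volume_real_Ioo_of_le zero_le_one, sub_zero, smul_eq_mul, Real.sqrt_one] at h3
  have h4 : 0 ≤ ∫ y in Ioo (0 : ℝ) 1, ‖H (x, y)‖ ^ 2 := integral_nonneg fun y => by positivity
  rw [Real.norm_of_nonneg (by positivity)]
  calc _ ≤ (√(∫ y in Ioo (0 : ℝ) 1, ‖H (x, y)‖ ^ 2)) ^ 2 := by gcongr
    _ = _ := Real.sq_sqrt h4

/-- A sequence of normalized solutions of the rescaled Dirichlet problems on `(0, N j)`, with
spectral parameters `μ j = lam0 + (α / N j) lam1 + o(α / N j)`. -/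
structure IsCellSeq (a ρ : ℝ → ℝ) (α lam0 lam1 : ℝ) (N : ℕ → ℕ) (μ : ℕ → ℝ) (W Z : ℕ → ℝ → ℂ) :
    Prop where
  sol : ∀ j, IsCellSol a ρ α (N j) (μ j) (W j) (Z j)
  eps : Tendsto (fun j => α / N j) atTop (𝓝 0)
  rate : Tendsto (fun j => (μ j - lam0) / (α / N j)) atTop (𝓝 lam1)

namespace IsCellSeq

variable {a ρ : ℝ → ℝ} {α lam0 lam1 : ℝ} {N : ℕ → ℕ} {μ : ℕ → ℝ} {W Z : ℕ → ℝ → ℂ}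

theorem eps_pos (h : IsCellSeq a ρ α lam0 lam1 N μ W Z) (hα : 0 < α) (j : ℕ) : 0 < α / N j :=
  div_pos hα (by exact_mod_cast (h.sol j).N_pos)

theorem eps_mul (h : IsCellSeq a ρ α lam0 lam1 N μ W Z) (j : ℕ) : α / N j * N j = α :=
  div_mul_cancel₀ _ (by exact_mod_cast (h.sol j).N_pos.ne')

theorem comp (h : IsCellSeq a ρ α lam0 lam1 N μ W Z) {s : ℕ → ℕ} (hs : StrictMono s) :
    IsCellSeq a ρ α lam0 lam1 (N ∘ s) (μ ∘ s) (W ∘ s) (Z ∘ s) :=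
  ⟨fun j => h.sol (s j), h.eps.comp hs.tendsto_atTop, h.rate.comp hs.tendsto_atTop⟩

theorem exists_rate_bound (h : IsCellSeq a ρ α lam0 lam1 N μ W Z) (hα : 0 < α) :
    ∃ K, 0 ≤ K ∧ ∀ j, |μ j - lam0| ≤ K * (α / N j) := by
  obtain ⟨K, hK⟩ := h.rate.norm.bddAbove_range
  refine ⟨K, ?_, fun j => ?_⟩
  · exact (norm_nonneg _).trans (hK ⟨0, rfl⟩)
  · have this : ‖(μ j - lam0) / (α / N j)‖ ≤ K := hK ⟨j, rfl⟩
    rw [Real.norm_eq_abs, abs_div, abs_of_pos (h.eps_pos hα j)] at this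
    exact (div_le_iff₀ (h.eps_pos hα j)).1 this

theorem tendsto_sub (h : IsCellSeq a ρ α lam0 lam1 N μ W Z) (hα : 0 < α) :
    Tendsto (fun j => μ j - lam0) atTop (𝓝 0) := by
  have := h.rate.mul h.eps
  rw [mul_zero] at this
  exact this.congr fun j => div_mul_cancel₀ _ (h.eps_pos hα j).ne'

theorem exists_bound (h : IsCellSeq a ρ α lam0 lam1 N μ W Z) (hα : 0 < α) :
    ∃ K, 0 ≤ K ∧ ∀ j, |μ j| ≤ K := by
  have h1 : Tendsto μ atTop (𝓝 (0 + lam0)) :=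
    ((h.tendsto_sub hα).add_const lam0).congr fun j => by ring
  obtain ⟨K, hK⟩ := h1.norm.bddAbove_range
  exact ⟨K, (norm_nonneg _).trans (hK ⟨0, rfl⟩), fun j => hK ⟨j, rfl⟩⟩

end IsCellSeq

theorem memLp_stepFun {α ε : ℝ} {N : ℕ} (hε : 0 < ε) (hεN : ε * N = α) {H : ℕ → ℝ → ℂ}
    (h : ∀ l < N, ContinuousOn (H l) (Icc (0 : ℝ) 1)) :
    MemLp (stepFun ε H) 2 (volume.restrict (cellDomain α)) := by
  refine MemLp.ae_eq (stepFun_ae_eq hε hεN H) ?_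
  rw [restrict_cellDomain]
  refine memLp_finsetSum _ fun l hl => ?_
  have hc := h l (Finset.mem_range.1 hl)
  obtain ⟨K, hK⟩ := isCompact_Icc.exists_bound_of_continuousOn hc
  refine IsL2H1.memLp_two_mul_prod ((memLp_const (1 : ℂ)).indicator measurableSet_Ico)
    (MemLp.of_bound ((hc.mono Ioo_subset_Icc_self).aestronglyMeasurable measurableSet_Ioo) K ?_)
  exact (ae_restrict_iff' measurableSet_Ioo).2
    (ae_of_all _ fun y hy => hK y (Ioo_subset_Icc_self hy))

theorem integral_stepFun_mul {α ε : ℝ} {N : ℕ} (hε : 0 < ε) (hεN : ε * N = α) (x : ℕ → ℂ)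
    {H : ℝ × ℝ → ℂ} (hH : MemLp H 2 (volume.restrict (cellDomain α))) :
    ∫ p in cellDomain α, stepFun ε (fun l _ => x l) p * H p =
      ∫ t in Ioo 0 α, x ⌊t / ε⌋₊ * ∫ y in Ioo (0 : ℝ) 1, H (t, y) := by
  have hi : Integrable (fun p => stepFun ε (fun l _ => x l) p * H p)
      (volume.restrict (cellDomain α)) :=
    (memLp_stepFun hε hεN fun _ _ => continuousOn_const).integrable_mul hH
  rw [restrict_cellDomain] at hi ⊢
  rw [integral_prod _ hi]
  simp only [stepFun, integral_const_mul]

theorem tendsto_integral_small_step {α : ℝ} (hα : 0 < α) {N : ℕ → ℕ} (hN : ∀ j, 0 < N j)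
    {x : ℕ → ℕ → ℂ} {δ : ℕ → ℝ} (hδ : Tendsto δ atTop (𝓝 0))
    (hx : ∀ j, α / N j * ∑ l ∈ Finset.range (N j), ‖x j l‖ ^ 2 ≤ δ j)
    {F : ℝ → ℂ} (hF : MemLp F 2 (volume.restrict (Ioo 0 α))) :
    Tendsto (fun j => ∫ t in Ioo 0 α, x j ⌊t / (α / N j)⌋₊ * F t) atTop (𝓝 0) := by
  have hN' : ∀ j, (0 : ℝ) < N j := fun j => by exact_mod_cast hN j
  have hε0 : ∀ j, 0 < α / N j := fun j => div_pos hα (hN' j)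
  have hεN : ∀ j, α / N j * N j = α := fun j => div_mul_cancel₀ _ (hN' j).ne'
  have h1 := hδ.sqrt.mul_const √(∫ t in Ioo 0 α, ‖F t‖ ^ 2)
  rw [Real.sqrt_zero, zero_mul] at h1
  refine squeeze_zero_norm (fun j => ?_) h1
  refine (norm_integral_mul_le_sqrt (memLp_step (hε0 j) (hεN j) (x j)) hF).trans ?_
  gcongr
  rw [integral_step (hε0 j) (hεN j) fun l => ‖x j l‖ ^ 2]
  exact hx j

theorem tendsto_integral_small_stepFun {α : ℝ} (hα : 0 < α) {N : ℕ → ℕ} (hN : ∀ j, 0 < N j)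
    {E : ℕ → ℕ → ℝ → ℂ} (hE : ∀ j, ∀ l < N j, ContinuousOn (E j l) (Icc (0 : ℝ) 1))
    {e : ℕ → ℕ → ℝ} (hEe : ∀ j, ∀ l < N j, ∀ y ∈ Icc (0 : ℝ) 1, ‖E j l y‖ ≤ e j l)
    {δ : ℕ → ℝ} (hδ : Tendsto δ atTop (𝓝 0))
    (he : ∀ j, α / N j * ∑ l ∈ Finset.range (N j), e j l ^ 2 ≤ δ j)
    {H : ℝ × ℝ → ℂ} (hH : MemLp H 2 (volume.restrict (cellDomain α))) :
    Tendsto (fun j => ∫ p in cellDomain α, stepFun (α / N j) (E j) p * H p) atTop (𝓝 0) := by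
  have hN' : ∀ j, (0 : ℝ) < N j := fun j => by exact_mod_cast hN j
  have hε0 : ∀ j, 0 < α / N j := fun j => div_pos hα (hN' j)
  have hεN : ∀ j, α / N j * N j = α := fun j => div_mul_cancel₀ _ (hN' j).ne'
  have h1 := hδ.sqrt.mul_const √(∫ p in cellDomain α, ‖H p‖ ^ 2)
  rw [Real.sqrt_zero, zero_mul] at h1
  refine squeeze_zero_norm (fun j => ?_) h1
  have hm := memLp_stepFun (hε0 j) (hεN j) (hE j)
  refine (norm_integral_mul_le_sqrt hm hH).trans ?_
  gcongr
  rw [integral_norm_sq_stepFun (hε0 j) (hεN j) hm]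
  refine le_trans ?_ (he j)
  have := hε0 j
  gcongr with l hl
  have hl' := Finset.mem_range.1 hl
  have h2 : ∫ y in (0 : ℝ)..1, ‖E j l y‖ ^ 2 ≤ ∫ _ in (0 : ℝ)..1, e j l ^ 2 :=
    intervalIntegral.integral_mono_on zero_le_one
      (((hE j l hl').norm.pow 2).intervalIntegrable_of_Icc zero_le_one)
      intervalIntegrable_const (fun y hy => by
        have := hEe j l hl' y hy
        gcongr)
  simpa using h2

theorem memLp_continuousOn_snd_mul {α : ℝ} {h : ℝ → ℂ} (hh : ContinuousOn h (Icc (0 : ℝ) 1))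
    {A : ℝ × ℝ → ℂ} (hA : MemLp A 2 (volume.restrict (cellDomain α))) :
    MemLp (fun p => h p.2 * A p) 2 (volume.restrict (cellDomain α)) := by
  obtain ⟨K, hK⟩ := isCompact_Icc.exists_bound_of_continuousOn hh
  have hm : AEStronglyMeasurable (fun p : ℝ × ℝ => h p.2) (volume.restrict (cellDomain α)) := by
    rw [restrict_cellDomain]
    exact ((hh.mono Ioo_subset_Icc_self).aestronglyMeasurable measurableSet_Ioo).comp_snd
  refine hA.of_le_mul (c := K) (hm.mul hA.1) ?_
  filter_upwards [ae_restrict_mem (measurableSet_cellDomain α)] with p hp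
  rw [norm_mul]
  gcongr
  exact hK _ (Ioo_subset_Icc_self hp.2)

theorem continuousOn_coords {a ρ : ℝ → ℝ} {lam μ A B : ℝ} {ψ z : Fin 2 → ℝ → ℂ} {W Z : ℝ → ℂ}
    (h : ∀ q, IsSol a ρ lam A B (ψ q) (z q)) (hW : IsSol a ρ μ A B W Z) (hAB : A ≤ B) (q : Fin 2) :
    ContinuousOn (coords ψ z W Z q) (Icc A B) := (isPrim_coords h hW hAB q).continuousOn

theorem sum_sq_integral_cell_le {a ρ : ℝ → ℝ} {α μ : ℝ} {N : ℕ} {W Z : ℝ → ℂ}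
    (h : IsCellSol a ρ α N μ W Z) (hα : 0 < α) (C : ℝ) :
    α / N * ∑ l ∈ Finset.range N, (C * ∫ t in (0 : ℝ)..1, ‖W (l + t)‖) ^ 2 ≤ C ^ 2 := by
  have hN : (0 : ℝ) < N := by exact_mod_cast h.N_pos
  have hWc := h.sol.fst.continuousOn
  calc α / N * ∑ l ∈ Finset.range N, (C * ∫ t in (0 : ℝ)..1, ‖W (l + t)‖) ^ 2
      ≤ α / N * ∑ l ∈ Finset.range N, C ^ 2 * ∫ t in (0 : ℝ)..1, ‖W (l + t)‖ ^ 2 := by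
        gcongr with l hl
        have hl' : (l + 1 : ℝ) ≤ N := by exact_mod_cast Finset.mem_range.1 hl
        rw [mul_pow]
        gcongr
        exact sq_integral_le (hWc.comp (by fun_prop) fun y hy =>
          ⟨by have := hy.1; positivity, by linarith [hy.2]⟩).norm
    _ = C ^ 2 * (α / N * ∫ t in (0 : ℝ)..N, ‖W t‖ ^ 2) := by
        rw [← Finset.mul_sum, sum_integral_cells (f := fun y => ‖W y‖ ^ 2) (hWc.norm.pow 2)]
        ring
    _ = C ^ 2 := by rw [h.norm_eq, mul_one]

/-- If `exp (2 i π k)` is not an eigenvalue of the monodromy matrix at `lam0`, then the transforms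
`S_k w` converge weakly to zero. -/
theorem tendsto_integral_unfold_zero {a ρ : ℝ → ℝ} {a0 a1 ρ1 α lam0 lam1 : ℝ} (hα : 0 < α)
    (hco : PeriodicCoeff a ρ a0 a1 ρ1) {N : ℕ → ℕ} {μ : ℕ → ℝ} {W Z : ℕ → ℝ → ℂ}
    (hs : IsCellSeq a ρ α lam0 lam1 N μ W Z) {ψ z : Fin 2 → ℝ → ℂ}
    (hψ : ∀ q, IsSol a ρ lam0 0 1 (ψ q) (z q)) (hfund : fundMat ψ z 0 = 1) (k : ℝ)
    (hdet : (phase (-k) 1 • fundMat ψ z 1 - 1).det ≠ 0) {A B : ℝ × ℝ → ℂ}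
    (hA : MemLp A 2 (volume.restrict (cellDomain α)))
    (hB : MemLp B 2 (volume.restrict (cellDomain α))) :
    Tendsto (fun j => ∫ p in cellDomain α,
      (stepFun (α / N j) (fun l y => phase (-k) l * W j (l + y)) p * A p +
        stepFun (α / N j) (fun l y => phase (-k) l * (Z j (l + y) / a y)) p * B p))
      atTop (𝓝 0) := by
  have hε0 := hs.eps_pos hα
  have hεN := hs.eps_mul
  have hN : ∀ j, 0 < N j := fun j => (hs.sol j).N_pos
  obtain ⟨K, hK0, hK⟩ := hs.exists_bound hα
  have hδ := hs.tendsto_sub hα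
  -- bounds for the fundamental system
  have hdetw : ∀ y ∈ Icc (0 : ℝ) 1, (wron ψ z y).det ≠ 0 := fun y hy => by
    rw [wron_eq_of_isSol hψ hy (y := 0) (by simp), det_wron, hfund]
    simp
  obtain ⟨S, hS⟩ : ∃ S, ∀ q, ∀ y ∈ Icc (0 : ℝ) 1, ‖ψ q y‖ ≤ S := by
    choose S hS using fun q => isCompact_Icc.exists_bound_of_continuousOn (hψ q).fst.continuousOn
    exact ⟨max (S 0) (S 1), Fin.forall_fin_two.2 ⟨fun y hy => (hS 0 y hy).trans (le_max_left _ _),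
      fun y hy => (hS 1 y hy).trans (le_max_right _ _)⟩⟩
  have hS0 : 0 ≤ S := (norm_nonneg _).trans (hS 0 0 (by simp))
  set C := varConst (wron ψ z 0) ρ1 S
  have hC : 0 ≤ C := varConst_nonneg _ hco.ρ1_nonneg hS0
  -- the coordinates on each cell
  set u : ℕ → ℕ → Fin 2 → ℝ → ℂ := fun j l =>
    coords ψ z (fun y => W j (l + y)) (fun y => Z j (l + y)) with hu
  set e : ℕ → ℕ → ℝ := fun j l => C * |μ j - lam0| * ∫ t in (0 : ℝ)..1, ‖W j (l + t)‖ with he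
  have he0 : ∀ j l, 0 ≤ e j l := fun j l => mul_nonneg (by positivity)
    (intervalIntegral.integral_nonneg zero_le_one fun _ _ => norm_nonneg _)
  have hcell : ∀ j, ∀ l < N j, IsSol a ρ (μ j) 0 1 (fun y => W j (l + y)) (fun y => Z j (l + y)) :=
    fun j l hl => (hs.sol j).sol.cell hco hl
  have hue : ∀ j, ∀ l < N j, ∀ q, ∀ y ∈ Icc (0 : ℝ) 1, ‖u j l q y - u j l q 0‖ ≤ e j l := by
    intro j l hl q y hy
    refine (norm_coords_sub_le hco hψ (hcell j l hl) hS q (x := 0) (by simp) hy hy.1).trans ?_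
    refine mul_le_mul_of_nonneg_left ?_ (by positivity)
    refine intervalIntegral.integral_mono_interval le_rfl hy.1 hy.2
      (ae_of_all _ fun _ => norm_nonneg _) ?_
    exact ((hcell j l hl).fst.continuousOn.norm).intervalIntegrable_of_Icc zero_le_one
  have hsum : ∀ j, α / N j * ∑ l ∈ Finset.range (N j), e j l ^ 2 ≤ (C * |μ j - lam0|) ^ 2 :=
    fun j => sum_sq_integral_cell_le (hs.sol j) hα _
  have hδ2 : Tendsto (fun j => (C * |μ j - lam0|) ^ 2) atTop (𝓝 0) := by
    have := (hδ.abs.const_mul C).pow 2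
    simpa using this
  have hcont : ∀ j, ∀ l < N j, ∀ q, ContinuousOn (u j l q) (Icc 0 1) := fun j l hl q =>
    continuousOn_coords hψ (hcell j l hl) zero_le_one q
  set x : ℕ → ℕ → Fin 2 → ℂ := fun j l q => phase (-k) l * u j l q 0 with hx
  have hu0 : ∀ j l : ℕ, W j l = u j l 0 0 ∧ Z j l = u j l 1 0 := fun j l => by
    have h1 := coords_spec (hdetw 0 (by simp)) (fun y => W j (l + y)) (fun y => Z j (l + y))
    have f00 := congrFun (congrFun hfund 0) 0
    have f01 := congrFun (congrFun hfund 0) 1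
    have f10 := congrFun (congrFun hfund 1) 0
    have f11 := congrFun (congrFun hfund 1) 1
    simp [fundMat] at f00 f01 f10 f11
    simpa [Fin.sum_univ_two, f00, f01, f10, f11] using h1
  -- the reduced test functions
  set H : Fin 2 → ℝ × ℝ → ℂ := fun q p => ψ q p.2 * A p + z q p.2 / a p.2 * B p with hH
  have hdivc : ∀ q, ContinuousOn (fun y => z q y / a y) (Icc 0 1) := fun q =>
    (hψ q).snd.continuousOn.div (Complex.continuous_ofReal.comp hco.continuous_a).continuousOn
      fun y _ => Complex.ofReal_ne_zero.2 (hco.a_pos y).ne'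
  have hHm : ∀ q, MemLp (H q) 2 (volume.restrict (cellDomain α)) := fun q =>
    (memLp_continuousOn_snd_mul (hψ q).fst.continuousOn hA).add
      (memLp_continuousOn_snd_mul (hdivc q) hB)
  set F : Fin 2 → ℝ → ℂ := fun q t => ∫ y in Ioo (0 : ℝ) 1, H q (t, y) with hF
  have hFm : ∀ q, MemLp (F q) 2 (volume.restrict (Ioo 0 α)) := fun q => memLp_integral_slice (hHm q)
  -- the recursion for the nodal values
  set T := phase (-k) 1 • fundMat ψ z 1 with hT
  set r : ℕ → ℕ → Fin 2 → ℂ := fun j l i => x j (l + 1) i - ∑ q, T i q * x j l q with hr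
  have hrec : ∀ j l q, x j l q =
      ∑ i, (T - 1)⁻¹ q i * (x j (l + 1) i - x j l i - r j l i) := fun j l q => by
    have h1 : ∀ i, x j (l + 1) i - x j l i - r j l i = ((T - 1).mulVec (x j l)) i := fun i => by
      rw [Matrix.sub_mulVec, Matrix.one_mulVec]
      simp only [hr, Pi.sub_apply, Matrix.mulVec, dotProduct]
      ring
    simp only [h1]
    have h2 : (T - 1)⁻¹.mulVec ((T - 1).mulVec (x j l)) = x j l := by
      rw [Matrix.mulVec_mulVec, Matrix.nonsing_inv_mul _ (isUnit_iff_ne_zero.2 hdet),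
        Matrix.one_mulVec]
    exact (congrFun h2 q).symm
  obtain ⟨S', hS'0, hS'⟩ : ∃ S', 0 ≤ S' ∧ ∀ i q, ‖fundMat ψ z 1 i q‖ ≤ S' := by
    refine ⟨∑ i, ∑ q, ‖fundMat ψ z 1 i q‖, by positivity, fun i q => ?_⟩
    exact (Finset.single_le_sum (f := fun q => ‖fundMat ψ z 1 i q‖) (fun _ _ => norm_nonneg _)
      (Finset.mem_univ q)).trans (Finset.single_le_sum
      (f := fun i => ∑ q, ‖fundMat ψ z 1 i q‖) (fun _ _ => by positivity) (Finset.mem_univ i))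
  have hrle : ∀ j, ∀ l < N j, ∀ i, ‖r j l i‖ ≤ 2 * S' * e j l := by
    intro j l hl i
    have h1 := coords_spec (hdetw 1 (by simp)) (fun y => W j (l + y)) (fun y => Z j (l + y))
    have h2 : u j (l + 1) i 0 = ∑ q, fundMat ψ z 1 i q * u j l q 1 := by
      have h3 := hu0 j (l + 1)
      push_cast at h3
      fin_cases i
      · refine h3.1.symm.trans (h1.1.trans ?_)
        simp [Fin.sum_univ_two, fundMat, hu]; ring
      · refine h3.2.symm.trans (h1.2.trans ?_)
        simp [Fin.sum_univ_two, fundMat, hu]; ring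
    have h4 : r j l i = ∑ q, phase (-k) 1 * phase (-k) l *
        (fundMat ψ z 1 i q * (u j l q 1 - u j l q 0)) := by
      simp only [hr, hx, h2, hT, Matrix.smul_apply, smul_eq_mul, Finset.mul_sum,
        ← Finset.sum_sub_distrib]
      refine Finset.sum_congr rfl fun q _ => ?_
      push_cast
      rw [phase_add]
      ring
    rw [h4]
    calc _ ≤ ∑ q : Fin 2, S' * e j l := by
          refine (norm_sum_le _ _).trans (Finset.sum_le_sum fun q _ => ?_)
          rw [norm_mul, norm_mul, norm_phase, norm_phase, one_mul, one_mul, norm_mul]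
          have := hue j l hl q 1 (by simp)
          gcongr
          exact hS' i q
      _ = _ := by simp; ring
  -- convergence of the leading part
  have hlead : ∀ q, Tendsto (fun j => ∫ t in Ioo 0 α, x j ⌊t / (α / N j)⌋₊ q * F q t)
      atTop (𝓝 0) := by
    intro q
    have t1 : ∀ i, Tendsto (fun j => ∫ t in Ioo 0 α, (x j (⌊t / (α / N j)⌋₊ + 1) i -
        x j ⌊t / (α / N j)⌋₊ i) * F q t) atTop (𝓝 0) := fun i => by
      refine tendsto_integral_step_increment hα hN hs.eps (x := fun j l => x j l i)
        (K := 2 * ((2 + 2 / a0 ^ 2 + 2 * (K * ρ1) ^ 2) * (1 + a1 * K * ρ1))) (fun j => ?_) (hFm q)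
      refine le_trans ?_ (sum_norm_sq_nodes_le (hs.sol j) hα hco (hK j))
      have := hε0 j
      gcongr with l hl
      simp only [hx, norm_mul, norm_phase, one_mul]
      rw [(hu0 j l).1, (hu0 j l).2]
      fin_cases i
      · exact le_add_of_nonneg_right (by positivity)
      · exact le_add_of_nonneg_left (by positivity)
    have t2 : ∀ i, Tendsto (fun j => ∫ t in Ioo 0 α, r j ⌊t / (α / N j)⌋₊ i * F q t)
        atTop (𝓝 0) := fun i => by
      refine tendsto_integral_small_step hα hN (x := fun j l => r j l i)
        (δ := fun j => (2 * S') ^ 2 * (C * |μ j - lam0|) ^ 2) ?_ (fun j => ?_) (hFm q)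
      · simpa using hδ2.const_mul ((2 * S') ^ 2)
      · have h3 : α / N j * ∑ l ∈ Finset.range (N j), ‖r j l i‖ ^ 2 ≤
            α / N j * ∑ l ∈ Finset.range (N j), (2 * S') ^ 2 * e j l ^ 2 := by
          have := hε0 j
          gcongr with l hl
          rw [← mul_pow]
          have := hrle j l (Finset.mem_range.1 hl) i
          gcongr
        refine h3.trans ?_
        rw [← Finset.mul_sum, mul_left_comm]
        exact mul_le_mul_of_nonneg_left (hsum j) (by positivity)
    have t3 := tendsto_finsetSum Finset.univ fun i _ => ((t1 i).sub (t2 i)).const_mul ((T - 1)⁻¹ q i)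
    simp only [sub_zero, mul_zero, Finset.sum_const_zero] at t3
    refine t3.congr fun j => ?_
    have hint : ∀ Φ : ℕ → ℂ, IntegrableOn (fun t => Φ ⌊t / (α / N j)⌋₊ * F q t) (Ioo 0 α) :=
      fun Φ => (memLp_step (hε0 j) (hεN j) Φ).integrable_mul (hFm q)
    have h5 : ∀ i, (T - 1)⁻¹ q i * ((∫ t in Ioo 0 α, (x j (⌊t / (α / N j)⌋₊ + 1) i -
        x j ⌊t / (α / N j)⌋₊ i) * F q t) - ∫ t in Ioo 0 α, r j ⌊t / (α / N j)⌋₊ i * F q t) =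
        ∫ t in Ioo 0 α, (T - 1)⁻¹ q i * (x j (⌊t / (α / N j)⌋₊ + 1) i - x j ⌊t / (α / N j)⌋₊ i -
          r j ⌊t / (α / N j)⌋₊ i) * F q t := fun i => by
      rw [← integral_sub (hint fun l => x j (l + 1) i - x j l i) (hint fun l => r j l i),
        ← integral_const_mul]
      congr 1; ext t; ring
    rw [Finset.sum_congr rfl fun i _ => h5 i, ← integral_finsetSum _ fun i _ =>
      hint fun l => (T - 1)⁻¹ q i * (x j (l + 1) i - x j l i - r j l i)]
    congr 1
    ext t
    rw [← Finset.sum_mul, ← hrec]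
  -- convergence of the remainder
  have hrem : ∀ q, Tendsto (fun j => ∫ p in cellDomain α, stepFun (α / N j)
      (fun l y => phase (-k) l * (u j l q y - u j l q 0)) p * H q p) atTop (𝓝 0) := fun q =>
    tendsto_integral_small_stepFun hα hN
      (E := fun j l y => phase (-k) l * (u j l q y - u j l q 0)) (e := e)
      (fun j l hl => continuousOn_const.mul ((hcont j l hl q).sub continuousOn_const))
      (fun j l hl y hy => by
        rw [norm_mul, norm_phase, one_mul]; exact hue j l hl q y hy) hδ2 hsum (hHm q)
  have htot := tendsto_finsetSum Finset.univ fun q _ => (hlead q).add (hrem q)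
  simp only [add_zero, Finset.sum_const_zero] at htot
  refine htot.congr fun j => ?_
  have m1 : ∀ q, MemLp (stepFun (α / N j) fun l _ => x j l q) 2 (volume.restrict (cellDomain α)) :=
    fun q => memLp_stepFun (hε0 j) (hεN j) fun _ _ => continuousOn_const
  have m2 : ∀ q, MemLp (stepFun (α / N j) fun l y => phase (-k) l * (u j l q y - u j l q 0)) 2
      (volume.restrict (cellDomain α)) := fun q => memLp_stepFun (hε0 j) (hεN j)
      fun l hl => continuousOn_const.mul ((hcont j l hl q).sub continuousOn_const)
  have i1 : ∀ q, Integrable (fun p => stepFun (α / N j) (fun l _ => x j l q) p * H q p)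
      (volume.restrict (cellDomain α)) := fun q => (m1 q).integrable_mul (hHm q)
  have i2 : ∀ q, Integrable (fun p => stepFun (α / N j)
      (fun l y => phase (-k) l * (u j l q y - u j l q 0)) p * H q p)
      (volume.restrict (cellDomain α)) := fun q => (m2 q).integrable_mul (hHm q)
  have h6 : ∀ q, (∫ t in Ioo 0 α, x j ⌊t / (α / N j)⌋₊ q * F q t) +
      ∫ p in cellDomain α, stepFun (α / N j)
        (fun l y => phase (-k) l * (u j l q y - u j l q 0)) p * H q p =
      ∫ p in cellDomain α, (stepFun (α / N j) (fun l _ => x j l q) p * H q p +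
        stepFun (α / N j) (fun l y => phase (-k) l * (u j l q y - u j l q 0)) p * H q p) :=
    fun q => by
      rw [integral_add (i1 q) (i2 q), integral_stepFun_mul (hε0 j) (hεN j) (fun l => x j l q) (hHm q)]
  have i3 : ∀ q, Integrable (fun p => stepFun (α / N j) (fun l _ => x j l q) p * H q p +
      stepFun (α / N j) (fun l y => phase (-k) l * (u j l q y - u j l q 0)) p * H q p)
      (volume.restrict (cellDomain α)) := fun q => (i1 q).add (i2 q)
  rw [Finset.sum_congr rfl fun q _ => h6 q, ← integral_finsetSum _ fun q _ => i3 q]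
  refine setIntegral_congr_fun (measurableSet_cellDomain α) fun p hp => ?_
  have h7 := coords_spec (hdetw p.2 (Ioo_subset_Icc_self hp.2))
    (fun y => W j (⌊p.1 / (α / N j)⌋₊ + y)) (fun y => Z j (⌊p.1 / (α / N j)⌋₊ + y))
  simp only [stepFun, h7.1, h7.2, hx, hH, hu, Fin.sum_univ_two]
  ring

/-- Weak limits in `L²(Ω; H¹(Y))` are determined by any other description of the limits of the
duality products. -/
theorem WeakTendstoL2H1.ae_eq {α : ℝ} {G G' D' : ℕ → ℝ × ℝ → ℂ} {g g' Dg' : ℝ × ℝ → ℂ}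
    (h : WeakTendstoL2H1 α G g) (hG : ∀ j, G j =ᵐ[volume.restrict (cellDomain α)] G' j)
    (hG' : ∀ j, IsL2H1 α (G' j) (D' j)) (hg' : IsL2H1 α g' Dg')
    (hlim : ∀ A B : ℝ × ℝ → ℂ, MemLp A 2 (volume.restrict (cellDomain α)) →
      MemLp B 2 (volume.restrict (cellDomain α)) →
      Tendsto (fun j => ∫ p in cellDomain α, (G' j p * A p + D' j p * B p)) atTop
        (𝓝 (∫ p in cellDomain α, (g' p * A p + Dg' p * B p)))) :
    ∀ᵐ p ∂(volume.restrict (cellDomain α)), g p = g' p := by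
  obtain ⟨DG, Dg, h1, h2, h3⟩ := h
  have hV := h2.sub hg'
  set V : ℝ × ℝ → ℂ := fun p => g p - g' p with hVdef
  set DV : ℝ × ℝ → ℂ := fun p => Dg p - Dg' p with hDVdef
  have cV : MemLp (fun p => conj (V p)) 2 (volume.restrict (cellDomain α)) := hV.memLp.star
  have cDV : MemLp (fun p => conj (DV p)) 2 (volume.restrict (cellDomain α)) :=
    hV.memLp_deriv.star
  have hD : ∀ j, DG j =ᵐ[volume.restrict (cellDomain α)] D' j := fun j =>
    ((h1 j).congr (hG j) (ae_eq_refl _)).deriv_unique (hG' j)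
  have l1 := h3 V DV hV
  have l2 := hlim _ _ cV cDV
  have e : ∀ j, ∫ p in cellDomain α, (G j p * conj (V p) + DG j p * conj (DV p)) =
      ∫ p in cellDomain α, (G' j p * conj (V p) + D' j p * conj (DV p)) := fun j =>
    integral_congr_ae (by filter_upwards [hG j, hD j] with p hp hp'; rw [hp, hp'])
  have e2 := tendsto_nhds_unique (l1.congr e) l2
  have i : ∀ f f' : ℝ × ℝ → ℂ, MemLp f 2 (volume.restrict (cellDomain α)) →
      MemLp f' 2 (volume.restrict (cellDomain α)) → Integrable
      (fun p => f p * conj (V p) + f' p * conj (DV p)) (volume.restrict (cellDomain α)) :=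
    fun f f' hf hf' => (hf.integrable_mul cV).add (hf'.integrable_mul cDV)
  have e3 := (integral_sub (i _ _ h2.memLp h2.memLp_deriv) (i _ _ hg'.memLp hg'.memLp_deriv)).trans
    (sub_eq_zero.2 e2)
  have e4 : ∀ p, (g p * conj (V p) + Dg p * conj (DV p)) -
      (g' p * conj (V p) + Dg' p * conj (DV p)) = ((‖V p‖ ^ 2 + ‖DV p‖ ^ 2 : ℝ) : ℂ) := fun p => by
    push_cast
    rw [← Complex.mul_conj', ← Complex.mul_conj']
    simp only [hVdef, hDVdef]
    ring
  simp only [e4, integral_complex_ofReal, Complex.ofReal_eq_zero] at e3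
  have i2 : Integrable (fun p => ‖V p‖ ^ 2 + ‖DV p‖ ^ 2) (volume.restrict (cellDomain α)) :=
    (hV.memLp.integrable_norm_pow (by norm_num)).add
      (hV.memLp_deriv.integrable_norm_pow (by norm_num))
  rw [integral_eq_zero_iff_of_nonneg (fun p => by positivity) i2] at e3
  filter_upwards [e3] with p hp
  have hp' : ‖V p‖ ^ 2 + ‖DV p‖ ^ 2 = 0 := hp
  have : ‖V p‖ ^ 2 = 0 := by nlinarith [sq_nonneg ‖V p‖, sq_nonneg ‖DV p‖]
  exact sub_eq_zero.1 (norm_eq_zero.1 (pow_eq_zero_iff two_ne_zero |>.1 this))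

theorem exists_fundamental_system {a ρ : ℝ → ℝ} {a0 a1 ρ1 : ℝ} (hco : PeriodicCoeff a ρ a0 a1 ρ1)
    (lam : ℝ) : ∃ ψ z : Fin 2 → ℝ → ℂ, (∀ q, IsSol a ρ lam 0 1 (ψ q) (z q)) ∧
      fundMat ψ z 0 = 1 := by
  choose ψ z h h1 h2 using fun q : Fin 2 =>
    exists_isSol hco lam ((1 : Matrix (Fin 2) (Fin 2) ℂ) 0 q) ((1 : Matrix (Fin 2) (Fin 2) ℂ) 1 q)
  refine ⟨ψ, z, h, ?_⟩
  ext p q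
  fin_cases p <;> fin_cases q <;> simp [fundMat, h1, h2]

/-- A phase `exp (2 i π k)` in the spectrum of the monodromy matrix gives a Bloch mode. -/
theorem isBlochEigenvalue_of_det {a ρ : ℝ → ℝ} {a0 a1 ρ1 lam k : ℝ}
    (hco : PeriodicCoeff a ρ a0 a1 ρ1) {ψ z : Fin 2 → ℝ → ℂ}
    (hψ : ∀ q, IsSol a ρ lam 0 1 (ψ q) (z q)) (hfund : fundMat ψ z 0 = 1)
    (hdet : (phase (-k) 1 • fundMat ψ z 1 - 1).det = 0) : IsBlochEigenvalue a ρ k lam := by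
  obtain ⟨v, hv, hv0⟩ := Matrix.exists_mulVec_eq_zero_iff.2 hdet
  have f00 := congrFun (congrFun hfund 0) 0
  have f01 := congrFun (congrFun hfund 0) 1
  have f10 := congrFun (congrFun hfund 1) 0
  have f11 := congrFun (congrFun hfund 1) 1
  simp [fundMat] at f00 f01 f10 f11
  have hsol := IsSol.sum Finset.univ v hψ
  set f : ℝ → ℂ := fun y => ∑ i, v i * ψ i y with hf
  set ζ : ℝ → ℂ := fun y => ∑ i, v i * z i y with hζ
  have hf0 : f 0 = v 0 := by simp [hf, Fin.sum_univ_two, f00, f01]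
  have hζ0 : ζ 0 = v 1 := by simp [hζ, Fin.sum_univ_two, f10, f11]
  have hph : phase k 1 * phase (-k) 1 = 1 := by rw [phase_mul, add_neg_cancel, phase_zero_left]
  have m0 := congrFun hv0 0
  have m1 := congrFun hv0 1
  simp [Matrix.mulVec, dotProduct, Fin.sum_univ_two, fundMat] at m0 m1
  have hf1 : f 1 = f 0 * phase k 1 := by
    rw [hf0]; simp only [hf, Fin.sum_univ_two]
    linear_combination phase k 1 * m0 - (v 0 * ψ 0 1 + v 1 * ψ 1 1) * hph
  have hζ1 : ζ 1 = ζ 0 * phase k 1 := by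
    rw [hζ0]; simp only [hζ, Fin.sum_univ_two]
    linear_combination phase k 1 * m1 - (v 0 * z 0 1 + v 1 * z 1 1) * hph
  have hB := hsol.isBlochSol_quasiExt hco hf1 hζ1
  set Φ := quasiExt k f
  have hΦ : ∀ y ∈ Ico (0 : ℝ) 1, Φ y = f y := fun y hy => by
    have := quasiExt_of_mem k f (n := 0) (y := y) (by simpa using hy)
    rwa [phase_zero, Int.cast_zero, sub_zero, mul_one] at this
  have hint : IntegrableOn (fun y => ‖Φ y‖ ^ 2) (Ioo 0 1) :=
    ((hB.continuous.norm.pow 2).integrableOn_Icc).mono_set Ioo_subset_Icc_self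
  set n := ∫ y in Ioo (0 : ℝ) 1, ‖Φ y‖ ^ 2 with hn
  have hn0 : 0 ≤ n := setIntegral_nonneg measurableSet_Ioo fun _ _ => by positivity
  have hn' : n ≠ 0 := fun h0 => by
    rw [hn, setIntegral_eq_zero_iff_of_nonneg_ae (ae_of_all _ fun _ => by positivity) hint] at h0
    have hz : EqOn Φ 0 (Ioo 0 1) := by
      refine Measure.eqOn_open_of_ae_eq (μ := volume) ?_ isOpen_Ioo hB.continuous.continuousOn
        continuousOn_const
      filter_upwards [h0] with y hy
      have hy' : ‖Φ y‖ ^ 2 = 0 := hy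
      simpa using hy'
    have hz' : EqOn Φ 0 (Icc 0 1) := by
      have := hz.closure hB.continuous continuous_const
      rwa [closure_Ioo zero_ne_one] at this
    have hd : HasDerivWithinAt Φ (quasiExt k ζ 0 / a 0) (Ici 0) 0 :=
      (hB.hasDerivAt hco 0).hasDerivWithinAt
    have hd0 : HasDerivWithinAt Φ 0 (Ici 0) 0 := by
      refine (hasDerivWithinAt_const (0 : ℝ) (Ici 0) (0 : ℂ)).congr_of_eventuallyEq ?_
        (hz' (by simp))
      filter_upwards [Icc_mem_nhdsGE (zero_lt_one (α := ℝ))] with y hy using hz' hy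
    have hzz := (uniqueDiffWithinAt_Ici (0 : ℝ)).eq_deriv _ hd hd0
    have hz0 : quasiExt k ζ 0 = ζ 0 := by
      rw [quasiExt_of_mem k ζ (n := 0) (by simp), phase_zero]; simp
    have ha : (a 0 : ℂ) ≠ 0 := Complex.ofReal_ne_zero.2 (hco.a_pos 0).ne'
    have v1 : v 1 = 0 := by rw [← hζ0, ← hz0]; simpa [ha] using hzz
    have v0 : v 0 = 0 := by rw [← hf0, ← hΦ 0 (by simp)]; exact hz' (by simp)
    exact hv (funext (Fin.forall_fin_two.2 ⟨v0, v1⟩))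
  refine ⟨_, (hB.const_mul ((√n)⁻¹ : ℝ)).isBlochMode hco ?_⟩
  simp only [norm_mul, mul_pow, integral_const_mul]
  rw [← hn, Complex.norm_real, Real.norm_eq_abs, sq_abs, inv_pow, Real.sq_sqrt hn0,
    inv_mul_cancel₀ hn']

theorem IsCellSeq.isBlochEigenvalue {a ρ : ℝ → ℝ} {a0 a1 ρ1 α lam0 lam1 k : ℝ} (hα : 0 < α)
    (hco : PeriodicCoeff a ρ a0 a1 ρ1) {N : ℕ → ℕ} {μ : ℕ → ℝ} {W Z : ℕ → ℝ → ℂ}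
    (hs : IsCellSeq a ρ α lam0 lam1 N μ W Z) {G : ℕ → ℝ × ℝ → ℂ} {wk : ℝ × ℝ → ℂ}
    (hG : ∀ j, G j =ᵐ[volume.restrict (cellDomain α)]
      stepFun (α / N j) (fun l y => phase (-k) l * W j (l + y)))
    (h : WeakTendstoL2H1 α G wk)
    (h0 : ¬ ∀ᵐ p ∂(volume.restrict (cellDomain α)), wk p = 0) : IsBlochEigenvalue a ρ k lam0 := by
  obtain ⟨ψ, z, hψ, hfund⟩ := exists_fundamental_system hco lam0
  by_contra hne
  have hdet := mt (isBlochEigenvalue_of_det (k := k) hco hψ hfund) hne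
  refine h0 (h.ae_eq hG (fun j => (hs.sol j).isL2H1 hα hco fun l => phase (-k) l)
    (g' := fun _ => 0) (Dg' := fun _ => 0) ⟨MemLp.zero, MemLp.zero, by simp⟩ fun A B hA hB => ?_)
  simpa using tendsto_integral_unfold_zero hα hco hs hψ hfund k hdet hA hB

/-- The primitive of a quasi-periodic function is bounded, provided that the function has mean zero
if it is periodic. -/
theorem exists_bound_integral_of_quasiPeriodic {f : ℝ → ℂ} {κ : ℝ}
    (hi : ∀ A B, IntervalIntegrable f volume A B)
    (hq : ∀ᵐ y, f (y + 1) = phase κ 1 * f y)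
    (h : phase κ 1 ≠ 1 ∨ ∫ y in (0 : ℝ)..1, f y = 0) : ∃ K, ∀ y, ‖∫ t in (0 : ℝ)..y, f t‖ ≤ K := by
  set R : ℝ → ℂ := fun y => ∫ t in (0 : ℝ)..y, f t with hR
  have hR1 : ∀ y, R (y + 1) = R 1 + phase κ 1 * R y := fun y => by
    simp only [hR]
    rw [← intervalIntegral.integral_add_adjacent_intervals (hi 0 1) (hi 1 (y + 1)),
      ← intervalIntegral.integral_const_mul]
    congr 1
    have h1 := intervalIntegral.integral_comp_add_right (a := 0) (b := y) f 1
    rw [zero_add] at h1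
    rw [← h1]
    exact intervalIntegral.integral_congr_ae (hq.mono fun t ht _ => ht)
  obtain ⟨d, hd⟩ : ∃ d, R 1 = d - phase κ 1 * d := by
    by_cases hc : phase κ 1 = 1
    · exact ⟨0, by simpa using h.resolve_left (not_not.2 hc)⟩
    · have : 1 - phase κ 1 ≠ 0 := sub_ne_zero.2 (Ne.symm hc)
      exact ⟨R 1 / (1 - phase κ 1), by field_simp⟩
  have hstep : ∀ y, R (y + 1) - d = (R y - d) * phase κ 1 := fun y => by
    rw [hR1, hd]; ring
  have hqp : ∀ (y : ℝ) (l : ℤ), R (y + l) - d = (R y - d) * phase κ l := by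
    intro y l
    induction l using Int.induction_on with
    | zero => simp [phase_zero]
    | succ n ih =>
      rw [phase_add, ← mul_assoc, ← ih, ← hstep]
      push_cast
      rw [add_assoc]
    | pred n ih =>
      have h1 := hstep (y + (-n - 1 : ℤ))
      have h2 : y + ((-n - 1 : ℤ) : ℝ) + 1 = y + ((-n : ℤ) : ℝ) := by push_cast; ring
      have h3 : phase κ (-n) = phase κ (-n - 1) * phase κ 1 := by rw [← phase_add]; congr 1; ring
      rw [h2, ih, h3, ← mul_assoc] at h1
      exact (mul_right_cancel₀ (phase_ne_zero κ 1) h1).symm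
  have hc : Continuous fun y => R y - d :=
    (intervalIntegral.continuous_primitive hi 0).sub continuous_const
  obtain ⟨K, hK⟩ := exists_bound_of_quasiPeriodic hc hqp
  refine ⟨K + ‖d‖, fun y => ?_⟩
  calc ‖R y‖ = ‖(R y - d) + d‖ := by rw [sub_add_cancel]
    _ ≤ K + ‖d‖ := (norm_add_le _ _).trans (by gcongr; exact hK y)

/-- A basis of the solutions of the cell equation which consists of Bloch waves with
quasi-momenta `κ 0`, `κ 1`, either equal or distinct modulo one. -/
structure IsBlochBasis (a ρ : ℝ → ℝ) (lam : ℝ) (κ : Fin 2 → ℝ) (ψ z : Fin 2 → ℝ → ℂ) : Prop where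
  sol : ∀ q, IsBlochSol a ρ (κ q) lam (ψ q) (z q)
  det_ne : (wron ψ z 0).det ≠ 0
  phase_ne : ∀ p q, κ p ≠ κ q → phase (κ q - κ p) 1 ≠ 1

/-- The mean value of `ρ ψ_q conj ψ_p` over the line. -/
def meanB (ρ : ℝ → ℝ) (κ : Fin 2 → ℝ) (ψ : Fin 2 → ℝ → ℂ) (p q : Fin 2) : ℂ :=
  if κ p = κ q then coeffB ρ (ψ p) (ψ q) else 0

namespace IsBlochBasis

variable {a ρ : ℝ → ℝ} {a0 a1 ρ1 lam : ℝ} {κ : Fin 2 → ℝ} {ψ z : Fin 2 → ℝ → ℂ}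

theorem wron_eq (h : IsBlochBasis a ρ lam κ ψ z) (y : ℝ) : wron ψ z y = wron ψ z 0 :=
  wron_eq_of_isSol (A := min y 0) (B := max y 0) (fun q => (h.sol q).sol _ _) (by simp) (by simp)

theorem det_wron_ne (h : IsBlochBasis a ρ lam κ ψ z) (y : ℝ) : (wron ψ z y).det ≠ 0 := by
  rw [h.wron_eq]; exact h.det_ne

theorem exists_bound (h : IsBlochBasis a ρ lam κ ψ z) :
    ∃ S, 0 ≤ S ∧ ∀ q y, ‖ψ q y‖ ≤ S ∧ ‖z q y‖ ≤ S := by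
  choose S hS using fun q => (h.sol q).exists_bound
  refine ⟨max (S 0) (S 1), ((norm_nonneg _).trans (hS 0 0).1).trans (le_max_left _ _),
    Fin.forall_fin_two.2 ⟨fun y => ?_, fun y => ?_⟩⟩
  · exact ⟨(hS 0 y).1.trans (le_max_left _ _), (hS 0 y).2.trans (le_max_left _ _)⟩
  · exact ⟨(hS 1 y).1.trans (le_max_right _ _), (hS 1 y).2.trans (le_max_right _ _)⟩

theorem intervalIntegrable_weight (h : IsBlochBasis a ρ lam κ ψ z)
    (hco : PeriodicCoeff a ρ a0 a1 ρ1) (p q : Fin 2) (A B : ℝ) :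
    IntervalIntegrable (fun y => (ρ y : ℂ) * ψ q y * conj (ψ p y)) volume A B := by
  have hc : Continuous fun y => ψ q y * conj (ψ p y) :=
    (h.sol q).continuous.mul (Complex.continuous_conj.comp (h.sol p).continuous)
  have hρ : IntervalIntegrable (fun y => (ρ y : ℂ)) volume A B := by
    refine (intervalIntegrable_const (c := (ρ1 : ℂ))).mono_fun
      (Complex.continuous_ofReal.comp_aestronglyMeasurable hco.meas).restrict ?_
    refine ae_restrict_of_ae (hco.ρ_le.mono fun y hy => ?_)
    change ‖(ρ y : ℂ)‖ ≤ ‖(ρ1 : ℂ)‖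
    rw [Complex.norm_real, Complex.norm_real, Real.norm_eq_abs, Real.norm_eq_abs]
    exact hy.trans (le_abs_self _)
  exact (hρ.mul_continuousOn hc.continuousOn).congr fun y _ => (mul_assoc _ _ _).symm

theorem exists_bound_weight (h : IsBlochBasis a ρ lam κ ψ z)
    (hco : PeriodicCoeff a ρ a0 a1 ρ1) : ∃ K, 0 ≤ K ∧ ∀ p q y,
      ‖∫ t in (0 : ℝ)..y, ((ρ t : ℂ) * ψ q t * conj (ψ p t) - meanB ρ κ ψ p q)‖ ≤ K := by
  have key : ∀ p q, ∃ K, ∀ y,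
      ‖∫ t in (0 : ℝ)..y, ((ρ t : ℂ) * ψ q t * conj (ψ p t) - meanB ρ κ ψ p q)‖ ≤ K := by
    intro p q
    have hi := h.intervalIntegrable_weight hco p q
    have hqp : ∀ᵐ y, (ρ (y + 1) : ℂ) * ψ q (y + 1) * conj (ψ p (y + 1)) =
        phase (κ q - κ p) 1 * ((ρ y : ℂ) * ψ q y * conj (ψ p y)) := by
      filter_upwards [hco.ρ_per] with y hy
      have h1 := (h.sol q).qp y 1
      have h2 := (h.sol p).qp y 1
      rw [Int.cast_one] at h1 h2
      rw [hy, h1, h2, map_mul, ← phase_neg, sub_eq_add_neg, ← phase_mul]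
      ring
    refine exists_bound_integral_of_quasiPeriodic (κ := κ q - κ p)
      (fun A B => (hi A B).sub intervalIntegrable_const) ?_ ?_
    · filter_upwards [hqp] with y hy
      rw [hy, meanB]
      split_ifs with hκ
      · rw [hκ, sub_self, phase_zero_left, one_mul, one_mul]
      · simp
    · by_cases hκ : κ p = κ q
      · right
        rw [intervalIntegral.integral_sub (hi 0 1) intervalIntegrable_const, meanB, if_pos hκ,
          coeffB, intervalIntegral.integral_of_le zero_le_one, integral_Ioc_eq_integral_Ioo]
        simp
      · exact Or.inl (h.phase_ne p q hκ)
  choose K hK using key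
  refine ⟨∑ p, ∑ q, |K p q|, by positivity, fun p q y => (hK p q y).trans ?_⟩
  exact (le_abs_self _).trans ((Finset.single_le_sum (f := fun q => |K p q|)
    (fun _ _ => abs_nonneg _) (Finset.mem_univ q)).trans (Finset.single_le_sum
    (f := fun p => ∑ q, |K p q|) (fun _ _ => by positivity) (Finset.mem_univ p)))

/-- The averaged equation for the coordinates of a solution in a Bloch basis. -/
theorem norm_averaged_le (h : IsBlochBasis a ρ lam κ ψ z) (hco : PeriodicCoeff a ρ a0 a1 ρ1)
    {μ B K K' S R : ℝ} {W Z : ℝ → ℂ} (hW : IsSol a ρ μ 0 B W Z)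
    (hS : ∀ q y, ‖ψ q y‖ ≤ S)
    (hU : ∀ q, ∀ y ∈ Icc 0 B, ‖coords ψ z W Z q y‖ ≤ K) (hWK : ∀ y ∈ Icc 0 B, ‖W y‖ ≤ K')
    (hR0 : 0 ≤ R)
    (hR : ∀ p q y, ‖∫ t in (0 : ℝ)..y,
      ((ρ t : ℂ) * ψ q t * conj (ψ p t) - meanB ρ κ ψ p q)‖ ≤ R) (p : Fin 2) {y : ℝ}
    (hy : y ∈ Icc 0 B) :
    ‖∑ q, wron ψ z 0 p q * (coords ψ z W Z q y - coords ψ z W Z q 0) +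
      ((μ - lam : ℝ) : ℂ) * ∑ q, meanB ρ κ ψ p q * ∫ t in (0 : ℝ)..y, coords ψ z W Z q t‖ ≤
      |μ - lam| * (2 * (R * K + R * (varConst (wron ψ z 0) ρ1 S * |μ - lam| * K') * B)) := by
  have hB : 0 ≤ B := hy.1.trans hy.2
  have h0 : (0 : ℝ) ∈ Icc 0 B := ⟨le_rfl, hB⟩
  have hψ : ∀ q, IsSol a ρ lam 0 B (ψ q) (z q) := fun q => (h.sol q).sol 0 B
  set U := coords ψ z W Z with hUdef
  set P : Fin 2 → ℝ → ℂ := fun q t => (ρ t : ℂ) * ψ q t * conj (ψ p t) with hP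
  have hS0 : 0 ≤ S := (norm_nonneg _).trans (hS 0 0)
  have hv := varConst_nonneg (wron ψ z 0) hco.ρ1_nonneg hS0
  have hK'0 : 0 ≤ K' := (norm_nonneg _).trans (hWK 0 h0)
  have spec : ∀ t, W t = ∑ q, U q t * ψ q t ∧ Z t = ∑ q, U q t * z q t := fun t =>
    coords_spec (h.det_wron_ne t) W Z
  have hUc : ∀ q, ContinuousOn (U q) (Icc 0 B) := fun q => continuousOn_coords hψ hW hB q
  have hUi : ∀ q, IntervalIntegrable (U q) volume 0 y := fun q =>
    ((hUc q).mono (Icc_subset_Icc_right hy.2)).intervalIntegrable_of_Icc hy.1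
  have hPi : ∀ q, IntervalIntegrable (P q) volume 0 y := fun q =>
    h.intervalIntegrable_weight hco p q 0 y
  have hPU : ∀ q, IntervalIntegrable (fun t => P q t * U q t) volume 0 y := fun q =>
    (hPi q).mul_continuousOn (by
      rw [uIcc_of_le hy.1]; exact (hUc q).mono (Icc_subset_Icc_right hy.2))
  have e1 : ∑ q, wron ψ z 0 p q * (U q y - U q 0) =
      -((μ - lam : ℝ) : ℂ) * ∑ q, ∫ t in (0 : ℝ)..y, P q t * U q t := by
    have hw := (hW.wronskian (hψ p) hB).sub_eq h0 hy
    have hQ : ∀ t, Z t * conj (ψ p t) - W t * conj (z p t) = ∑ q, wron ψ z 0 p q * U q t :=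
      fun t => by
        rw [(spec t).1, (spec t).2, ← h.wron_eq t]
        simp only [wron, Matrix.of_apply, Fin.sum_univ_two]
        ring
    rw [hQ, hQ, ← Finset.sum_sub_distrib] at hw
    simp only [mul_sub]
    rw [hw, ← intervalIntegral.integral_finsetSum fun q _ => hPU q,
      ← intervalIntegral.integral_const_mul]
    refine intervalIntegral.integral_congr fun t _ => ?_
    simp only [(spec t).1, hP, Finset.sum_mul, Finset.mul_sum]
    refine Finset.sum_congr rfl fun q _ => ?_
    push_cast
    ring
  have e2 : ∀ q, (∫ t in (0 : ℝ)..y, P q t * U q t) - meanB ρ κ ψ p q * ∫ t in (0 : ℝ)..y, U q t =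
      ∫ t in (0 : ℝ)..y, (P q t - meanB ρ κ ψ p q) * U q t := fun q => by
    rw [← intervalIntegral.integral_const_mul,
      ← intervalIntegral.integral_sub (hPU q) ((hUi q).const_mul _)]
    refine intervalIntegral.integral_congr fun t _ => ?_
    ring
  have e3 : ∀ q, ‖∫ t in (0 : ℝ)..y, (P q t - meanB ρ κ ψ p q) * U q t‖ ≤
      R * K + R * (varConst (wron ψ z 0) ρ1 S * |μ - lam| * K') * B := fun q => by
    set r : ℝ → ℂ := fun x => ∫ t in (0 : ℝ)..x, (P q t - meanB ρ κ ψ p q) with hr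
    have hrp : IsPrim 0 B r (fun t => P q t - meanB ρ κ ψ p q) := by
      refine ⟨?_, fun x _ => by simp [hr]⟩
      rw [← intervalIntegrable_iff_integrableOn_Icc_of_le hB]
      exact (h.intervalIntegrable_weight hco p q 0 B).sub intervalIntegrable_const
    have hUp := isPrim_coords hψ hW hB q
    set U' : ℝ → ℂ := fun y => ∑ p, (wron ψ z 0)⁻¹ q p *
      (-(((μ - lam) * ρ y : ℝ) : ℂ) * (W y * conj (ψ p y)))
    have hprod := (hrp.mul hUp hB).sub_eq h0 hy
    have hr0 : r 0 = 0 := by simp [hr]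
    have hi1 : IntervalIntegrable (fun t => (P q t - meanB ρ κ ψ p q) * U q t) volume 0 y :=
      (hrp.intervalIntegrable h0 hy).mul_continuousOn (by
        rw [uIcc_of_le hy.1]; exact (hUc q).mono (Icc_subset_Icc_right hy.2))
    have hi2 : IntervalIntegrable (fun t => r t * U' t) volume 0 y :=
      (hUp.intervalIntegrable h0 hy).continuousOn_mul (by
        rw [uIcc_of_le hy.1]; exact hrp.continuousOn.mono (Icc_subset_Icc_right hy.2))
    rw [intervalIntegral.integral_add hi1 hi2, hr0, zero_mul, sub_zero] at hprod
    have e4 : ‖∫ t in (0 : ℝ)..y, r t * U' t‖ ≤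
        R * (varConst (wron ψ z 0) ρ1 S * |μ - lam| * K') * |y - 0| := by
      refine intervalIntegral.norm_integral_le_of_norm_le_const_ae ?_
      filter_upwards [coords_density_le hco (lam := lam) (μ := μ) (W := W) (I := univ)
        (fun q y _ => hS q y) (wron ψ z 0) q] with t ht htI
      rw [uIoc_of_le hy.1] at htI
      rw [norm_mul]
      have h1 := ht trivial
      have h2 := hWK t ⟨htI.1.le, htI.2.trans hy.2⟩
      gcongr
      · exact hR p q t
      · exact h1.trans (by gcongr)
    rw [sub_zero, abs_of_nonneg hy.1] at e4
    rw [← sub_eq_iff_eq_add.2 hprod]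
    refine (norm_sub_le _ _).trans (add_le_add ?_ (e4.trans ?_))
    · rw [norm_mul]
      have := hU q y hy
      gcongr
      exact hR p q y
    · gcongr
      exact hy.2
  have e5 : ∑ q, wron ψ z 0 p q * (U q y - U q 0) +
      ((μ - lam : ℝ) : ℂ) * ∑ q, meanB ρ κ ψ p q * ∫ t in (0 : ℝ)..y, U q t =
      -((μ - lam : ℝ) : ℂ) * ∑ q, ∫ t in (0 : ℝ)..y, (P q t - meanB ρ κ ψ p q) * U q t := by
    rw [e1, ← Finset.sum_congr rfl fun q _ => e2 q, Finset.sum_sub_distrib]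
    ring
  rw [e5, norm_mul, norm_neg, Complex.norm_real, Real.norm_eq_abs]
  gcongr
  refine (norm_sum_le _ _).trans ((Finset.sum_le_sum fun q _ => e3 q).trans ?_)
  simp [mul_add]

end IsBlochBasis

theorem exists_subseq_tendstoUniformlyOn {α K L : ℝ} (hα : 0 ≤ α) {f : ℕ → Fin 2 → ℝ → ℂ}
    (hK : ∀ j q, ∀ x ∈ Icc 0 α, ‖f j q x‖ ≤ K)
    (hL : ∀ j q, ∀ x ∈ Icc 0 α, ∀ y ∈ Icc 0 α, ‖f j q x - f j q y‖ ≤ L * |x - y|) :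
    ∃ (s : ℕ → ℕ) (u : Fin 2 → ℝ → ℂ), StrictMono s ∧ (∀ q, Continuous (u q)) ∧
      ∀ q, TendstoUniformlyOn (fun j => f (s j) q) (u q) atTop (Icc 0 α) := by
  have h0 : (0 : ℝ) ∈ Icc 0 α := ⟨le_rfl, hα⟩
  have hK0 : 0 ≤ K := (norm_nonneg _).trans (hK 0 0 0 h0)
  have hdist : ∀ j, ∀ x y : Icc (0 : ℝ) α,
      dist (fun q => f j q x) (fun q => f j q y) ≤ max L 0 * dist x y := fun j x y => by
    refine (dist_pi_le_iff (by positivity)).2 fun q => ?_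
    rw [dist_eq_norm]
    refine (hL j q x x.2 y y.2).trans ?_
    rw [Subtype.dist_eq, Real.dist_eq]
    gcongr
    exact le_max_left _ _
  have hlip : ∀ j, LipschitzWith (max L 0).toNNReal (fun (x : Icc (0 : ℝ) α) q => f j q x) :=
    fun j => LipschitzWith.of_dist_le_mul fun x y => by
      rw [Real.coe_toNNReal _ (le_max_right _ _)]; exact hdist j x y
  set F : ℕ → BoundedContinuousFunction (Icc (0 : ℝ) α) (Fin 2 → ℂ) := fun j =>
    BoundedContinuousFunction.mkOfCompact ⟨fun x q => f j q x, (hlip j).continuous⟩ with hF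
  have hcpt : IsCompact (closure (range F)) := by
    refine BoundedContinuousFunction.arzela_ascoli (Metric.closedBall 0 K)
      (isCompact_closedBall 0 K) _ ?_ ?_
    · rintro _ x ⟨j, rfl⟩
      rw [mem_closedBall_zero_iff]
      exact (pi_norm_le_iff_of_nonneg hK0).2 fun q => hK j q x x.2
    · refine (Metric.uniformEquicontinuous_of_continuity_modulus (fun t => max L 0 * t) ?_ _
        ?_).equicontinuous
      · have : Continuous fun t : ℝ => max L 0 * t := by fun_prop
        simpa using this.tendsto 0
      · rintro x y ⟨_, j, rfl⟩
        exact hdist j x y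
  obtain ⟨g, -, s, hs, hg⟩ := hcpt.tendsto_subseq fun j => subset_closure (mem_range_self (f := F) j)
  refine ⟨s, fun q x => g (projIcc 0 α hα x) q, hs, fun q => ?_, fun q => ?_⟩
  · exact (continuous_apply q).comp (g.continuous.comp continuous_projIcc)
  · rw [BoundedContinuousFunction.tendsto_iff_tendstoUniformly,
      Metric.tendstoUniformly_iff] at hg
    rw [Metric.tendstoUniformlyOn_iff]
    intro e he
    filter_upwards [hg e he] with j hj x hx
    have h1 := hj ⟨x, hx⟩
    rw [projIcc_of_mem hα hx]
    exact (dist_le_pi_dist _ _ q).trans_lt h1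

namespace IsCellSeq

variable {a ρ : ℝ → ℝ} {a0 a1 ρ1 α lam0 lam1 : ℝ} {N : ℕ → ℕ} {μ : ℕ → ℝ} {W Z : ℕ → ℝ → ℂ}
  {κ : Fin 2 → ℝ} {ψ z : Fin 2 → ℝ → ℂ}

/-- Uniform bounds for the coordinates in a Bloch basis. -/
theorem exists_coords_bound (hs : IsCellSeq a ρ α lam0 lam1 N μ W Z) (hα : 0 < α)
    (hco : PeriodicCoeff a ρ a0 a1 ρ1) (hb : IsBlochBasis a ρ lam0 κ ψ z) :
    ∃ K, 0 ≤ K ∧ ∀ j, (∀ y ∈ Icc (0 : ℝ) (N j), ‖W j y‖ ≤ K) ∧ ∀ q, ∀ y ∈ Icc (0 : ℝ) (N j),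
      ‖coords ψ z (W j) (Z j) q y‖ ≤ K ∧ ∀ x ∈ Icc (0 : ℝ) (N j),
      ‖coords ψ z (W j) (Z j) q x - coords ψ z (W j) (Z j) q y‖ ≤ K * (α / N j) * |x - y| := by
  obtain ⟨S, hS0, hS⟩ := hb.exists_bound
  obtain ⟨Kr, hKr0, hKr⟩ := hs.exists_rate_bound hα
  obtain ⟨Kμ, hKμ0, hKμ⟩ := hs.exists_bound hα
  have hρ := hco.ρ1_nonneg
  have ha1 := hco.a1_pos
  set v := varConst (wron ψ z 0) ρ1 S
  have hv : 0 ≤ v := varConst_nonneg _ hρ hS0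
  set Q := 2 * ((2 + 2 / a0 ^ 2 + 2 * (Kμ * ρ1) ^ 2) * (1 + a1 * Kμ * ρ1)) with hQ
  have hQ0 : 0 ≤ Q := by positivity
  set T := √(Q / α)
  set c := ∑ q, ∑ p, ‖(wron ψ z 0)⁻¹ q p‖ with hc
  set K1 := c * (2 * (T * S)) + v * Kr * (α + 1) with hK1
  set K2 := 2 * (K1 * S) with hK2
  have hK10 : 0 ≤ K1 := by positivity
  have hψ : ∀ j q, IsSol a ρ lam0 0 (N j) (ψ q) (z q) := fun j q => (hb.sol q).sol _ _
  -- variation of the coordinates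
  have hvar : ∀ j q, ∀ x ∈ Icc (0 : ℝ) (N j), ∀ y ∈ Icc (0 : ℝ) (N j), x ≤ y →
      ‖coords ψ z (W j) (Z j) q y - coords ψ z (W j) (Z j) q x‖ ≤
        v * (Kr * (α / N j)) * ∫ t in x..y, ‖W j t‖ := fun j q x hx y hy hxy => by
    refine (norm_coords_sub_le hco (hψ j) (hs.sol j).sol (fun q y _ => (hS q y).1) q hx hy
      hxy).trans ?_
    have := hKr j
    have : 0 ≤ ∫ t in x..y, ‖W j t‖ :=
      intervalIntegral.integral_nonneg hxy fun _ _ => norm_nonneg _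
    gcongr
  have hint : ∀ j, α / N j * ∫ t in (0 : ℝ)..N j, ‖W j t‖ ≤ α + 1 := fun j => by
    have hN : (0 : ℝ) ≤ N j := Nat.cast_nonneg _
    have hWc := (hs.sol j).sol.fst.continuousOn
    have i1 : IntervalIntegrable (fun t => ‖W j t‖) volume 0 (N j) :=
      hWc.norm.intervalIntegrable_of_Icc hN
    have i2 : IntervalIntegrable (fun t => ‖W j t‖ ^ 2) volume 0 (N j) :=
      (hWc.norm.pow 2).intervalIntegrable_of_Icc hN
    have h1 : ∫ t in (0 : ℝ)..N j, ‖W j t‖ ≤ ∫ t in (0 : ℝ)..N j, (1 + ‖W j t‖ ^ 2) :=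
      intervalIntegral.integral_mono_on hN i1 (intervalIntegrable_const.add i2) fun t _ => by
        nlinarith [sq_nonneg (‖W j t‖ - 1), norm_nonneg (W j t)]
    rw [intervalIntegral.integral_add intervalIntegrable_const i2] at h1
    simp only [intervalIntegral.integral_const, sub_zero, smul_eq_mul, mul_one] at h1
    have h2 := mul_le_mul_of_nonneg_left h1 (hs.eps_pos hα j).le
    rwa [mul_add, hs.eps_mul, (hs.sol j).norm_eq] at h2
  have hosc : ∀ j q, ∀ x ∈ Icc (0 : ℝ) (N j), ∀ y ∈ Icc (0 : ℝ) (N j), x ≤ y →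
      ‖coords ψ z (W j) (Z j) q y - coords ψ z (W j) (Z j) q x‖ ≤ v * Kr * (α + 1) := by
    intro j q x hx y hy hxy
    have hε := hs.eps_pos hα j
    refine (hvar j q x hx y hy hxy).trans ?_
    calc v * (Kr * (α / N j)) * ∫ t in x..y, ‖W j t‖
        ≤ v * (Kr * (α / N j)) * ∫ t in (0 : ℝ)..N j, ‖W j t‖ := by
          refine mul_le_mul_of_nonneg_left ?_ (by positivity)
          exact intervalIntegral.integral_mono_interval hx.1 hxy hy.2
            (ae_of_all _ fun _ => norm_nonneg _)
            ((hs.sol j).sol.fst.continuousOn.norm.intervalIntegrable_of_Icc (Nat.cast_nonneg _))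
      _ = v * Kr * (α / N j * ∫ t in (0 : ℝ)..N j, ‖W j t‖) := by ring
      _ ≤ _ := mul_le_mul_of_nonneg_left (hint j) (by positivity)
  -- a point where the coordinates are bounded
  have hU : ∀ j q, ∀ y ∈ Icc (0 : ℝ) (N j), ‖coords ψ z (W j) (Z j) q y‖ ≤ K1 := by
    intro j q y hy
    have hε := hs.eps_pos hα j
    have hNp : (0 : ℝ) < N j := by exact_mod_cast (hs.sol j).N_pos
    obtain ⟨l, hl, hle⟩ : ∃ l ∈ Finset.range (N j + 1), ‖W j l‖ ^ 2 + ‖Z j l‖ ^ 2 ≤ Q / α := by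
      refine Finset.exists_le_of_sum_le (by simp) ?_
      have h1 := sum_norm_sq_nodes_le (hs.sol j) hα hco (hKμ j)
      rw [← hQ, div_mul_eq_mul_div, div_le_iff₀ hNp] at h1
      simp only [Finset.sum_const, Finset.card_range, nsmul_eq_mul]
      push_cast
      rw [← mul_div_assoc, le_div_iff₀ hα]
      nlinarith
    have hl' : (l : ℝ) ∈ Icc (0 : ℝ) (N j) :=
      ⟨Nat.cast_nonneg _, by exact_mod_cast Nat.lt_succ_iff.1 (Finset.mem_range.1 hl)⟩
    have hWl : ‖W j l‖ ≤ T := Real.le_sqrt_of_sq_le (by nlinarith [sq_nonneg ‖Z j l‖])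
    have hZl : ‖Z j l‖ ≤ T := Real.le_sqrt_of_sq_le (by nlinarith [sq_nonneg ‖W j l‖])
    have hUl : ‖coords ψ z (W j) (Z j) q l‖ ≤ c * (2 * (T * S)) := by
      rw [coords, hb.wron_eq]
      calc _ ≤ ∑ p, ‖(wron ψ z 0)⁻¹ q p‖ * (2 * (T * S)) := by
            refine (norm_sum_le _ _).trans (Finset.sum_le_sum fun p _ => ?_)
            rw [norm_mul]
            refine mul_le_mul_of_nonneg_left ((norm_sub_le _ _).trans ?_) (norm_nonneg _)
            rw [norm_mul, norm_mul, RCLike.norm_conj, RCLike.norm_conj, two_mul]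
            have h1 := (hS p l).1
            have h2 := (hS p l).2
            have : 0 ≤ T := Real.sqrt_nonneg _
            gcongr
        _ ≤ c * (2 * (T * S)) := by
            rw [← Finset.sum_mul]
            refine mul_le_mul_of_nonneg_right ?_ (by positivity)
            exact Finset.single_le_sum (f := fun q => ∑ p, ‖(wron ψ z 0)⁻¹ q p‖)
              (fun _ _ => by positivity) (Finset.mem_univ q)
    have hd : ‖coords ψ z (W j) (Z j) q y - coords ψ z (W j) (Z j) q l‖ ≤ v * Kr * (α + 1) := by
      rcases le_total (l : ℝ) y with h | h
      · exact hosc j q l hl' y hy h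
      · rw [norm_sub_rev]; exact hosc j q y hy l hl' h
    calc _ = ‖coords ψ z (W j) (Z j) q l +
          (coords ψ z (W j) (Z j) q y - coords ψ z (W j) (Z j) q l)‖ := by rw [add_sub_cancel]
      _ ≤ _ := (norm_add_le _ _).trans (add_le_add hUl hd)
  have hW : ∀ j, ∀ y ∈ Icc (0 : ℝ) (N j), ‖W j y‖ ≤ K2 := fun j y hy => by
    rw [(coords_spec (hb.det_wron_ne y) (W j) (Z j)).1]
    calc _ ≤ ∑ _q : Fin 2, K1 * S := by
          refine (norm_sum_le _ _).trans (Finset.sum_le_sum fun q _ => ?_)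
          rw [norm_mul]
          have h1 := hU j q y hy
          have h2 := (hS q y).1
          gcongr
      _ = K2 := by simp [hK2]
  have hK20 : 0 ≤ K2 := by positivity
  have hlip : ∀ j q, ∀ x ∈ Icc (0 : ℝ) (N j), ∀ y ∈ Icc (0 : ℝ) (N j), x ≤ y →
      ‖coords ψ z (W j) (Z j) q y - coords ψ z (W j) (Z j) q x‖ ≤
        v * Kr * K2 * (α / N j) * |y - x| := fun j q x hx y hy hxy => by
    refine (hvar j q x hx y hy hxy).trans ?_
    have hε := hs.eps_pos hα j
    have h1 : ∫ t in x..y, ‖W j t‖ ≤ K2 * |y - x| := by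
      refine (le_abs_self _).trans ?_
      refine intervalIntegral.norm_integral_le_of_norm_le_const (f := fun t => ‖W j t‖)
        fun t ht => ?_
      rw [uIoc_of_le hxy] at ht
      rw [norm_norm]
      exact hW j t ⟨hx.1.trans ht.1.le, ht.2.trans hy.2⟩
    calc _ ≤ v * (Kr * (α / N j)) * (K2 * |y - x|) :=
          mul_le_mul_of_nonneg_left h1 (by positivity)
      _ = _ := by ring
  refine ⟨K1 + K2 + v * Kr * K2, by positivity, fun j => ⟨fun y hy => (hW j y hy).trans ?_,
    fun q y hy => ⟨(hU j q y hy).trans ?_, fun x hx => ?_⟩⟩⟩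
  · have : 0 ≤ v * Kr * K2 := by positivity
    linarith
  · have : 0 ≤ v * Kr * K2 := by positivity
    linarith
  · have hε := hs.eps_pos hα j
    have h1 : v * Kr * K2 * (α / N j) * |x - y| ≤
        (K1 + K2 + v * Kr * K2) * (α / N j) * |x - y| := by
      gcongr; linarith
    refine le_trans ?_ h1
    rcases le_total x y with h | h
    · rw [norm_sub_rev, abs_sub_comm]; exact hlip j q x hx y hy h
    · exact hlip j q y hy x hx h

end IsCellSeq

namespace IsCellSeq

variable {a ρ : ℝ → ℝ} {a0 a1 ρ1 α lam0 lam1 : ℝ} {N : ℕ → ℕ} {μ : ℕ → ℝ} {W Z : ℕ → ℝ → ℂ}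
  {κ : Fin 2 → ℝ} {ψ z : Fin 2 → ℝ → ℂ} {u : Fin 2 → ℝ → ℂ}

theorem div_eps_mem (hs : IsCellSeq a ρ α lam0 lam1 N μ W Z) (hα : 0 < α) (j : ℕ) {x : ℝ}
    (hx : x ∈ Icc 0 α) : x / (α / N j) ∈ Icc (0 : ℝ) (N j) := by
  have hε := hs.eps_pos hα j
  refine ⟨div_nonneg hx.1 hε.le, ?_⟩
  rw [div_le_iff₀ hε, mul_comm, hs.eps_mul]
  exact hx.2

theorem exists_profile (hs : IsCellSeq a ρ α lam0 lam1 N μ W Z) (hα : 0 < α)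
    (hco : PeriodicCoeff a ρ a0 a1 ρ1) (hb : IsBlochBasis a ρ lam0 κ ψ z) :
    ∃ (s : ℕ → ℕ) (u : Fin 2 → ℝ → ℂ), StrictMono s ∧ (∀ q, Continuous (u q)) ∧
      ∀ q, TendstoUniformlyOn (fun j x => coords ψ z (W (s j)) (Z (s j)) q (x / (α / N (s j))))
        (u q) atTop (Icc 0 α) := by
  obtain ⟨K, hK0, hK⟩ := hs.exists_coords_bound hα hco hb
  refine exists_subseq_tendstoUniformlyOn (K := K) (L := K) hα.le
    (f := fun j q x => coords ψ z (W j) (Z j) q (x / (α / N j)))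
    (fun j q x hx => (((hK j).2 q _ (hs.div_eps_mem hα j hx)).1)) fun j q x hx y hy => ?_
  refine (((hK j).2 q _ (hs.div_eps_mem hα j hy)).2 _ (hs.div_eps_mem hα j hx)).trans (le_of_eq ?_)
  have hε := hs.eps_pos hα j
  rw [← sub_div, abs_div, abs_of_pos hε, mul_assoc, mul_div_cancel₀ _ hε.ne']

/-- The averaged equation passes to the limit. -/
theorem profile_eq (hs : IsCellSeq a ρ α lam0 lam1 N μ W Z) (hα : 0 < α)
    (hco : PeriodicCoeff a ρ a0 a1 ρ1) (hb : IsBlochBasis a ρ lam0 κ ψ z)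
    (hu : ∀ q, TendstoUniformlyOn (fun j x => coords ψ z (W j) (Z j) q (x / (α / N j)))
      (u q) atTop (Icc 0 α)) (p : Fin 2) {x : ℝ} (hx : x ∈ Icc 0 α) :
    ∑ q, wron ψ z 0 p q * (u q x - u q 0) +
      lam1 * ∑ q, meanB ρ κ ψ p q * ∫ t in (0 : ℝ)..x, u q t = 0 := by
  obtain ⟨K, hK0, hK⟩ := hs.exists_coords_bound hα hco hb
  obtain ⟨S, hS0, hS⟩ := hb.exists_bound
  obtain ⟨R, hR0, hR⟩ := hb.exists_bound_weight hco
  obtain ⟨Kr, hKr0, hKr⟩ := hs.exists_rate_bound hα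
  have h0 : (0 : ℝ) ∈ Icc 0 α := ⟨le_rfl, hα.le⟩
  set V : ℕ → Fin 2 → ℝ → ℂ := fun j q x => coords ψ z (W j) (Z j) q (x / (α / N j)) with hV
  have hVlim : ∀ q, ∀ t ∈ Icc 0 α, Tendsto (fun j => V j q t) atTop (𝓝 (u q t)) := fun q t ht =>
    (hu q).tendsto_at ht
  have hVc : ∀ j q, ContinuousOn (V j q) (Icc 0 α) := fun j q =>
    (continuousOn_coords (fun q => (hb.sol q).sol 0 (N j)) (hs.sol j).sol (Nat.cast_nonneg _)
      q).comp (by fun_prop) fun t ht => hs.div_eps_mem hα j ht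
  have hint : ∀ q, Tendsto (fun j => ∫ t in (0 : ℝ)..x, V j q t) atTop
      (𝓝 (∫ t in (0 : ℝ)..x, u q t)) := fun q => by
    refine intervalIntegral.tendsto_integral_filter_of_dominated_convergence (fun _ => K) ?_ ?_
      intervalIntegrable_const ?_
    · refine Eventually.of_forall fun j => ((hVc j q).mono ?_).aestronglyMeasurable
        measurableSet_uIoc
      rw [uIoc_of_le hx.1]
      exact fun t ht => ⟨ht.1.le, ht.2.trans hx.2⟩
    · refine Eventually.of_forall fun j => ae_of_all _ fun t ht => ?_
      rw [uIoc_of_le hx.1] at ht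
      exact ((hK j).2 q _ (hs.div_eps_mem hα j ⟨ht.1.le, ht.2.trans hx.2⟩)).1
    · refine ae_of_all _ fun t ht => ?_
      rw [uIoc_of_le hx.1] at ht
      exact hVlim q t ⟨ht.1.le, ht.2.trans hx.2⟩
  have hrate : Tendsto (fun j => (((μ j - lam0) / (α / N j) : ℝ) : ℂ)) atTop (𝓝 (lam1 : ℂ)) :=
    (Complex.continuous_ofReal.tendsto _).comp hs.rate
  have hlim := (tendsto_finsetSum Finset.univ fun q _ =>
    ((hVlim q x hx).sub (hVlim q 0 h0)).const_mul (wron ψ z 0 p q)).add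
    (hrate.mul (tendsto_finsetSum Finset.univ fun q _ =>
      (hint q).const_mul (meanB ρ κ ψ p q)))
  refine tendsto_nhds_unique hlim (squeeze_zero_norm (a := fun j => |μ j - lam0| *
    (2 * (R * K + R * (varConst (wron ψ z 0) ρ1 S * Kr * K) * α))) (fun j => ?_) ?_)
  · have hε := hs.eps_pos hα j
    have h1 := hb.norm_averaged_le hco (hs.sol j).sol (fun q y => (hS q y).1)
      (fun q y hy => ((hK j).2 q y hy).1) (hK j).1 hR0 hR p (hs.div_eps_mem hα j hx)
    have h2 : ∀ q, ∫ t in (0 : ℝ)..x / (α / N j), coords ψ z (W j) (Z j) q t =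
        ((α / N j : ℝ) : ℂ)⁻¹ * ∫ t in (0 : ℝ)..x, V j q t := fun q => by
      have := intervalIntegral.integral_comp_div (a := 0) (b := x) (coords ψ z (W j) (Z j) q) hε.ne'
      simp only [hV, this, zero_div, Complex.real_smul]
      rw [inv_mul_cancel_left₀ (Complex.ofReal_ne_zero.2 hε.ne')]
    have h3 : ((μ j - lam0 : ℝ) : ℂ) * ∑ q, meanB ρ κ ψ p q *
        ∫ t in (0 : ℝ)..x / (α / N j), coords ψ z (W j) (Z j) q t =
        (((μ j - lam0) / (α / N j) : ℝ) : ℂ) * ∑ q, meanB ρ κ ψ p q * ∫ t in (0 : ℝ)..x, V j q t := by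
      simp only [h2, Finset.mul_sum]
      refine Finset.sum_congr rfl fun q _ => ?_
      rw [Complex.ofReal_div (μ j - lam0), div_eq_mul_inv]
      ring
    rw [h3] at h1
    simp only [hV, zero_div] at h1 ⊢
    refine h1.trans ?_
    have hv := varConst_nonneg (wron ψ z 0) hco.ρ1_nonneg hS0
    refine mul_le_mul_of_nonneg_left ?_ (abs_nonneg _)
    have h4 : |μ j - lam0| * (N j : ℝ) ≤ Kr * α := by
      calc _ ≤ Kr * (α / N j) * N j := by have := hKr j; gcongr
        _ = Kr * α := by rw [mul_assoc, hs.eps_mul]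
    have h5 : R * (varConst (wron ψ z 0) ρ1 S * |μ j - lam0| * K) * N j ≤
        R * (varConst (wron ψ z 0) ρ1 S * Kr * K) * α := by
      calc _ = R * varConst (wron ψ z 0) ρ1 S * K * (|μ j - lam0| * N j) := by ring
        _ ≤ R * varConst (wron ψ z 0) ρ1 S * K * (Kr * α) :=
            mul_le_mul_of_nonneg_left h4 (by positivity)
        _ = _ := by ring
    linarith
  · have := (hs.tendsto_sub hα).abs.mul_const
      (2 * (R * K + R * (varConst (wron ψ z 0) ρ1 S * Kr * K) * α))
    simpa using this

end IsCellSeq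

/-- The derivative of the limit profile. -/
def profileDeriv (ρ : ℝ → ℝ) (lam1 : ℝ) (κ : Fin 2 → ℝ) (ψ z u : Fin 2 → ℝ → ℂ) (q : Fin 2)
    (x : ℝ) : ℂ :=
  ∑ p, (wron ψ z 0)⁻¹ q p * (-lam1 * ∑ r, meanB ρ κ ψ p r * u r x)

theorem sum_wron_mul_profileDeriv {ρ : ℝ → ℝ} {lam1 : ℝ} {κ : Fin 2 → ℝ} {ψ z u : Fin 2 → ℝ → ℂ}
    (hdet : (wron ψ z 0).det ≠ 0) (p : Fin 2) (x : ℝ) :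
    ∑ q, (wron ψ z 0 p q * profileDeriv ρ lam1 κ ψ z u q x + lam1 * meanB ρ κ ψ p q * u q x) =
      0 := by
  have h1 : (wron ψ z 0).mulVec ((wron ψ z 0)⁻¹.mulVec
      fun p => -lam1 * ∑ r, meanB ρ κ ψ p r * u r x) =
      fun p => -lam1 * ∑ r, meanB ρ κ ψ p r * u r x := by
    rw [Matrix.mulVec_mulVec, Matrix.mul_nonsing_inv _ (isUnit_iff_ne_zero.2 hdet),
      Matrix.one_mulVec]
  have h2 : ∑ q, wron ψ z 0 p q * profileDeriv ρ lam1 κ ψ z u q x =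
      -lam1 * ∑ r, meanB ρ κ ψ p r * u r x := congrFun h1 p
  rw [Finset.sum_add_distrib, h2, Finset.mul_sum, ← Finset.sum_add_distrib]
  exact Finset.sum_eq_zero fun q _ => by ring

theorem isH1_profile {ρ : ℝ → ℝ} {α lam1 : ℝ} (hα : 0 < α) {κ : Fin 2 → ℝ}
    {ψ z u : Fin 2 → ℝ → ℂ} (hdet : (wron ψ z 0).det ≠ 0) (huc : ∀ q, Continuous (u q))
    (h : ∀ p, ∀ x ∈ Icc 0 α, ∑ q, wron ψ z 0 p q * (u q x - u q 0) +
      lam1 * ∑ q, meanB ρ κ ψ p q * ∫ t in (0 : ℝ)..x, u q t = 0) (q : Fin 2) :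
    IsH1 α (u q) (profileDeriv ρ lam1 κ ψ z u q) := by
  have hc : Continuous (profileDeriv ρ lam1 κ ψ z u q) := by
    unfold profileDeriv; fun_prop
  have hprim : IsPrim 0 α (u q) (profileDeriv ρ lam1 κ ψ z u q) := by
    refine ⟨hc.integrableOn_Icc, fun x hx => ?_⟩
    have h1 : (wron ψ z 0)⁻¹.mulVec ((wron ψ z 0).mulVec fun q => u q x - u q 0) =
        fun q => u q x - u q 0 := by
      rw [Matrix.mulVec_mulVec, Matrix.nonsing_inv_mul _ (isUnit_iff_ne_zero.2 hdet),
        Matrix.one_mulVec]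
    have h2 : u q x - u q 0 = ∑ p, (wron ψ z 0)⁻¹ q p *
        ∑ r, wron ψ z 0 p r * (u r x - u r 0) := (congrFun h1 q).symm
    have h3 : ∫ t in (0 : ℝ)..x, profileDeriv ρ lam1 κ ψ z u q t = ∑ p, (wron ψ z 0)⁻¹ q p *
        (-lam1 * ∑ r, meanB ρ κ ψ p r * ∫ t in (0 : ℝ)..x, u r t) := by
      unfold profileDeriv
      rw [intervalIntegral.integral_finsetSum fun p _ =>
        Continuous.intervalIntegrable (by fun_prop) _ _]
      refine Finset.sum_congr rfl fun p _ => ?_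
      rw [intervalIntegral.integral_const_mul, intervalIntegral.integral_const_mul,
        intervalIntegral.integral_finsetSum fun p _ =>
        Continuous.intervalIntegrable (by fun_prop) _ _]
      simp only [intervalIntegral.integral_const_mul]
    rw [h3, ← sub_eq_iff_eq_add', h2]
    refine Finset.sum_congr rfl fun p _ => ?_
    rw [eq_neg_of_add_eq_zero_left (h p x hx), neg_mul]
  refine ⟨(huc q).continuousOn, ?_, hprim.hasWeakDerivOn hα.le⟩
  obtain ⟨K, hK⟩ := (isCompact_Icc (a := (0 : ℝ)) (b := α)).exists_bound_of_continuousOn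
    hc.continuousOn
  exact MemLp.of_bound hc.aestronglyMeasurable K ((ae_restrict_iff' measurableSet_Ioo).2
    (ae_of_all _ fun y hy => hK y (Ioo_subset_Icc_self hy)))

theorem memLp_continuous_fst_mul {α : ℝ} {v : ℝ → ℂ} (hv : Continuous v) {A : ℝ × ℝ → ℂ}
    (hA : MemLp A 2 (volume.restrict (cellDomain α))) :
    MemLp (fun p => v p.1 * A p) 2 (volume.restrict (cellDomain α)) := by
  obtain ⟨K, hK⟩ := (isCompact_Icc (a := (0 : ℝ)) (b := α)).exists_bound_of_continuousOn
    hv.continuousOn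
  refine hA.of_le_mul (c := K) ((hv.comp continuous_fst).aestronglyMeasurable.mul hA.1) ?_
  filter_upwards [ae_restrict_mem (measurableSet_cellDomain α)] with p hp
  rw [norm_mul]
  gcongr
  exact hK _ (Ioo_subset_Icc_self hp.1)

/-- A sequence of cellwise functions which is uniformly close to `v (x)`, modulated by phases of
the form `1 + d ζ ^ l`, converges weakly to `v`. -/
theorem tendsto_integral_modulated {α : ℝ} (hα : 0 < α) {N : ℕ → ℕ} (hN : ∀ j, 0 < N j)
    (hε : Tendsto (fun j => α / N j) atTop (𝓝 0)) {ζ d : ℂ} (hζ : ‖ζ‖ = 1) (hζ1 : ζ ≠ 1)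
    {v : ℝ → ℂ} (hv : Continuous v) {X : ℕ → ℕ → ℝ → ℂ}
    (hXc : ∀ j, ∀ l < N j, ContinuousOn (X j l) (Icc 0 1))
    (hX : ∀ e > 0, ∀ᶠ j in atTop, ∀ p ∈ cellDomain α, ‖X j ⌊p.1 / (α / N j)⌋₊ p.2 - v p.1‖ ≤ e)
    {H : ℝ × ℝ → ℂ} (hH : MemLp H 2 (volume.restrict (cellDomain α))) :
    Tendsto (fun j => ∫ p in cellDomain α,
      stepFun (α / N j) (fun l y => (1 + d * ζ ^ l) * X j l y) p * H p) atTop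
      (𝓝 (∫ p in cellDomain α, v p.1 * H p)) := by
  have hN' : ∀ j, (0 : ℝ) < N j := fun j => by exact_mod_cast hN j
  have hε0 : ∀ j, 0 < α / N j := fun j => div_pos hα (hN' j)
  have hεN : ∀ j, α / N j * N j = α := fun j => div_mul_cancel₀ _ (hN' j).ne'
  have hfin : IsFiniteMeasure (volume.restrict (cellDomain α)) := by
    rw [restrict_cellDomain]; infer_instance
  have hvH := memLp_continuous_fst_mul hv hH
  have hHi : Integrable H (volume.restrict (cellDomain α)) := hH.integrable (by norm_num)
  have hvHi : Integrable (fun p => v p.1 * H p) (volume.restrict (cellDomain α)) :=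
    hvH.integrable (by norm_num)
  have hosc : Tendsto (fun j => ∫ p in cellDomain α,
      stepFun (α / N j) (fun l _ => ζ ^ l) p * (v p.1 * H p)) atTop (𝓝 0) := by
    refine (tendsto_integral_pow_step hα hN hε hζ hζ1 (memLp_integral_slice hvH)).congr fun j => ?_
    exact (integral_stepFun_mul (hε0 j) (hεN j) (fun l => ζ ^ l) hvH).symm
  have hi1 : ∀ j, Integrable (fun p => stepFun (α / N j)
      (fun l y => (1 + d * ζ ^ l) * X j l y) p * H p) (volume.restrict (cellDomain α)) := fun j =>
    (memLp_stepFun (hε0 j) (hεN j) fun l hl =>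
      continuousOn_const.mul (hXc j l hl)).integrable_mul hH
  have hi2 : ∀ j, Integrable (fun p => stepFun (α / N j) (fun l _ => ζ ^ l) p * (v p.1 * H p))
      (volume.restrict (cellDomain α)) := fun j =>
    (memLp_stepFun (hε0 j) (hεN j) fun l hl => continuousOn_const).integrable_mul hvH
  have hrem : Tendsto (fun j => ∫ p in cellDomain α,
      (stepFun (α / N j) (fun l y => (1 + d * ζ ^ l) * X j l y) p * H p -
        (v p.1 * H p + d * (stepFun (α / N j) (fun l _ => ζ ^ l) p * (v p.1 * H p)))))
      atTop (𝓝 0) := by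
    rw [Metric.tendsto_nhds]
    intro e he
    set M := (1 + ‖d‖) * ∫ p in cellDomain α, ‖H p‖ with hM
    have hI : 0 ≤ ∫ p in cellDomain α, ‖H p‖ := integral_nonneg fun _ => norm_nonneg _
    have hM0 : 0 ≤ M := by positivity
    filter_upwards [hX (e / (M + 1)) (by positivity)] with j hj
    rw [dist_zero_right]
    have h1 : ‖∫ p in cellDomain α,
        (stepFun (α / N j) (fun l y => (1 + d * ζ ^ l) * X j l y) p * H p -
        (v p.1 * H p + d * (stepFun (α / N j) (fun l _ => ζ ^ l) p * (v p.1 * H p))))‖ ≤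
        ∫ p in cellDomain α, (1 + ‖d‖) * (e / (M + 1)) * ‖H p‖ := by
      refine norm_integral_le_of_norm_le (hHi.norm.const_mul _) ?_
      filter_upwards [ae_restrict_mem (measurableSet_cellDomain α)] with p hp
      have h2 : stepFun (α / N j) (fun l y => (1 + d * ζ ^ l) * X j l y) p * H p -
          (v p.1 * H p + d * (stepFun (α / N j) (fun l _ => ζ ^ l) p * (v p.1 * H p))) =
          (1 + d * ζ ^ ⌊p.1 / (α / N j)⌋₊) * (X j ⌊p.1 / (α / N j)⌋₊ p.2 - v p.1) * H p := by
        simp only [stepFun]; ring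
      rw [h2, norm_mul, norm_mul]
      have h3 := hj p hp
      gcongr
      refine (norm_add_le _ _).trans ?_
      simp [hζ]
    refine h1.trans_lt ?_
    rw [integral_const_mul]
    calc _ = M * (e / (M + 1)) := by rw [hM]; ring
      _ < e := by
        rw [← mul_div_assoc, div_lt_iff₀ (by positivity)]
        nlinarith
  have htot := (hrem.add_const (∫ p in cellDomain α, v p.1 * H p)).add (hosc.const_mul d)
  rw [zero_add, mul_zero, add_zero] at htot
  refine htot.congr fun j => ?_
  have hi3 : Integrable (fun p => v p.1 * H p +
      d * (stepFun (α / N j) (fun l _ => ζ ^ l) p * (v p.1 * H p)))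
      (volume.restrict (cellDomain α)) := hvHi.add ((hi2 j).const_mul d)
  rw [integral_sub (hi1 j) hi3,
    integral_add hvHi ((hi2 j).const_mul d), integral_const_mul]
  ring

namespace IsCellSeq

variable {a ρ : ℝ → ℝ} {a0 a1 ρ1 α lam0 lam1 : ℝ} {N : ℕ → ℕ} {μ : ℕ → ℝ} {W Z : ℕ → ℝ → ℂ}
  {κ : Fin 2 → ℝ} {ψ z : Fin 2 → ℝ → ℂ} {u : Fin 2 → ℝ → ℂ}

/-- Weak convergence of the transforms to the two-scale limit given by the profiles. -/
theorem tendsto_integral_unfold (hs : IsCellSeq a ρ α lam0 lam1 N μ W Z) (hα : 0 < α)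
    (hco : PeriodicCoeff a ρ a0 a1 ρ1) (hb : IsBlochBasis a ρ lam0 κ ψ z)
    (huc : ∀ q, Continuous (u q))
    (hu : ∀ q, TendstoUniformlyOn (fun j x => coords ψ z (W j) (Z j) q (x / (α / N j)))
      (u q) atTop (Icc 0 α)) {c : ℕ → ℂ} {d ζ : Fin 2 → ℂ} (hζ : ∀ q, ‖ζ q‖ = 1)
    (hζ1 : ∀ q, ζ q ≠ 1) (hc : ∀ q (l : ℕ), c l * phase (κ q) l = 1 + d q * ζ q ^ l)
    {A B : ℝ × ℝ → ℂ} (hA : MemLp A 2 (volume.restrict (cellDomain α)))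
    (hB : MemLp B 2 (volume.restrict (cellDomain α))) :
    Tendsto (fun j => ∫ p in cellDomain α,
      (stepFun (α / N j) (fun l y => c l * W j (l + y)) p * A p +
        stepFun (α / N j) (fun l y => c l * (Z j (l + y) / a y)) p * B p)) atTop
      (𝓝 (∫ p in cellDomain α, ((∑ q, u q p.1 * ψ q p.2) * A p +
        (∑ q, u q p.1 * (z q p.2 / a p.2)) * B p))) := by
  have hε0 := hs.eps_pos hα
  have hεN := hs.eps_mul
  have hfin : IsFiniteMeasure (volume.restrict (cellDomain α)) := by
    rw [restrict_cellDomain]; infer_instance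
  obtain ⟨K, hK0, hK⟩ := hs.exists_coords_bound hα hco hb
  set H : Fin 2 → ℝ × ℝ → ℂ := fun q p => ψ q p.2 * A p + z q p.2 / a p.2 * B p with hH
  have hHm : ∀ q, MemLp (H q) 2 (volume.restrict (cellDomain α)) := fun q =>
    (memLp_continuousOn_snd_mul (hb.sol q).continuous.continuousOn hA).add
      (memLp_continuousOn_snd_mul ((hb.sol q).continuous_div hco).continuousOn hB)
  set X : Fin 2 → ℕ → ℕ → ℝ → ℂ := fun q j l y => coords ψ z (W j) (Z j) q (l + y) with hX
  have hXc : ∀ q j, ∀ l < N j, ContinuousOn (X q j l) (Icc 0 1) := fun q j l hl => by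
    have hl' : (l + 1 : ℝ) ≤ N j := by exact_mod_cast hl
    exact (continuousOn_coords (fun q => (hb.sol q).sol 0 (N j)) (hs.sol j).sol
      (Nat.cast_nonneg _) q).comp (by fun_prop) fun y hy =>
      ⟨by have := hy.1; positivity, by linarith [hy.2]⟩
  have hclose : ∀ q, ∀ e > 0, ∀ᶠ j in atTop, ∀ p ∈ cellDomain α,
      ‖X q j ⌊p.1 / (α / N j)⌋₊ p.2 - u q p.1‖ ≤ e := by
    intro q e he
    have h1 : Tendsto (fun j => K * (α / N j)) atTop (𝓝 0) := by
      simpa using hs.eps.const_mul K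
    filter_upwards [Metric.tendstoUniformlyOn_iff.1 (hu q) (e / 2) (by positivity),
      h1.eventually_lt_const (show (0 : ℝ) < e / 2 by positivity)] with j hj hj' p hp
    have hx : p.1 ∈ Icc 0 α := Ioo_subset_Icc_self hp.1
    have hl := floor_lt_of_mem (hε0 j) (hεN j) hp.1
    have hl' : (⌊p.1 / (α / N j)⌋₊ + 1 : ℝ) ≤ N j := by exact_mod_cast hl
    have h2 := hj p.1 hx
    rw [dist_comm, dist_eq_norm] at h2
    have hm := hs.div_eps_mem hα j hx
    have h3 := ((hK j).2 q _ hm).2 (⌊p.1 / (α / N j)⌋₊ + p.2)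
      ⟨by have := hp.2.1; positivity, by linarith [hp.2.2]⟩
    have h4 : |(⌊p.1 / (α / N j)⌋₊ : ℝ) + p.2 - p.1 / (α / N j)| ≤ 1 := by
      have h5 := Nat.floor_le hm.1
      have h6 := Nat.lt_floor_add_one (p.1 / (α / N j))
      have h7 := hp.2.1
      have h8 := hp.2.2
      rw [abs_le]
      constructor <;> linarith
    have h9 : K * (α / N j) * |(⌊p.1 / (α / N j)⌋₊ : ℝ) + p.2 - p.1 / (α / N j)| ≤ e / 2 := by
      have := mul_le_mul_of_nonneg_left h4 (mul_nonneg hK0 (hε0 j).le)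
      linarith
    calc _ = ‖(X q j ⌊p.1 / (α / N j)⌋₊ p.2 - coords ψ z (W j) (Z j) q (p.1 / (α / N j))) +
          (coords ψ z (W j) (Z j) q (p.1 / (α / N j)) - u q p.1)‖ := by rw [sub_add_sub_cancel]
      _ ≤ e / 2 + e / 2 := (norm_add_le _ _).trans (add_le_add (h3.trans h9) h2.le)
      _ = e := by ring
  have key := tendsto_finsetSum Finset.univ fun q _ => tendsto_integral_modulated hα
    (fun j => (hs.sol j).N_pos) hs.eps (d := d q) (hζ q) (hζ1 q) (huc q) (hXc q) (hclose q) (hHm q)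
  have hlim : ∑ q, ∫ p in cellDomain α, u q p.1 * H q p =
      ∫ p in cellDomain α, ((∑ q, u q p.1 * ψ q p.2) * A p +
        (∑ q, u q p.1 * (z q p.2 / a p.2)) * B p) := by
    rw [← integral_finsetSum _ fun q _ =>
      (memLp_continuous_fst_mul (huc q) (hHm q)).integrable (by norm_num)]
    congr 1
    ext p
    simp only [hH, Fin.sum_univ_two]
    ring
  rw [hlim] at key
  refine key.congr fun j => ?_
  have hi : ∀ q, Integrable (fun p => stepFun (α / N j)
      (fun l y => (1 + d q * ζ q ^ l) * X q j l y) p * H q p) (volume.restrict (cellDomain α)) :=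
    fun q => (memLp_stepFun (hε0 j) (hεN j) fun l hl =>
      continuousOn_const.mul (hXc q j l hl)).integrable_mul (hHm q)
  rw [← integral_finsetSum _ fun q _ => hi q]
  refine setIntegral_congr_fun (measurableSet_cellDomain α) fun p hp => ?_
  set l := ⌊p.1 / (α / N j)⌋₊ with hl
  obtain ⟨s1, s2⟩ := coords_spec (hb.det_wron_ne (l + p.2)) (W j) (Z j)
  have q1 : ∀ q, ψ q (l + p.2) = ψ q p.2 * phase (κ q) l := fun q => by
    have := (hb.sol q).qp p.2 l
    rwa [add_comm, Int.cast_natCast] at this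
  have q2 : ∀ q, z q (l + p.2) = z q p.2 * phase (κ q) l := fun q => by
    have := (hb.sol q).qpz p.2 l
    rwa [add_comm, Int.cast_natCast] at this
  simp only [stepFun, ← hl, s1, s2, q1, q2, ← hc, hH, hX, Fin.sum_univ_two]
  ring

end IsCellSeq

theorem WeakTendstoL2H1.comp {α : ℝ} {G : ℕ → ℝ × ℝ → ℂ} {g : ℝ × ℝ → ℂ}
    (h : WeakTendstoL2H1 α G g) {s : ℕ → ℕ} (hs : StrictMono s) :
    WeakTendstoL2H1 α (fun j => G (s j)) g := by
  obtain ⟨DG, Dg, h1, h2, h3⟩ := h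
  exact ⟨fun j => DG (s j), Dg, fun j => h1 (s j), h2,
    fun V DV hV => (h3 V DV hV).comp hs.tendsto_atTop⟩

/-- Identification of the weak limits of the transforms in terms of a Bloch basis. -/
theorem IsCellSeq.exists_twoScale_limit {a ρ : ℝ → ℝ} {a0 a1 ρ1 α lam0 lam1 : ℝ} {N : ℕ → ℕ}
    {μ : ℕ → ℝ} {W Z : ℕ → ℝ → ℂ} {κ : Fin 2 → ℝ} {ψ z : Fin 2 → ℝ → ℂ}
    (hs : IsCellSeq a ρ α lam0 lam1 N μ W Z) (hα : 0 < α) (hco : PeriodicCoeff a ρ a0 a1 ρ1)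
    (hb : IsBlochBasis a ρ lam0 κ ψ z) {c : ℕ → ℂ} {d ζ θ : Fin 2 → ℂ} (hζ : ∀ q, ‖ζ q‖ = 1)
    (hζ1 : ∀ q, ζ q ≠ 1) (hc : ∀ q (l : ℕ), c l * phase (κ q) l = 1 + d q * ζ q ^ l)
    (hθ : ∀ q, Tendsto (fun j => phase (κ q) (N j)) atTop (𝓝 (θ q)))
    {G : ℕ → ℝ × ℝ → ℂ} {g : ℝ × ℝ → ℂ}
    (hG : ∀ j, G j =ᵐ[volume.restrict (cellDomain α)]
      stepFun (α / N j) (fun l y => c l * W j (l + y))) (hg : WeakTendstoL2H1 α G g) :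
    ∃ u u' : Fin 2 → ℝ → ℂ, (∀ q, IsH1 α (u q) (u' q)) ∧
      (∀ᵐ p ∂(volume.restrict (cellDomain α)), g p = ∑ q, u q p.1 * ψ q p.2) ∧
      (∀ p x, ∑ q, (coeffC a (ψ p) (ψ q) * u' q x + lam1 * meanB ρ κ ψ p q * u q x) = 0) ∧
      ∑ q, u q 0 * ψ q 0 = 0 ∧ ∑ q, u q α * (ψ q 0 * θ q) = 0 ∧
      ((∀ j, ∀ y ∈ Icc (0 : ℝ) (N j),
        coords ψ z (W j) (Z j) 1 y = conj (coords ψ z (W j) (Z j) 0 y)) →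
        ∀ x ∈ Icc 0 α, u 1 x = conj (u 0 x)) := by
  obtain ⟨s, u, hsm, huc, hu⟩ := hs.exists_profile hα hco hb
  have hs' := hs.comp hsm
  have hεN := hs'.eps_mul
  have heq := fun (p : Fin 2) (x : ℝ) (hx : x ∈ Icc 0 α) => hs'.profile_eq hα hco hb hu p hx
  have h0 : (0 : ℝ) ∈ Icc 0 α := ⟨le_rfl, hα.le⟩
  have hα' : α ∈ Icc 0 α := ⟨hα.le, le_rfl⟩
  refine ⟨u, profileDeriv ρ lam1 κ ψ z u, isH1_profile hα hb.det_ne huc heq, ?_, fun p x => ?_, ?_,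
    ?_, fun hre x hx => ?_⟩
  · have hm : ∀ q, MemLp (u q) 2 (volume.restrict (Ioo 0 α)) := fun q => by
      obtain ⟨K, hK⟩ := (isCompact_Icc (a := (0 : ℝ)) (b := α)).exists_bound_of_continuousOn
        (huc q).continuousOn
      exact MemLp.of_bound (huc q).aestronglyMeasurable K ((ae_restrict_iff' measurableSet_Ioo).2
        (ae_of_all _ fun y hy => hK y (Ioo_subset_Icc_self hy)))
    have hd : ∀ q, MemLp (fun y => z q y / a y) 2 (volume.restrict (Ioo (0 : ℝ) 1)) := fun q => by
      have hcd := (hb.sol q).continuous_div hco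
      obtain ⟨K, hK⟩ := (isCompact_Icc (a := (0 : ℝ)) (b := 1)).exists_bound_of_continuousOn
        hcd.continuousOn
      exact MemLp.of_bound hcd.aestronglyMeasurable K ((ae_restrict_iff' measurableSet_Ioo).2
        (ae_of_all _ fun y hy => hK y (Ioo_subset_Icc_self hy)))
    exact (hg.comp hsm).ae_eq (fun j => hG (s j)) (fun j => (hs'.sol j).isL2H1 hα hco c)
      (IsL2H1.sum Finset.univ fun q _ => IsL2H1.tensor (hm q) ((hb.sol q).sol 0 1).fst (hd q))
      fun A B hA hB => hs'.tendsto_integral_unfold hα hco hb huc hu hζ hζ1 hc hA hB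
  · simp only [coeffC_eq_wron hco hb.sol]
    exact sum_wron_mul_profileDeriv hb.det_ne p x
  · refine tendsto_nhds_unique (tendsto_finsetSum Finset.univ fun q _ =>
      ((hu q).tendsto_at h0).mul_const (ψ q 0)) (tendsto_const_nhds.congr fun j => ?_)
    rw [← (hs'.sol j).zero_left, zero_div]
    exact (coords_spec (hb.det_wron_ne 0) (W (s j)) (Z (s j))).1
  · refine tendsto_nhds_unique (tendsto_finsetSum Finset.univ fun q _ =>
      ((hu q).tendsto_at hα').mul (((hθ q).comp hsm.tendsto_atTop).const_mul (ψ q 0)))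
      (tendsto_const_nhds.congr fun j => ?_)
    have hN : α / (α / N (s j)) = N (s j) := by
      rw [div_div_eq_mul_div, mul_comm, mul_div_cancel_right₀ _ hα.ne']
    have hsp := (coords_spec (hb.det_wron_ne (N (s j))) (W (s j)) (Z (s j))).1
    rw [← (hs'.sol j).zero_right, hN]
    refine hsp.trans (Finset.sum_congr rfl fun q _ => ?_)
    have := (hb.sol q).qp 0 (N (s j))
    rw [zero_add, Int.cast_natCast] at this
    rw [this]
    rfl
  · refine tendsto_nhds_unique ((hu 1).tendsto_at hx) ?_
    refine ((Complex.continuous_conj.tendsto _).comp ((hu 0).tendsto_at hx)).congr fun j => ?_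
    exact (hre (s j) _ (hs'.div_eps_mem hα j hx)).symm

/-- A solution with real values has a real flux. -/
theorem IsSol.conj_snd_eq {a ρ : ℝ → ℝ} {a0 a1 ρ1 μ A B : ℝ} (hco : PeriodicCoeff a ρ a0 a1 ρ1)
    {f z : ℝ → ℂ} (h : IsSol a ρ μ A B f z) (hAB : A < B)
    (hf : ∀ y ∈ Icc A B, conj (f y) = f y) : ∀ y ∈ Icc A B, conj (z y) = z y := by
  have hc := h.snd.continuousOn
  have hcc : ContinuousOn (fun y => conj (z y)) (Icc A B) :=
    Complex.continuous_conj.comp_continuousOn hc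
  have ha : ∀ y, (a y : ℂ) ≠ 0 := fun y => Complex.ofReal_ne_zero.2 (hco.a_pos y).ne'
  have hd := h.star.fst.sub h.fst
  have hdc : ContinuousOn (fun y => conj (z y) / (a y : ℂ) - z y / a y) (Icc A B) :=
    (hcc.div (Complex.continuous_ofReal.comp hco.continuous_a).continuousOn fun y _ => ha y).sub
      (hc.div (Complex.continuous_ofReal.comp hco.continuous_a).continuousOn fun y _ => ha y)
  have hin : EqOn (fun y => conj (z y)) z (Ioo A B) := fun y hy => by
    have h1 := hd.hasDerivAt hdc hy
    have h2 : HasDerivAt (fun y => conj (f y) - f y) 0 y :=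
      (hasDerivAt_const y (0 : ℂ)).congr_of_eventuallyEq (by
        filter_upwards [Icc_mem_nhds hy.1 hy.2] with t ht
        rw [hf t ht, sub_self])
    have h3 := h1.unique h2
    have := ha y
    rw [← sub_div, div_eq_zero_iff, or_iff_left this] at h3
    exact sub_eq_zero.1 h3
  have hcl : Icc A B ⊆ closure (Ioo A B) := by rw [closure_Ioo hAB.ne]
  exact hin.of_subset_closure hcc hc Ioo_subset_Icc_self hcl

theorem coords_conj {φ ζ W Z : ℝ → ℂ} {y : ℝ}
    (hdet : (wron ![φ, conjFun φ] ![ζ, conjFun ζ] y).det ≠ 0) (hW : conj (W y) = W y)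
    (hZ : conj (Z y) = Z y) :
    coords ![φ, conjFun φ] ![ζ, conjFun ζ] W Z 1 y =
      conj (coords ![φ, conjFun φ] ![ζ, conjFun ζ] W Z 0 y) := by
  obtain ⟨h1, h2⟩ := coords_spec hdet W Z
  set U := coords ![φ, conjFun φ] ![ζ, conjFun ζ] W Z with hU
  refine coords_unique (c := ![conj (U 1 y), conj (U 0 y)]) hdet ?_ ?_ 1
  · rw [← hW, h1]
    simp [Fin.sum_univ_two, conjFun, add_comm]
  · rw [← hZ, h2]
    simp [Fin.sum_univ_two, conjFun, add_comm]

theorem IsBlochSol.isBlochBasis_conj {a ρ : ℝ → ℝ} {a0 a1 ρ1 k lam : ℝ} {φ z : ℝ → ℂ}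
    (h : IsBlochSol a ρ k lam φ z) (hco : PeriodicCoeff a ρ a0 a1 ρ1)
    (hk : |2 * k| < 1) (hk0 : k ≠ 0) {y₀ : ℝ} (hy₀ : 0 ≤ y₀) (hφ : φ y₀ ≠ 0) :
    IsBlochBasis a ρ lam ![k, -k] ![φ, conjFun φ] ![z, conjFun z] := by
  have hsol : ∀ q : Fin 2, IsBlochSol a ρ (![k, -k] q) lam (![φ, conjFun φ] q)
      (![z, conjFun z] q) := Fin.forall_fin_two.2 ⟨h, h.star⟩
  have h2k : phase (2 * k) 1 ≠ 1 := phase_one_ne_one hk (by simpa using hk0)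
  have hm2k : phase (-(2 * k)) 1 ≠ 1 := phase_one_ne_one (by rwa [abs_neg]) (by simpa using hk0)
  refine ⟨hsol, det_wron_ne_zero hco (fun q A B => (hsol q).sol A B) fun c hc => ?_, ?_⟩
  · have e1 := hc y₀ hy₀
    have e2 := hc (y₀ + 1) (by linarith)
    have q1 := h.qp y₀ 1
    have q2 := h.star.qp y₀ 1
    rw [Int.cast_one] at q1 q2
    simp only [Fin.sum_univ_two, Matrix.cons_val_zero, Matrix.cons_val_one] at e1 e2
    rw [q1, q2] at e2
    have hne : phase k 1 - phase (-k) 1 ≠ 0 := fun h0 => h2k (by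
      rw [two_mul, ← phase_mul]
      nth_rewrite 1 [sub_eq_zero.1 h0]
      rw [phase_mul, neg_add_cancel, phase_zero_left])
    have hcφ : conjFun φ y₀ ≠ 0 := by simpa [conjFun] using hφ
    have c0 : c 0 * (φ y₀ * (phase k 1 - phase (-k) 1)) = 0 := by
      linear_combination e2 - phase (-k) 1 * e1
    have c1 : c 1 * (conjFun φ y₀ * (phase k 1 - phase (-k) 1)) = 0 := by
      linear_combination phase k 1 * e1 - e2
    exact funext (Fin.forall_fin_two.2 ⟨(mul_eq_zero.1 c0).resolve_right (mul_ne_zero hφ hne),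
      (mul_eq_zero.1 c1).resolve_right (mul_ne_zero hcφ hne)⟩)
  · have e1 : -k - k = -(2 * k) := by ring
    have e2 : k - -k = 2 * k := by ring
    refine Fin.forall_fin_two.2 ⟨Fin.forall_fin_two.2 ⟨?_, ?_⟩, Fin.forall_fin_two.2 ⟨?_, ?_⟩⟩ <;>
      simp [e1, e2, h2k, hm2k]

theorem isBlochBasis_of_linearIndependent {a ρ : ℝ → ℝ} {a0 a1 ρ1 lam : ℝ} {φ z : Fin 2 → ℝ → ℂ}
    (hco : PeriodicCoeff a ρ a0 a1 ρ1) (h : ∀ q, IsBlochSol a ρ 0 lam (φ q) (z q))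
    (hli : LinearIndependent ℂ φ) : IsBlochBasis a ρ lam (fun _ => 0) φ z := by
  refine ⟨h, det_wron_ne_zero hco (fun q A B => (h q).sol A B) fun c hc => ?_,
    fun p q hpq => absurd rfl hpq⟩
  refine funext (Fintype.linearIndependent_iff.1 hli c (funext fun y => ?_))
  have hy : 0 ≤ y + (⌈|y|⌉₊ : ℤ) := by
    have h1 := Nat.le_ceil |y|
    have h2 := neg_abs_le y
    push_cast
    linarith
  have h1 := hc _ hy
  simp only [(h _).qp, phase_zero_left, mul_one] at h1
  simpa using h1

theorem phaseSum_zero (l : ℕ) : phaseSum 0 l = 1 := by simp [phaseSum, phase_zero_left]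

theorem phaseSum_eq {k : ℝ} (hk : k ≠ 0) (l : ℕ) : phaseSum k l = phase (-k) l + phase k l := by
  have : k ≠ -k := fun h => hk (by linarith)
  rw [phaseSum, Finset.sum_pair this, neg_neg]

theorem phase_eq_exp_fract (k : ℝ) (n : ℤ) :
    phase k n = Complex.exp ((2 * Real.pi * Int.fract (k * n) : ℝ) * Complex.I) := by
  rw [phase, Complex.exp_eq_exp_iff_exists_int]
  refine ⟨⌊k * n⌋, ?_⟩
  rw [Int.fract]
  push_cast
  ring

theorem IsCellSeq.of_eigenpairs {a ρ : ℝ → ℝ} {a0 a1 ρ1 α lam0 lam1 : ℝ} (hα : 0 < α)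
    (hco : PeriodicCoeff a ρ a0 a1 ρ1) {ε : ℕ → ℝ} {N : ℕ → ℕ} (hN : ∀ j, 0 < N j)
    (hεN : ∀ j, ε j = α / N j) (hε : Tendsto ε atTop (𝓝 0)) {lamε : ℕ → ℝ} {w : ℕ → ℝ → ℂ}
    (hw : ∀ j, IsDirichletEigenpair α (fun x => a (x / ε j)) (fun x => ρ (x / ε j)) (lamε j) (w j))
    (hlam : (fun j => ε j ^ 2 * lamε j - (lam0 + ε j * lam1)) =o[atTop] ε) :
    ∃ Z : ℕ → ℝ → ℂ, IsCellSeq a ρ α lam0 lam1 N (fun j => ε j ^ 2 * lamε j)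
      (fun j y => w j (ε j * y)) Z := by
  choose Z hZ using fun j => (hw j).exists_isCellSol hα hco (hN j) (hεN j)
  refine ⟨Z, hZ, hε.congr hεN, ?_⟩
  have hne : ∀ j, ε j ≠ 0 := fun j => by
    rw [hεN]; exact (div_pos hα (by exact_mod_cast hN j)).ne'
  have h1 := hlam.tendsto_div_nhds_zero.add_const lam1
  rw [zero_add] at h1
  refine h1.congr fun j => ?_
  rw [← hεN]
  have := hne j
  field_simp
  ring

theorem tendsto_phase_of_fract {k l : ℝ} {n : ℕ → ℤ}
    (h : Tendsto (fun j => Int.fract (k * n j)) atTop (𝓝 l)) :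
    Tendsto (fun j => phase k (n j)) atTop
      (𝓝 (Complex.exp ((2 * Real.pi * l : ℝ) * Complex.I))) := by
  simp only [phase_eq_exp_fract]
  have : Continuous fun t : ℝ => Complex.exp ((2 * Real.pi * t : ℝ) * Complex.I) := by fun_prop
  exact (this.tendsto l).comp h

theorem IsBlochMode.exists_ne_zero {a ρ : ℝ → ℝ} {k lam : ℝ} {φ : ℝ → ℂ}
    (h : IsBlochMode a ρ k lam φ) : ∃ y, 0 ≤ y ∧ φ y ≠ 0 := by
  by_contra! hne
  have h1 := h.norm_eq
  rw [setIntegral_congr_fun (g := fun _ => (0 : ℝ)) measurableSet_Ioo fun y hy => by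
    simp [hne y hy.1.le]] at h1
  simp at h1

end BlochHom

end

open BlochHom in
theorem mainTheorem1
    (α : ℝ) (hα : 0 < α)
    -- the periodic coefficients
    (a ρ : ℝ → ℝ) (a0 a1 ρ0 ρ1 : ℝ) (ha0 : 0 < a0) (hρ0 : 0 < ρ0)
    (haLip : ∃ K, LipschitzWith K a) (haPer : Function.Periodic a 1)
    (haBd : ∀ y, a0 ≤ a y ∧ a y ≤ a1)
    (hρMeas : AEStronglyMeasurable ρ volume) (hρPer : ∀ᵐ y, ρ (y + 1) = ρ y)
    (hρBd : ∀ᵐ y, ρ0 ≤ ρ y ∧ ρ y ≤ ρ1)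
    (k : ℝ) (hk : k ∈ Ioo (-1 / 2 : ℝ) (1 / 2))
    -- the sequence of the small parameters: `(0,α)` is a union of entire cells of size `ε j`
    (ε : ℕ → ℝ) (hεcell : ∀ j, ∃ N : ℕ, 0 < N ∧ ε j = α / N) (hε : Tendsto ε atTop (𝓝 0))
    -- the eigenpairs of the physical problem
    (lamε : ℕ → ℝ) (w : ℕ → ℝ → ℂ)
    (hw : ∀ j, IsDirichletEigenpair α (fun x => a (x / ε j)) (fun x => ρ (x / ε j)) (lamε j) (w j))
    (lam0 lam1 : ℝ)
    (hlam : (fun j => ε j ^ 2 * lamε j - (lam0 + ε j * lam1)) =o[atTop] ε) :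
    BoundedL2H1 α (fun j => twoScaleSum α (ε j) k (w j)) ∧
    ∀ l : ℝ, Tendsto (fun j => Int.fract (α * k / ε j)) atTop (𝓝 l) →
      -- `S_k^ε w^ε` has a non-vanishing weak limit (possibly along a subsequence only)
      (∃ (s : ℕ → ℕ) (wk : ℝ × ℝ → ℂ), StrictMono s ∧
        WeakTendstoL2H1 α (fun j => twoScale α (ε (s j)) k (w (s j))) wk ∧
        ¬ (∀ᵐ p ∂(volume.restrict (cellDomain α)), wk p = 0)) →
      IsBlochEigenvalue a ρ k lam0 ∧
      ∀ (s : ℕ → ℕ) (g : ℝ × ℝ → ℂ), StrictMono s →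
        WeakTendstoL2H1 α (fun j => twoScaleSum α (ε (s j)) k (w (s j))) g →
        -- case `k ≠ 0`, with `φ = φ^k` and `conjFun φ = φ^{-k}`
        (k ≠ 0 → ∀ φ : ℝ → ℂ, IsBlochMode a ρ k lam0 φ →
          ∃ up up' um um' : ℝ → ℂ, IsH1 α up up' ∧ IsH1 α um um' ∧
            (∀ᵐ p ∂(volume.restrict (cellDomain α)),
              g p = up p.1 * φ p.2 + um p.1 * conjFun φ p.2) ∧
            (∀ᵐ x ∂(volume.restrict (Ioo 0 α)),
              coeffC a φ φ * up' x + lam1 * coeffB ρ φ φ * up x = 0) ∧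
            (∀ᵐ x ∂(volume.restrict (Ioo 0 α)),
              coeffC a (conjFun φ) (conjFun φ) * um' x
                + lam1 * coeffB ρ (conjFun φ) (conjFun φ) * um x = 0) ∧
            (∀ x ∈ ({0, α} : Set ℝ),
              up x * φ 0 * Complex.exp ((2 * Real.pi * (l * x / α) : ℝ) * Complex.I)
                + um x * conjFun φ 0 *
                  Complex.exp (-(2 * Real.pi * (l * x / α) : ℝ) * Complex.I) = 0) ∧
            ((∀ j, ∀ x ∈ Ioo 0 α, (w j x).im = 0) → ∀ x ∈ Icc 0 α, um x = conj (up x))) ∧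
        -- case `k = 0`, with a double eigenvalue
        (k = 0 → ∀ φ : Fin 2 → ℝ → ℂ, (∀ q, IsBlochMode a ρ k lam0 (φ q)) →
          LinearIndependent ℂ φ →
          ∃ u u' : Fin 2 → ℝ → ℂ, (∀ q, IsH1 α (u q) (u' q)) ∧
            (∀ᵐ p ∂(volume.restrict (cellDomain α)), g p = ∑ q, u q p.1 * φ q p.2) ∧
            (∀ p, ∀ᵐ x ∂(volume.restrict (Ioo 0 α)),
              ∑ q, (coeffC a (φ p) (φ q) * u' q x + lam1 * coeffB ρ (φ p) (φ q) * u q x) = 0) ∧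
            (∀ x ∈ ({0, α} : Set ℝ), ∑ q, u q x * φ q 0 = 0)) := by
  have hco : PeriodicCoeff a ρ a0 a1 ρ1 := ⟨ha0, haLip, haPer, fun y => (haBd y).1,
    fun y => (haBd y).2, hρMeas, hρPer, hρBd.mono fun y hy => by
      rw [abs_of_pos (hρ0.trans_le hy.1)]; exact hy.2⟩
  choose N hN hεN using hεcell
  obtain ⟨Z, hs⟩ := IsCellSeq.of_eigenpairs hα hco hN hεN hε hw hlam
  have hε0 : ∀ j, 0 < ε j := fun j => by rw [hεN]; exact hs.eps_pos hα j
  have hεmul : ∀ j, ε j * N j = α := fun j => by rw [hεN]; exact hs.eps_mul j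
  have hsum : ∀ j, twoScaleSum α (ε j) k (w j) =ᵐ[volume.restrict (cellDomain α)]
      stepFun (α / N j) (fun l y => phaseSum k l * w j (ε j * (l + y))) := fun j => by
    have := twoScaleSum_ae_eq (hε0 j) (hεmul j) k (w j)
    rwa [← hεN]
  refine ⟨?_, fun l hl hex => ⟨?_, fun s g hsm hg => ⟨fun hk0 φ hφ => ?_, fun hk0 φ hφ hli => ?_⟩⟩⟩
  · obtain ⟨K, hK0, hK⟩ := hs.exists_bound hα
    refine ⟨2 ^ 2 + 2 ^ 2 * (a1 * K * ρ1 / a0 ^ 2), fun j =>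
      ⟨_, ((hs.sol j).isL2H1 hα hco (phaseSum k)).congr (hsum j).symm (ae_eq_refl _), ?_⟩⟩
    obtain ⟨h1, h2⟩ := (hs.sol j).norm_sq_le hα hco (norm_phaseSum_le k)
    have h3 : ∫ p in cellDomain α, ‖twoScaleSum α (ε j) k (w j) p‖ ^ 2 =
        ∫ p in cellDomain α, ‖stepFun (α / N j)
          (fun l y => phaseSum k l * w j (ε j * (l + y))) p‖ ^ 2 :=
      integral_congr_ae ((hsum j).mono fun p hp => by simp only [hp])
    rw [h3]
    refine add_le_add h1 (h2.trans ?_)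
    have h4 := hco.a1_pos
    have h5 := hco.ρ1_nonneg
    have h6 := hK j
    gcongr
  · obtain ⟨s, wk, hsm, hwk, hne⟩ := hex
    have hone : ∀ j, twoScale α (ε j) k (w j) =ᵐ[volume.restrict (cellDomain α)]
        stepFun (α / N j) (fun l y => phase (-k) l * w j (ε j * (l + y))) := fun j => by
      have := twoScale_ae_eq (hε0 j) (hεmul j) k (w j)
      rwa [← hεN]
    exact (hs.comp hsm).isBlochEigenvalue hα hco (fun j => hone (s j)) hwk hne
  · obtain ⟨z, hz⟩ := hφ.exists_isBlochSol hco
    obtain ⟨y₀, hy₀, hφ₀⟩ := hφ.exists_ne_zero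
    have hk2 : |2 * k| < 1 := by
      rw [abs_lt]; constructor <;> linarith [hk.1, hk.2]
    have hk0' : 2 * k ≠ 0 := by simpa using hk0
    have hb := hz.isBlochBasis_conj hco hk2 hk0 hy₀ hφ₀
    have hfr : Tendsto (fun j => Int.fract (k * ((N (s j) : ℤ) : ℝ))) atTop (𝓝 l) := by
      refine (hl.comp hsm.tendsto_atTop).congr fun j => ?_
      simp only [Function.comp]
      congr 1
      rw [Int.cast_natCast, div_eq_iff (hε0 _).ne', ← hεmul (s j)]
      ring
    have hθ := tendsto_phase_of_fract hfr
    obtain ⟨u, u', hH1, hgu, hode, hb0, hbα, hreal⟩ := (hs.comp hsm).exists_twoScale_limit hα hco hb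
      (c := phaseSum k) (d := fun _ => 1) (ζ := ![phase (2 * k) 1, phase (-(2 * k)) 1])
      (θ := ![Complex.exp ((2 * Real.pi * l : ℝ) * Complex.I),
        conj (Complex.exp ((2 * Real.pi * l : ℝ) * Complex.I))])
      (Fin.forall_fin_two.2 ⟨norm_phase _ _, norm_phase _ _⟩)
      (Fin.forall_fin_two.2 ⟨phase_one_ne_one hk2 hk0',
        phase_one_ne_one (by rwa [abs_neg]) (neg_ne_zero.2 hk0')⟩)
      (Fin.forall_fin_two.2 ⟨fun n => by
          change phaseSum k n * phase k n = 1 + 1 * phase (2 * k) 1 ^ n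
          rw [phaseSum_eq hk0, ← phase_eq_pow, add_mul, phase_mul, phase_mul, neg_add_cancel,
            phase_zero_left, two_mul, one_mul], fun n => by
          change phaseSum k n * phase (-k) n = 1 + 1 * phase (-(2 * k)) 1 ^ n
          rw [phaseSum_eq hk0, ← phase_eq_pow, add_mul, phase_mul, phase_mul, add_neg_cancel,
            phase_zero_left, two_mul, one_mul, neg_add, add_comm]⟩)
      (Fin.forall_fin_two.2 ⟨hθ, by
        refine ((Complex.continuous_conj.tendsto _).comp hθ).congr fun j => ?_
        exact (phase_neg k _).symm⟩)
      (fun j => hsum (s j)) hg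
    have hkk : k ≠ -k := fun h => hk0 (by linarith)
    have c01 : coeffC a φ (conjFun φ) = 0 := by
      have := coeffC_eq_wron hco hb.sol 0 1
      simp only [Matrix.cons_val_zero, Matrix.cons_val_one] at this
      rw [this]
      simp [wron, conjFun]
      ring
    have c10 : coeffC a (conjFun φ) φ = 0 := by
      have := coeffC_eq_wron hco hb.sol 1 0
      simp only [Matrix.cons_val_zero, Matrix.cons_val_one] at this
      rw [this]
      simp [wron, conjFun]
      ring
    refine ⟨u 0, u' 0, u 1, u' 1, hH1 0, hH1 1, ?_, ae_of_all _ fun x => ?_,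
      ae_of_all _ fun x => ?_, ?_, fun hre x hx => ?_⟩
    · filter_upwards [hgu] with p hp
      simpa [Fin.sum_univ_two] using hp
    · have := hode 0 x
      simpa [Fin.sum_univ_two, meanB, hkk, c01] using this
    · have := hode 1 x
      simpa [Fin.sum_univ_two, meanB, hkk.symm, c10] using this
    · rintro x (rfl | rfl)
      · simpa [Fin.sum_univ_two] using hb0
      · have h1 : l * x / x = l := mul_div_cancel_right₀ _ hα.ne'
        have h2 : conj (Complex.exp ((2 * Real.pi * l : ℝ) * Complex.I)) =
            Complex.exp (-(2 * Real.pi * l : ℝ) * Complex.I) := by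
          rw [← Complex.exp_conj, map_mul, Complex.conj_ofReal, Complex.conj_I, mul_neg, neg_mul]
        rw [h1, ← h2]
        simp only [Fin.sum_univ_two, Matrix.cons_val_zero, Matrix.cons_val_one] at hbα
        linear_combination hbα
    · refine hreal (fun j y hy => ?_) x hx
      have hsol := (hs.sol (s j)).sol
      have hNp : (0 : ℝ) < N (s j) := by exact_mod_cast hN (s j)
      have hWre : ∀ y ∈ Icc (0 : ℝ) (N (s j)),
          conj (w (s j) (ε (s j) * y)) = w (s j) (ε (s j) * y) := fun y hy => by
        rcases eq_endpoints_or_mem_Ioo_of_mem_Icc hy with rfl | rfl | hy'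
        · rw [(hs.sol (s j)).zero_left, map_zero]
        · rw [(hs.sol (s j)).zero_right, map_zero]
        · refine Complex.conj_eq_iff_im.2 (hre _ _ ⟨mul_pos (hε0 _) hy'.1, ?_⟩)
          rw [← hεmul (s j)]
          exact mul_lt_mul_of_pos_left hy'.2 (hε0 _)
      exact coords_conj (hb.det_wron_ne y) (hWre y hy) (hsol.conj_snd_eq hco hNp hWre y hy)
  · subst hk0
    choose z hz using fun q => (hφ q).exists_isBlochSol hco
    have hb := isBlochBasis_of_linearIndependent hco hz hli
    obtain ⟨u, u', hH1, hgu, hode, hb0, hbα, -⟩ := (hs.comp hsm).exists_twoScale_limit hα hco hb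
      (c := phaseSum 0) (d := fun _ => 0) (ζ := fun _ => -1) (θ := fun _ => 1) (fun q => by simp)
      (fun q => by norm_num) (fun q n => by simp [phaseSum_zero, phase_zero_left])
      (fun q => by simp [phase_zero_left]) (fun j => hsum (s j)) hg
    refine ⟨u, u', hH1, hgu, fun p => ae_of_all _ fun x => ?_, ?_⟩
    · simpa [meanB] using hode p x
    · rintro x (rfl | rfl)
      · exact hb0
      · simpa using hbα
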